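/- **Conventions.** A C*-category is a $\mathbb C$-linear category with Banach Hom spaces, $\|fg\|\le\|f\|\,\|g\|$, and an anti-linear involution $*$ satisfying the C*-identity and such that each $f^*f$ is positive; it is assumed closed under finite direct sums and subobjects. C*-functors are linear and $*$-preserving. A C*-tensor category is a monoidal C*-category with bilinear $*$-preserving tensor product, unitary structure isomorphisms and $\operatorname{End}(\mathbf 1)=\mathbb C\,\mathrm{id}_{\mathbf 1}\neq0$. A *solution* (of the conjugate equations) for $X$ is $(X,\bar X,R,\bar R)$ with $R:\mathbf 1\to\bar X\otimes X$, $\bar R:\mathbf 1\to X\otimes\bar X$, $(\mathrm{id}_X\otimes R^*)(\bar R\otimes\mathrm{id}_X)=\mathrm{id}_X$ and $(\mathrm{id}_{\bar X}\otimes\bar R^*)(R\otimes\mathrm{id}_{\bar X})=\mathrm{id}_{\bar X}$; a category is *rigid* if every object has a solution. Put $d(X)=\inf\|R\|\,\|\bar R\|$ over all solutions for $X$; a solution is *norm-standard* if $\|R\|^2=\|\bar R\|^2=d(X)$. Let $\mathcal C,\mathcal D$ be rigid C*-tensor categories, $\Theta:\mathcal D\to\mathcal C$ a C*-tensor functor (monoidal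 C*-functor with unitary structure maps), and $\mathcal M$ a $\mathcal C$-module category: a C*-category with finite-dimensional Hom spaces and an action $\mathcal C\times\mathcal M\to\mathcal M$ by a C*-bifunctor with coherent unitary structure isomorphisms. Let $(\operatorname{tr}_X)_{X\in\mathcal M}$ be a $\mathcal C$-module trace: positive linear maps $\operatorname{tr}_X:\operatorname{End}(X)\to\mathbb C$ with $\operatorname{tr}_X(g^*f)=\operatorname{tr}_Y(fg^*)$ for $f,g:X\to Y$, with $\operatorname{tr}_{U\otimes X}(T)=\operatorname{tr}_X\big((R^*\otimes\mathrm{id}_X)(\mathrm{id}_{\bar U}\otimes T)(R\otimes\mathrm{id}_X)\big)$ for every norm-standard solution $(U,\bar U,R,\bar R)$ in $\mathcal C$ and $T\in\operatorname{End}(U\otimes X)$, and with $d(X):=\operatorname{tr}_X(\mathrm{id}_X)\ne0$ for irreducible $X$. Assume that the set $\operatorname{Irr}\mathcal M$ of isomorphism classes of irreducible objects is finite. Let $[\mathcal M,\mathcal M]_{\mathrm b}$ be the category of C*-functors $\mathcal M\to\mathcal M$ and uniformly bounded natural transformations, with $F\otimes G=F\circ G$, componentwise adjoint and the uniform norm.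 Let $\mathcal D$ act on $\mathcal M$ through $\Theta$, and let $[\mathcal M,\mathcal M]^{\mathcal D}_{\mathrm b}$ be the category of $\mathcal D$-module endofunctors $(F,f)$, where $F$ is a C*-functor and $f_{U,X}:F(\Theta(U)\otimes X)\to\Theta(U)\otimes F(X)$ is a coherent unitary natural transformation, with bounded natural transformations intertwining the $f$'s, and tensor product, adjoint and norm as before. For $a\in\operatorname{End}_{\mathrm b}(\mathrm{id}_{\mathcal M})$ let $\omega(a)=\sum_{i\in\operatorname{Irr}\mathcal M}d(i)^2a_i$, where $a$ acts on $i$ by the scalar $a_i$. A solution $(F,\bar F,R,\bar R)$ in $[\mathcal M,\mathcal M]_{\mathrm b}$ (resp. $[\mathcal M,\mathcal M]^{\mathcal D}_{\mathrm b}$) is *standard* if $$\omega\big(R^*(\mathrm{id}\otimes\eta)R\big)=\omega\big(\bar R^*(\eta\otimes\mathrm{id})\bar R\big)$$ for all positive endomorphisms $\eta$ of $F$ in that category. **Theorem.** The category $[\mathcal M,\mathcal M]^{\mathcal D}_{\mathrm b}$ is rigid. Every standard solution in $[\mathcal M,\mathcal M]^{\mathcal D}_{\mathrm b}$ is also standard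 in $[\mathcal M,\mathcal M]_{\mathrm b}$. Moreover, if the unit object of $[\mathcal M,\mathcal M]^{\mathcal D}_{\mathrm b}$ has only scalar endomorphisms (so that the norm definition of standardness applies there), every norm-standard solution in $[\mathcal M,\mathcal M]^{\mathcal D}_{\mathrm b}$ is also standard in $[\mathcal M,\mathcal M]_{\mathrm b}$. -/

import Mathlib

open CategoryTheory MonoidalCategory
open scoped MonoidalLeftAction ComplexOrder

noncomputable section

namespace CStarCat

universe v u v₁ u₁ v₂ u₂ v₃ u₃

/-! ### Dagger categories, C*-categories and C*-functors -/

/-- A category with an involution `f ↦ f†` on morphisms, reversing arrows and fixing objects. -/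
class DaggerCategory (C : Type u) [Category.{v} C] where
  /-- The adjoint of a morphism. -/
  dagger {X Y : C} (f : X ⟶ Y) : Y ⟶ X
  dagger_dagger {X Y : C} (f : X ⟶ Y) : dagger (dagger f) = f
  dagger_comp {X Y Z : C} (f : X ⟶ Y) (g : Y ⟶ Z) :
    dagger (f ≫ g) = dagger g ≫ dagger f

postfix:max "†" => DaggerCategory.dagger

attribute [simp] DaggerCategory.dagger_dagger DaggerCategory.dagger_comp

@[simp]
theorem dagger_id {C : Type u} [Category.{v} C] [DaggerCategory C] (X : C) :
    (𝟙 X)† = 𝟙 X := by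
  have h : (𝟙 X ≫ (𝟙 X)†)† = 𝟙 X ≫ (𝟙 X)† := by
    rw [DaggerCategory.dagger_comp, DaggerCategory.dagger_dagger]
  rwa [Category.id_comp, DaggerCategory.dagger_dagger, eq_comm] at h

/-- A unitary morphism: `f* f = 1` and `f f* = 1`. -/
def IsUnitary {C : Type u} [Category.{v} C] [DaggerCategory C] {X Y : C} (f : X ⟶ Y) : Prop :=
  f ≫ f† = 𝟙 X ∧ f† ≫ f = 𝟙 Y

/-- A C*-category, closed under (finite) direct sums and subobjects.  The composition of
`f : X ⟶ Y` and `g : Y ⟶ Z` is written `f ≫ g`, so the operator product `f* f` is `f ≫ f†`. -/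
class CStarCategory (C : Type u) [Category.{v} C] extends DaggerCategory C where
  homNormed (X Y : C) : NormedAddCommGroup (X ⟶ Y)
  homNormedSpace (X Y : C) : NormedSpace ℂ (X ⟶ Y)
  homComplete (X Y : C) : CompleteSpace (X ⟶ Y)
  add_comp {X Y Z : C} (f f' : X ⟶ Y) (g : Y ⟶ Z) : (f + f') ≫ g = f ≫ g + f' ≫ g
  comp_add {X Y Z : C} (f : X ⟶ Y) (g g' : Y ⟶ Z) : f ≫ (g + g') = f ≫ g + f ≫ g'
  smul_comp {X Y Z : C} (c : ℂ) (f : X ⟶ Y) (g : Y ⟶ Z) : (c • f) ≫ g = c • (f ≫ g)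
  comp_smul {X Y Z : C} (c : ℂ) (f : X ⟶ Y) (g : Y ⟶ Z) : f ≫ (c • g) = c • (f ≫ g)
  dagger_add {X Y : C} (f g : X ⟶ Y) : (f + g)† = f† + g†
  dagger_smul {X Y : C} (c : ℂ) (f : X ⟶ Y) : (c • f)† = (starRingEnd ℂ c) • f†
  norm_comp_le {X Y Z : C} (f : X ⟶ Y) (g : Y ⟶ Z) : ‖f ≫ g‖ ≤ ‖f‖ * ‖g‖
  /-- The C*-identity. -/
  norm_dagger_comp {X Y : C} (f : X ⟶ Y) : ‖f ≫ f†‖ = ‖f‖ ^ 2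
  /-- `f* f` is positive in the C*-algebra of endomorphisms of `X`. -/
  positive {X Y : C} (f : X ⟶ Y) : ∃ g : X ⟶ X, f ≫ f† = g ≫ g†
  /-- Direct sums. -/
  exists_directSum (X Y : C) : ∃ (Z : C) (u : X ⟶ Z) (v : Y ⟶ Z),
    u ≫ u† = 𝟙 X ∧ v ≫ v† = 𝟙 Y ∧ u† ≫ u + v† ≫ v = 𝟙 Z
  /-- Every projection is the range projection of an isometry. -/
  exists_subobject {X : C} (p : X ⟶ X) (hp : p ≫ p = p) (hp' : p† = p) :
    ∃ (Y : C) (v : Y ⟶ X), v ≫ v† = 𝟙 Y ∧ v† ≫ v = p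

attribute [reducible, instance] CStarCategory.homNormed CStarCategory.homNormedSpace
attribute [instance] CStarCategory.homComplete

/-- A C*-functor: linear on Hom spaces and compatible with adjoints. -/
class IsCStarFunctor {C : Type u₁} [Category.{v₁} C] [CStarCategory C]
    {D : Type u₂} [Category.{v₂} D] [CStarCategory D] (F : C ⥤ D) : Prop where
  map_add {X Y : C} (f g : X ⟶ Y) : F.map (f + g) = F.map f + F.map g
  map_smul {X Y : C} (c : ℂ) (f : X ⟶ Y) : F.map (c • f) = c • F.map f
  map_dagger {X Y : C} (f : X ⟶ Y) : F.map f† = (F.map f)†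

/-! A C*-functor is automatically norm-decreasing; this is needed for whiskerings of bounded
natural transformations to be bounded. -/

section Contractive

variable {C : Type u₁} [Category.{v₁} C] [CStarCategory C]

/-- The ring of endomorphisms of an object, with `f * g` the composite of `g` followed by `f`. -/
@[reducible]
def endNormedRing (X : C) : NormedRing (X ⟶ X) :=
  { CStarCategory.homNormed X X with
    mul := fun f g => g ≫ f
    one := 𝟙 X
    mul_assoc := fun f g h => (Category.assoc h g f).symm
    one_mul := fun f => Category.comp_id f
    mul_one := fun f => Category.id_comp f
    left_distrib := fun f g h => CStarCategory.add_comp g h f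
    right_distrib := fun f g h => CStarCategory.comp_add h f g
    zero_mul := fun f => by
      have h := CStarCategory.comp_smul (0 : ℂ) f (0 : X ⟶ X)
      rw [zero_smul, zero_smul] at h
      exact h
    mul_zero := fun f => by
      have h := CStarCategory.smul_comp (0 : ℂ) (0 : X ⟶ X) f
      rw [zero_smul, zero_smul] at h
      exact h
    norm_mul_le := fun f g => by
      have h := CStarCategory.norm_comp_le g f
      rw [mul_comm] at h
      exact h }

/-- The algebra structure on the endomorphisms of an object. -/
@[reducible]
def endAlgebra (X : C) : @Algebra ℂ (X ⟶ X) _ (endNormedRing X).toRing.toSemiring :=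
  letI := endNormedRing X
  { smul := fun c f => c • f
    algebraMap :=
      { toFun := fun c => c • 𝟙 X
        map_one' := one_smul _ _
        map_mul' := fun a b => by
          change (a * b) • 𝟙 X = (b • 𝟙 X) ≫ (a • 𝟙 X)
          rw [CStarCategory.comp_smul, Category.comp_id, mul_smul]
        map_zero' := zero_smul _ _
        map_add' := fun a b => add_smul _ _ _ }
    commutes' := fun c f => by
      change f ≫ (c • 𝟙 X) = (c • 𝟙 X) ≫ f
      rw [CStarCategory.comp_smul, CStarCategory.smul_comp, Category.comp_id, Category.id_comp]
    smul_def' := fun c f => by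
      change c • f = f ≫ (c • 𝟙 X)
      rw [CStarCategory.comp_smul, Category.comp_id] }

/-- The C*-algebra structure on the endomorphisms of an object. -/
@[reducible]
def endCStarAlgebra (X : C) : CStarAlgebra (X ⟶ X) :=
  { endNormedRing X, endAlgebra X, CStarCategory.homComplete X X with
    star := fun f => f†
    star_involutive := fun f => DaggerCategory.dagger_dagger f
    star_mul := fun f g => DaggerCategory.dagger_comp g f
    star_add := fun f g => CStarCategory.dagger_add f g
    norm_mul_self_le := fun f => by
      have h := CStarCategory.norm_dagger_comp f
      rw [sq] at h
      exact h.ge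
    star_smul := fun c f => CStarCategory.dagger_smul c f
    norm_smul_le := fun c f => (norm_smul c f).le }

theorem IsCStarFunctor.norm_map_le {D : Type u₂} [Category.{v₂} D] [CStarCategory D]
    (F : C ⥤ D) [IsCStarFunctor F] {X Y : C} (f : X ⟶ Y) : ‖F.map f‖ ≤ ‖f‖ := by
  have key : ∀ g : X ⟶ X, ‖F.map g‖ ≤ ‖g‖ := by
    intro g
    let := endCStarAlgebra X
    let := endCStarAlgebra (F.obj X)
    let φ : (X ⟶ X) →⋆ₙₐ[ℂ] (F.obj X ⟶ F.obj X) :=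
      { toFun := fun h => F.map h
        map_smul' := fun c h => IsCStarFunctor.map_smul c h
        map_zero' := by
          have h := IsCStarFunctor.map_smul (F := F) (0 : ℂ) (𝟙 X)
          simpa only [zero_smul] using h
        map_add' := fun h k => IsCStarFunctor.map_add h k
        map_mul' := fun h k => F.map_comp k h
        map_star' := fun h => IsCStarFunctor.map_dagger h }
    exact NonUnitalStarAlgHom.norm_apply_le φ g
  have h := key (f ≫ f†)
  rw [F.map_comp, IsCStarFunctor.map_dagger, CStarCategory.norm_dagger_comp,
    CStarCategory.norm_dagger_comp] at h
  exact le_of_sq_le_sq h (norm_nonneg _)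

theorem norm_dagger {X Y : C} (f : X ⟶ Y) : ‖f†‖ = ‖f‖ := by
  have key : ∀ {X Y : C} (f : X ⟶ Y), ‖f‖ ≤ ‖f†‖ := by
    intro X Y f
    have h1 := CStarCategory.norm_dagger_comp f
    have h2 := CStarCategory.norm_comp_le f f†
    by_contra hlt
    push Not at hlt
    have h3 : 0 ≤ ‖f†‖ := norm_nonneg _
    nlinarith
  refine le_antisymm ?_ (key f)
  simpa using key f†

end Contractive

/-! ### Conjugate equations in a monoidal category with involution -/

section Conjugate

variable {C : Type u} [Category.{v} C] [DaggerCategory C] [MonoidalCategory C]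

/-- `(X, X', R, R')` is a solution of the conjugate equations
`(id ⊗ R*)(R' ⊗ id) = id_X` and `(id ⊗ R'*)(R ⊗ id) = id_X'`. -/
structure IsConjugateSolution (X X' : C) (R : 𝟙_ C ⟶ X' ⊗ X) (R' : 𝟙_ C ⟶ X ⊗ X') : Prop where
  left_eq : (λ_ X).inv ≫ R' ▷ X ≫ (α_ X X' X).hom ≫ X ◁ R† ≫ (ρ_ X).hom = 𝟙 X
  right_eq : (λ_ X').inv ≫ R ▷ X' ≫ (α_ X' X X').hom ≫ X' ◁ R'† ≫ (ρ_ X').hom = 𝟙 X'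

variable (C) in
/-- Every object is rigid, i.e. admits a solution of the conjugate equations. -/
def IsRigid : Prop :=
  ∀ X : C, ∃ (X' : C) (R : 𝟙_ C ⟶ X' ⊗ X) (R' : 𝟙_ C ⟶ X ⊗ X'), IsConjugateSolution X X' R R'

/-- The categorical dimension: the least value of `‖R‖ ‖R'‖` over all solutions of the
conjugate equations for `X`. -/
def categoricalDim [∀ X Y : C, Norm (X ⟶ Y)] (X : C) : ℝ :=
  sInf {d : ℝ | ∃ (X' : C) (R : 𝟙_ C ⟶ X' ⊗ X) (R' : 𝟙_ C ⟶ X ⊗ X'),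
    IsConjugateSolution X X' R R' ∧ d = ‖R‖ * ‖R'‖}

/-- A standard solution: `‖R‖ ^ 2 = ‖R'‖ ^ 2 = d(X)`. -/
structure IsStandardSolution [∀ X Y : C, Norm (X ⟶ Y)] (X X' : C)
    (R : 𝟙_ C ⟶ X' ⊗ X) (R' : 𝟙_ C ⟶ X ⊗ X') : Prop where
  solution : IsConjugateSolution X X' R R'
  norm_left : ‖R‖ ^ 2 = categoricalDim X
  norm_right : ‖R'‖ ^ 2 = categoricalDim X

variable (C) in
/-- The unit object has only scalar endomorphisms. -/
def HasSimpleUnit [∀ X Y : C, SMul ℂ (X ⟶ Y)] : Prop :=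
  ∀ f : 𝟙_ C ⟶ 𝟙_ C, ∃ c : ℂ, f = c • 𝟙 (𝟙_ C)

end Conjugate

/-- A C*-tensor category (not necessarily strict, with unitary structure isomorphisms),
with simple unit. -/
class CStarTensorCategory (C : Type u) [Category.{v} C] [CStarCategory C]
    [MonoidalCategory C] : Prop where
  whiskerLeft_add (X : C) {Y Z : C} (f g : Y ⟶ Z) : X ◁ (f + g) = X ◁ f + X ◁ g
  whiskerLeft_smul (X : C) {Y Z : C} (c : ℂ) (f : Y ⟶ Z) : X ◁ (c • f) = c • X ◁ f
  whiskerLeft_dagger (X : C) {Y Z : C} (f : Y ⟶ Z) : X ◁ f† = (X ◁ f)†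
  add_whiskerRight {Y Z : C} (f g : Y ⟶ Z) (X : C) : (f + g) ▷ X = f ▷ X + g ▷ X
  smul_whiskerRight {Y Z : C} (c : ℂ) (f : Y ⟶ Z) (X : C) : (c • f) ▷ X = c • f ▷ X
  dagger_whiskerRight {Y Z : C} (f : Y ⟶ Z) (X : C) : f† ▷ X = (f ▷ X)†
  associator_unitary (X Y Z : C) : IsUnitary (α_ X Y Z).hom
  leftUnitor_unitary (X : C) : IsUnitary (λ_ X).hom
  rightUnitor_unitary (X : C) : IsUnitary (ρ_ X).hom
  unit_ne_zero : 𝟙 (𝟙_ C) ≠ 0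
  unit_simple : HasSimpleUnit C

/-- A C*-tensor functor: a monoidal C*-functor with unitary structure isomorphisms. -/
class IsCStarTensorFunctor {D : Type u₁} [Category.{v₁} D] [CStarCategory D] [MonoidalCategory D]
    {C : Type u₂} [Category.{v₂} C] [CStarCategory C] [MonoidalCategory C]
    (Θ : D ⥤ C) [Θ.Monoidal] : Prop extends IsCStarFunctor Θ where
  unit_unitary : IsUnitary (Functor.LaxMonoidal.ε Θ)
  tensor_unitary (U V : D) : IsUnitary (Functor.LaxMonoidal.μ Θ U V)

/-! ### Module categories -/

/-- A C*-category `M` with a left action of `C` which is a semisimple `C`-module C*-category: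
the action is a C*-bifunctor, its structure isomorphisms are unitary, and the Hom spaces of `M`
are finite dimensional. -/
class CStarModuleCategory (C : Type u₁) [Category.{v₁} C] [CStarCategory C] [MonoidalCategory C]
    (M : Type u₂) [Category.{v₂} M] [CStarCategory M] [MonoidalLeftAction C M] : Prop where
  actionRight_add (U : C) {X Y : M} (f g : X ⟶ Y) : U ⊴ₗ (f + g) = U ⊴ₗ f + U ⊴ₗ g
  actionRight_smul (U : C) {X Y : M} (c : ℂ) (f : X ⟶ Y) : U ⊴ₗ (c • f) = c • U ⊴ₗ f
  actionRight_dagger (U : C) {X Y : M} (f : X ⟶ Y) : U ⊴ₗ f† = (U ⊴ₗ f)†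
  actionLeft_add {U V : C} (f g : U ⟶ V) (X : M) : (f + g) ⊵ₗ X = f ⊵ₗ X + g ⊵ₗ X
  actionLeft_smul {U V : C} (c : ℂ) (f : U ⟶ V) (X : M) : (c • f) ⊵ₗ X = c • f ⊵ₗ X
  actionLeft_dagger {U V : C} (f : U ⟶ V) (X : M) : f† ⊵ₗ X = (f ⊵ₗ X)†
  actionAssoc_unitary (U V : C) (X : M) : IsUnitary (αₗ U V X).hom
  actionUnit_unitary (X : M) : IsUnitary (λₗ[C] X).hom
  finiteDimensional (X Y : M) : FiniteDimensional ℂ (X ⟶ Y)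

theorem actionAssocIso_actionRight_assoc {C : Type u₁} [Category.{v₁} C] [MonoidalCategory C]
    {M : Type u₂} [Category.{v₂} M] [MonoidalLeftAction C M] (U : C) {V W : C} (f : V ⟶ W)
    (X : M) {Y : M} (h : U ⊙ₗ W ⊙ₗ X ⟶ Y) :
    (αₗ U V X).hom ≫ U ⊴ₗ f ⊵ₗ X ≫ h = (U ◁ f) ⊵ₗ X ≫ (αₗ U W X).hom ≫ h := by
  simp

/-- The restriction of a `C`-action along a monoidal functor `Θ : D ⥤ C`:
`U` acts on `X` by `Θ(U) ⊗ X`. -/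
@[reducible]
def restrictAction {D : Type u₁} [Category.{v₁} D] [MonoidalCategory D]
    {C : Type u₂} [Category.{v₂} C] [MonoidalCategory C] (Θ : D ⥤ C) [Θ.Monoidal]
    (M : Type u₃) [Category.{v₃} M] [MonoidalLeftAction C M] : MonoidalLeftAction D M where
  actionObj U X := Θ.obj U ⊙ₗ X
  actionHomLeft f X := Θ.map f ⊵ₗ X
  actionHomRight U _ _ f := Θ.obj U ⊴ₗ f
  actionHom f g := Θ.map f ⊙ₗₘ g
  actionAssocIso U V X :=
    { hom := Functor.OplaxMonoidal.δ Θ U V ⊵ₗ X ≫ (αₗ (Θ.obj U) (Θ.obj V) X).hom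
      inv := (αₗ (Θ.obj U) (Θ.obj V) X).inv ≫ Functor.LaxMonoidal.μ Θ U V ⊵ₗ X
      hom_inv_id := by simp [← MonoidalLeftAction.comp_actionHomLeft]
      inv_hom_id := by simp [← MonoidalLeftAction.comp_actionHomLeft_assoc] }
  actionUnitIso X :=
    { hom := Functor.OplaxMonoidal.η Θ ⊵ₗ X ≫ (λₗ X).hom
      inv := (λₗ X).inv ≫ Functor.LaxMonoidal.ε Θ ⊵ₗ X
      hom_inv_id := by simp [← MonoidalLeftAction.comp_actionHomLeft]
      inv_hom_id := by simp [← MonoidalLeftAction.comp_actionHomLeft_assoc] }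
  actionHom_def f g := MonoidalLeftAction.actionHom_def _ _
  actionHomRight_id _ _ := by simp
  id_actionHomLeft _ _ := by simp
  actionHom_comp _ _ _ _ := by simp
  actionAssocIso_hom_naturality f g h := by
    simp only [Category.assoc, ← MonoidalLeftAction.actionAssocIso_hom_naturality]
    rw [← MonoidalLeftAction.actionHom_id, ← MonoidalLeftAction.actionHom_id,
      ← MonoidalLeftAction.actionHom_comp_assoc, ← MonoidalLeftAction.actionHom_comp_assoc,
      Functor.OplaxMonoidal.δ_natural, Category.id_comp, Category.comp_id]
  actionUnitIso_hom_naturality f := by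
    rw [Category.assoc, MonoidalLeftAction.actionUnitIso_hom_naturality,
      ← MonoidalLeftAction.action_exchange_assoc]
  whiskerLeft_actionHomLeft U _ _ f X := by
    simp only [Functor.Monoidal.map_whiskerLeft, MonoidalLeftAction.comp_actionHomLeft,
      MonoidalLeftAction.whiskerLeft_actionHomLeft, Category.assoc]
  whiskerRight_actionHomLeft V f X := by
    simp only [Functor.Monoidal.map_whiskerRight, MonoidalLeftAction.comp_actionHomLeft,
      MonoidalLeftAction.whiskerRight_actionHomLeft, Category.assoc]
  associator_actionHom U V W X := by
    have h := congrArg (fun t => t ⊵ₗ X) (Functor.OplaxMonoidal.associativity Θ U V W)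
    simp only [MonoidalLeftAction.comp_actionHomLeft] at h
    have h1 := MonoidalLeftAction.associator_actionHom (Θ.obj U) (Θ.obj V) (Θ.obj W) X
    simp only [MonoidalLeftAction.actionHomRight_comp, Category.assoc,
      actionAssocIso_actionRight_assoc, MonoidalLeftAction.actionHomLeft_action,
      Iso.hom_inv_id_assoc]
    rw [← h1, reassoc_of% h]
  leftUnitor_actionHom U X := by
    have h := congrArg (fun t => t ⊵ₗ X) (Functor.Monoidal.map_leftUnitor Θ U)
    simp only [MonoidalLeftAction.comp_actionHomLeft,
      MonoidalLeftAction.leftUnitor_actionHom] at h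
    simp only [Category.assoc, MonoidalLeftAction.actionHomLeft_action,
      Iso.hom_inv_id_assoc]
    rw [h]
  rightUnitor_actionHom U X := by
    have h := congrArg (fun t => t ⊵ₗ X) (Functor.Monoidal.map_rightUnitor Θ U)
    simp only [MonoidalLeftAction.comp_actionHomLeft,
      MonoidalLeftAction.rightUnitor_actionHom] at h
    simp only [MonoidalLeftAction.actionHomRight_comp, Category.assoc,
      actionAssocIso_actionRight_assoc]
    rw [h]

/-! ### Bounded endofunctors -/

/-- An object of `[M, M]_b`: a C*-functor `M ⥤ M`. -/
structure BddEnd (M : Type u) [Category.{v} M] [CStarCategory M] where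
  toFunctor : M ⥤ M
  isCStar : IsCStarFunctor toFunctor

attribute [instance] BddEnd.isCStar

namespace BddEnd

variable {M : Type u} [Category.{v} M] [CStarCategory M]

/-- A morphism of `[M, M]_b`: a uniformly bounded natural transformation. -/
@[ext]
structure Hom (F G : BddEnd M) where
  natTrans : F.toFunctor ⟶ G.toFunctor
  bounded : ∃ K : ℝ, ∀ X : M, ‖natTrans.app X‖ ≤ K

instance : Category (BddEnd M) where
  Hom := Hom
  id F := ⟨𝟙 F.toFunctor, by
    refine ⟨1, fun X => ?_⟩
    have h := CStarCategory.norm_dagger_comp (𝟙 (F.toFunctor.obj X))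
    rw [dagger_id, Category.id_comp] at h
    have h0 := norm_nonneg (𝟙 (F.toFunctor.obj X))
    change ‖𝟙 (F.toFunctor.obj X)‖ ≤ 1
    nlinarith⟩
  comp η ζ := ⟨η.natTrans ≫ ζ.natTrans, by
    obtain ⟨K, hK⟩ := η.bounded
    obtain ⟨L, hL⟩ := ζ.bounded
    refine ⟨K * L, fun X => ?_⟩
    have hK0 : 0 ≤ K := (norm_nonneg _).trans (hK X)
    exact (CStarCategory.norm_comp_le _ _).trans
      (mul_le_mul (hK X) (hL X) (norm_nonneg _) hK0)⟩

/-- The component of a bounded natural transformation at an object. -/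
def app {F G : BddEnd M} (η : F ⟶ G) (X : M) : F.toFunctor.obj X ⟶ G.toFunctor.obj X :=
  η.natTrans.app X

theorem hom_ext {F G : BddEnd M} {η ζ : F ⟶ G} (h : ∀ X, app η X = app ζ X) : η = ζ :=
  Hom.ext (NatTrans.ext (funext h))

@[simp] theorem id_app (F : BddEnd M) (X : M) : app (𝟙 F) X = 𝟙 (F.toFunctor.obj X) := rfl

@[simp] theorem comp_app {F G H : BddEnd M} (η : F ⟶ G) (ζ : G ⟶ H) (X : M) :
    app (η ≫ ζ) X = app η X ≫ app ζ X := rfl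

theorem naturality {F G : BddEnd M} (η : F ⟶ G) {X Y : M} (f : X ⟶ Y) :
    F.toFunctor.map f ≫ app η Y = app η X ≫ G.toFunctor.map f :=
  η.natTrans.naturality f

/-- The adjoint of a bounded natural transformation, taken componentwise. -/
instance : DaggerCategory (BddEnd M) where
  dagger {F G} η :=
    ⟨{ app := fun X => (app η X)†
       naturality := fun X Y f => by
        have h := congrArg (fun t => t†) (naturality η f†)
        simpa [IsCStarFunctor.map_dagger] using h.symm }, by
      obtain ⟨K, hK⟩ := η.bounded
      exact ⟨K, fun X => (norm_dagger _).trans_le (hK X)⟩⟩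
  dagger_dagger η := hom_ext fun X => DaggerCategory.dagger_dagger (app η X)
  dagger_comp η ζ := hom_ext fun X => DaggerCategory.dagger_comp (app η X) (app ζ X)

@[simp] theorem dagger_app {F G : BddEnd M} (η : F ⟶ G) (X : M) : app η† X = (app η X)† := rfl

/-- Scalar multiples of bounded natural transformations. -/
instance (F G : BddEnd M) : SMul ℂ (F ⟶ G) where
  smul c η :=
    ⟨{ app := fun X => c • app η X
       naturality := fun X Y f => by
        rw [CStarCategory.comp_smul, CStarCategory.smul_comp, naturality] }, by
      obtain ⟨K, hK⟩ := η.bounded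
      refine ⟨‖c‖ * K, fun X => ?_⟩
      change ‖c • app η X‖ ≤ _
      rw [norm_smul]
      exact mul_le_mul_of_nonneg_left (hK X) (norm_nonneg c)⟩

@[simp] theorem smul_app {F G : BddEnd M} (c : ℂ) (η : F ⟶ G) (X : M) :
    app (c • η) X = c • app η X := rfl

/-- The uniform norm. -/
instance (F G : BddEnd M) : Norm (F ⟶ G) where
  norm η := ⨆ X : M, ‖app η X‖

instance idIsCStar : IsCStarFunctor (𝟭 M) where
  map_add _ _ := rfl
  map_smul _ _ := rfl
  map_dagger _ := rfl

instance compIsCStar (G F : M ⥤ M) [IsCStarFunctor G] [IsCStarFunctor F] :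
    IsCStarFunctor (G ⋙ F) where
  map_add f g := by simp [IsCStarFunctor.map_add]
  map_smul c f := by simp [IsCStarFunctor.map_smul]
  map_dagger f := by simp [IsCStarFunctor.map_dagger]

/-- Build a morphism from a natural transformation whose components are unitary. -/
def ofNatTrans {F G : BddEnd M} (η : F.toFunctor ⟶ G.toFunctor)
    (h : ∀ X, η.app X ≫ (η.app X)† = 𝟙 _) : F ⟶ G :=
  ⟨η, by
    refine ⟨1, fun X => ?_⟩
    have h1 := CStarCategory.norm_dagger_comp (η.app X)
    have h2 := CStarCategory.norm_dagger_comp (𝟙 (F.toFunctor.obj X))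
    rw [h X] at h1
    rw [dagger_id, Category.id_comp] at h2
    have h0 := norm_nonneg (𝟙 (F.toFunctor.obj X))
    have h3 := norm_nonneg (η.app X)
    have h4 : ‖𝟙 (F.toFunctor.obj X)‖ ≤ 1 := by nlinarith
    nlinarith⟩

/-- An isomorphism from a natural isomorphism with unitary components. -/
@[simps]
def isoOfNatIso {F G : BddEnd M} (e : F.toFunctor ≅ G.toFunctor)
    (h : ∀ X, IsUnitary (e.hom.app X)) : F ≅ G where
  hom := ofNatTrans e.hom fun X => (h X).1
  inv := ofNatTrans e.inv fun X => by
    have h1 : (e.hom.app X)† = e.inv.app X := by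
      rw [← cancel_epi (e.hom.app X), (h X).1, Iso.hom_inv_id_app]
    rw [← h1, DaggerCategory.dagger_dagger, (h X).2]
  hom_inv_id := hom_ext fun X => e.hom_inv_id_app X
  inv_hom_id := hom_ext fun X => e.inv_hom_id_app X

/-- The tensor product of `[M, M]_b` is composition of functors: `(F ⊗ G)(X) = F(G(X))`. -/
instance : MonoidalCategoryStruct (BddEnd M) where
  tensorObj F G := ⟨G.toFunctor ⋙ F.toFunctor, inferInstance⟩
  tensorUnit := ⟨𝟭 M, inferInstance⟩
  whiskerLeft F G G' η :=
    ⟨Functor.whiskerRight η.natTrans F.toFunctor, by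
      obtain ⟨K, hK⟩ := η.bounded
      exact ⟨K, fun X => (IsCStarFunctor.norm_map_le F.toFunctor _).trans (hK X)⟩⟩
  whiskerRight {F F'} η G :=
    ⟨Functor.whiskerLeft G.toFunctor η.natTrans, by
      obtain ⟨K, hK⟩ := η.bounded
      exact ⟨K, fun X => hK _⟩⟩
  associator F G H := isoOfNatIso
    (Functor.associator H.toFunctor G.toFunctor F.toFunctor).symm
    fun X => by simp [IsUnitary]
  leftUnitor F := isoOfNatIso (Functor.rightUnitor F.toFunctor) fun X => by simp [IsUnitary]
  rightUnitor F := isoOfNatIso (Functor.leftUnitor F.toFunctor) fun X => by simp [IsUnitary]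
  tensorHom {F F' G G'} η ζ :=
    ⟨Functor.whiskerLeft G.toFunctor η.natTrans ≫ Functor.whiskerRight ζ.natTrans F'.toFunctor, by
      obtain ⟨K, hK⟩ := η.bounded
      obtain ⟨L, hL⟩ := ζ.bounded
      refine ⟨K * L, fun X => ?_⟩
      have hK0 : 0 ≤ K := (norm_nonneg _).trans (hK X)
      exact (CStarCategory.norm_comp_le _ _).trans (mul_le_mul (hK _)
        ((IsCStarFunctor.norm_map_le F'.toFunctor _).trans (hL X)) (norm_nonneg _) hK0)⟩

@[simp] theorem tensorObj_obj (F G : BddEnd M) (X : M) :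
    (F ⊗ G).toFunctor.obj X = F.toFunctor.obj (G.toFunctor.obj X) := rfl

@[simp] theorem tensorUnit_obj (X : M) : (𝟙_ (BddEnd M)).toFunctor.obj X = X := rfl

@[simp] theorem whiskerLeft_app (F : BddEnd M) {G G' : BddEnd M} (η : G ⟶ G') (X : M) :
    app (F ◁ η) X = F.toFunctor.map (app η X) := rfl

@[simp] theorem whiskerRight_app {F F' : BddEnd M} (η : F ⟶ F') (G : BddEnd M) (X : M) :
    app (η ▷ G) X = app η (G.toFunctor.obj X) := rfl

@[simp] theorem tensorHom_app {F F' G G' : BddEnd M} (η : F ⟶ F') (ζ : G ⟶ G') (X : M) :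
    app (η ⊗ₘ ζ) X = app η (G.toFunctor.obj X) ≫ F'.toFunctor.map (app ζ X) := rfl

@[simp] theorem associator_hom_app (F G H : BddEnd M) (X : M) :
    app (α_ F G H).hom X = 𝟙 (F.toFunctor.obj (G.toFunctor.obj (H.toFunctor.obj X))) := rfl

@[simp] theorem leftUnitor_hom_app (F : BddEnd M) (X : M) :
    app (λ_ F).hom X = 𝟙 (F.toFunctor.obj X) := rfl

@[simp] theorem rightUnitor_hom_app (F : BddEnd M) (X : M) :
    app (ρ_ F).hom X = 𝟙 (F.toFunctor.obj X) := rfl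

@[simp] theorem tensorObj_map (F G : BddEnd M) {X Y : M} (f : X ⟶ Y) :
    (F ⊗ G).toFunctor.map f = F.toFunctor.map (G.toFunctor.map f) := rfl

@[simp] theorem tensorUnit_map {X Y : M} (f : X ⟶ Y) :
    (𝟙_ (BddEnd M)).toFunctor.map f = f := rfl

instance : MonoidalCategory (BddEnd M) where
  tensorHom_def η ζ := rfl
  id_tensorHom_id F G := hom_ext fun X => by simp
  tensorHom_comp_tensorHom η η' ζ ζ' := hom_ext fun X => by
    simp only [comp_app, tensorHom_app, Functor.map_comp, Category.assoc]
    rw [reassoc_of% (naturality ζ)]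
  whiskerLeft_id F G := hom_ext fun X => by simp
  id_whiskerRight F G := hom_ext fun X => by simp
  associator_naturality η ζ θ := hom_ext fun X => by simp
  leftUnitor_naturality η := hom_ext fun X => by simp
  rightUnitor_naturality η := hom_ext fun X => by simp
  pentagon F G H K := hom_ext fun X => by simp
  triangle F G := hom_ext fun X => by simp

end BddEnd

/-! ### Bounded module endofunctors -/

section Unitary

variable {C : Type u} [Category.{v} C] [DaggerCategory C]

theorem isUnitary_id (X : C) : IsUnitary (𝟙 X) := by simp [IsUnitary]

theorem IsUnitary.comp {X Y Z : C} {f : X ⟶ Y} {g : Y ⟶ Z} (hf : IsUnitary f)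
    (hg : IsUnitary g) : IsUnitary (f ≫ g) := by
  constructor
  · rw [DaggerCategory.dagger_comp, Category.assoc, reassoc_of% hg.1, hf.1]
  · rw [DaggerCategory.dagger_comp, Category.assoc, reassoc_of% hf.2, hg.2]

theorem IsUnitary.dagger {X Y : C} {f : X ⟶ Y} (hf : IsUnitary f) : IsUnitary f† := by
  refine ⟨?_, ?_⟩
  · rw [DaggerCategory.dagger_dagger, hf.2]
  · rw [DaggerCategory.dagger_dagger, hf.1]

theorem IsUnitary.inv_eq {X Y : C} {e : X ≅ Y} (h : IsUnitary e.hom) : e.inv = e.hom† := by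
  rw [← cancel_epi e.hom, h.1, Iso.hom_inv_id]

theorem IsUnitary.map {M : Type u₁} [Category.{v₁} M] [CStarCategory M] {N : Type u₂}
    [Category.{v₂} N] [CStarCategory N] (F : M ⥤ N) [IsCStarFunctor F] {X Y : M} {f : X ⟶ Y}
    (hf : IsUnitary f) : IsUnitary (F.map f) := by
  constructor
  · rw [← IsCStarFunctor.map_dagger, ← F.map_comp, hf.1, F.map_id]
  · rw [← IsCStarFunctor.map_dagger, ← F.map_comp, hf.2, F.map_id]

end Unitary

section Restrict

variable {C : Type u₁} [Category.{v₁} C] [CStarCategory C] [MonoidalCategory C]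
  {M : Type u₂} [Category.{v₂} M] [CStarCategory M] [MonoidalLeftAction C M]

theorem isUnitary_actionRight [CStarModuleCategory C M] (U : C) {X Y : M} {f : X ⟶ Y}
    (hf : IsUnitary f) : IsUnitary (U ⊴ₗ f) := by
  constructor
  · rw [← CStarModuleCategory.actionRight_dagger, ← MonoidalLeftAction.actionHomRight_comp, hf.1,
      MonoidalLeftAction.actionHomRight_id]
  · rw [← CStarModuleCategory.actionRight_dagger, ← MonoidalLeftAction.actionHomRight_comp, hf.2,
      MonoidalLeftAction.actionHomRight_id]

theorem isUnitary_actionLeft [CStarModuleCategory C M] {U V : C} {f : U ⟶ V}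
    (hf : IsUnitary f) (X : M) : IsUnitary (f ⊵ₗ X) := by
  constructor
  · rw [← CStarModuleCategory.actionLeft_dagger, ← MonoidalLeftAction.comp_actionHomLeft, hf.1,
      MonoidalLeftAction.id_actionHomLeft]
  · rw [← CStarModuleCategory.actionLeft_dagger, ← MonoidalLeftAction.comp_actionHomLeft, hf.2,
      MonoidalLeftAction.id_actionHomLeft]

/-- Restricting a module C*-category along a C*-tensor functor gives a module C*-category. -/
theorem restrictAction_isModule {D : Type u₃} [Category.{v₃} D] [CStarCategory D]
    [MonoidalCategory D] (Θ : D ⥤ C) [Θ.Monoidal] [IsCStarTensorFunctor Θ]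
    [CStarModuleCategory C M] :
    letI := restrictAction Θ M
    CStarModuleCategory D M :=
  letI := restrictAction Θ M
  { actionRight_add := fun U _ _ f g => CStarModuleCategory.actionRight_add (Θ.obj U) f g
    actionRight_smul := fun U _ _ c f => CStarModuleCategory.actionRight_smul (Θ.obj U) c f
    actionRight_dagger := fun U _ _ f => CStarModuleCategory.actionRight_dagger (Θ.obj U) f
    actionLeft_add := fun f g X => by
      change Θ.map (f + g) ⊵ₗ X = Θ.map f ⊵ₗ X + Θ.map g ⊵ₗ X
      rw [IsCStarFunctor.map_add, CStarModuleCategory.actionLeft_add]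
    actionLeft_smul := fun c f X => by
      change Θ.map (c • f) ⊵ₗ X = c • Θ.map f ⊵ₗ X
      rw [IsCStarFunctor.map_smul, CStarModuleCategory.actionLeft_smul]
    actionLeft_dagger := fun f X => by
      change Θ.map f† ⊵ₗ X = (Θ.map f ⊵ₗ X)†
      rw [IsCStarFunctor.map_dagger, CStarModuleCategory.actionLeft_dagger]
    actionAssoc_unitary := fun U V X => by
      have h : IsUnitary (Functor.Monoidal.μIso Θ U V).hom :=
        IsCStarTensorFunctor.tensor_unitary U V
      have h' : IsUnitary (Functor.OplaxMonoidal.δ Θ U V) := by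
        have e : Functor.OplaxMonoidal.δ Θ U V = _ := h.inv_eq
        rw [e]
        exact h.dagger
      exact (isUnitary_actionLeft h' X).comp (CStarModuleCategory.actionAssoc_unitary _ _ X)
    actionUnit_unitary := fun X => by
      have h : IsUnitary (Functor.Monoidal.εIso Θ).hom :=
        IsCStarTensorFunctor.unit_unitary
      have h' : IsUnitary (Functor.OplaxMonoidal.η Θ) := by
        have e : Functor.OplaxMonoidal.η Θ = _ := h.inv_eq
        rw [e]
        exact h.dagger
      exact (isUnitary_actionLeft h' X).comp (CStarModuleCategory.actionUnit_unitary X)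
    finiteDimensional := fun X Y => CStarModuleCategory.finiteDimensional C X Y }

end Restrict

/-- An object of `[M, M]_b^D`: a `D`-module endofunctor `(F, f)`, where `F` is a C*-functor and
`f_{U,X} : F(U ⊗ X) ⟶ U ⊗ F(X)` is a coherent unitary natural transformation
(called `δₗ` in Mathlib). -/
structure ModEnd (D : Type u₁) [Category.{v₁} D] [CStarCategory D] [MonoidalCategory D]
    (M : Type u₂) [Category.{v₂} M] [CStarCategory M] [MonoidalLeftAction D M] where
  toBddEnd : BddEnd M
  lineator : toBddEnd.toFunctor.OplaxLeftLinear D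
  lineator_unitary (U : D) (X : M) : IsUnitary (lineator.δₗ U X)

namespace ModEnd

variable {D : Type u₁} [Category.{v₁} D] [CStarCategory D] [MonoidalCategory D]
  {M : Type u₂} [Category.{v₂} M] [CStarCategory M] [MonoidalLeftAction D M]

/-- The structure morphism `f_{U,X} : F(U ⊗ X) ⟶ U ⊗ F(X)`. -/
def str (F : ModEnd D M) (U : D) (X : M) :
    F.toBddEnd.toFunctor.obj (U ⊙ₗ X) ⟶ U ⊙ₗ F.toBddEnd.toFunctor.obj X :=
  F.lineator.δₗ U X

/-- A morphism of `[M, M]_b^D`: a bounded natural transformation `η` with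
`(id ⊗ η_X) f_{U,X} = g_{U,X} η_{U ⊗ X}`. -/
@[ext]
structure Hom (F G : ModEnd D M) where
  toHom : F.toBddEnd ⟶ G.toBddEnd
  comm (U : D) (X : M) :
    F.str U X ≫ U ⊴ₗ BddEnd.app toHom X = BddEnd.app toHom (U ⊙ₗ X) ≫ G.str U X

instance : Category (ModEnd D M) where
  Hom := Hom
  id F := ⟨𝟙 F.toBddEnd, fun U X => by simp⟩
  comp η ζ := ⟨η.toHom ≫ ζ.toHom, fun U X => by
    simp only [BddEnd.comp_app, MonoidalLeftAction.actionHomRight_comp, Category.assoc]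
    rw [reassoc_of% (η.comm U X), ζ.comm U X]⟩

variable (D M) in
/-- The forgetful functor `[M, M]_b^D ⥤ [M, M]_b`. -/
def forget : ModEnd D M ⥤ BddEnd M where
  obj F := F.toBddEnd
  map η := η.toHom

theorem hom_ext {F G : ModEnd D M} {η ζ : F ⟶ G} (h : η.toHom = ζ.toHom) : η = ζ :=
  Hom.ext h

@[simp] theorem id_toHom (F : ModEnd D M) : Hom.toHom (𝟙 F) = 𝟙 F.toBddEnd := rfl

@[simp] theorem comp_toHom {F G H : ModEnd D M} (η : F ⟶ G) (ζ : G ⟶ H) :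
    Hom.toHom (η ≫ ζ) = η.toHom ≫ ζ.toHom := rfl

/-- The uniform norm. -/
instance (F G : ModEnd D M) : Norm (F ⟶ G) where
  norm η := ‖η.toHom‖

theorem str_naturality_left (F : ModEnd D M) {U V : D} (f : U ⟶ V) (X : M) :
    F.toBddEnd.toFunctor.map (f ⊵ₗ X) ≫ F.str V X =
      F.str U X ≫ f ⊵ₗ F.toBddEnd.toFunctor.obj X :=
  F.lineator.δₗ_naturality_left f X

theorem str_naturality_right (F : ModEnd D M) (U : D) {X Y : M} (f : X ⟶ Y) :
    F.toBddEnd.toFunctor.map (U ⊴ₗ f) ≫ F.str U Y =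
      F.str U X ≫ U ⊴ₗ F.toBddEnd.toFunctor.map f :=
  F.lineator.δₗ_naturality_right U f

theorem str_assoc (F : ModEnd D M) (U V : D) (X : M) :
    F.str (U ⊗ V) X ≫ (αₗ U V (F.toBddEnd.toFunctor.obj X)).hom =
      F.toBddEnd.toFunctor.map (αₗ U V X).hom ≫ F.str U (V ⊙ₗ X) ≫ U ⊴ₗ F.str V X :=
  F.lineator.δₗ_associativity U V X

theorem str_unit (F : ModEnd D M) (X : M) :
    (λₗ[D] (F.toBddEnd.toFunctor.obj X)).inv =
      F.toBddEnd.toFunctor.map (λₗ[D] X).inv ≫ F.str (𝟙_ D) X :=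
  F.lineator.δₗ_unitality_inv X

/-- Scalar multiples of morphisms. -/
instance [CStarModuleCategory D M] (F G : ModEnd D M) : SMul ℂ (F ⟶ G) where
  smul c η := ⟨c • η.toHom, fun U X => by
    rw [BddEnd.smul_app, BddEnd.smul_app, CStarModuleCategory.actionRight_smul,
      CStarCategory.comp_smul, CStarCategory.smul_comp, η.comm U X]⟩

@[simp] theorem smul_toHom [CStarModuleCategory D M] {F G : ModEnd D M} (c : ℂ) (η : F ⟶ G) :
    Hom.toHom (c • η) = c • η.toHom := rfl

/-- The adjoint of a morphism, taken componentwise. -/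
instance [CStarModuleCategory D M] : DaggerCategory (ModEnd D M) where
  dagger {F G} η := ⟨η.toHom†, fun U X => by
    have h := congrArg (fun t => t†) (η.comm U X)
    simp only [DaggerCategory.dagger_comp, ← CStarModuleCategory.actionRight_dagger] at h
    have hF : (F.str U X)† ≫ F.str U X = 𝟙 _ := (F.lineator_unitary U X).2
    have hG : G.str U X ≫ (G.str U X)† = 𝟙 _ := (G.lineator_unitary U X).1
    rw [BddEnd.dagger_app, BddEnd.dagger_app]
    have h' := congrArg (fun t => G.str U X ≫ t ≫ F.str U X) h
    simpa only [Category.assoc, hF, Category.comp_id, reassoc_of% hG] using h'⟩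
  dagger_dagger η := hom_ext (DaggerCategory.dagger_dagger η.toHom)
  dagger_comp η ζ := hom_ext (DaggerCategory.dagger_comp η.toHom ζ.toHom)

@[simp] theorem dagger_toHom [CStarModuleCategory D M] {F G : ModEnd D M} (η : F ⟶ G) :
    Hom.toHom η† = η.toHom† := rfl

/-- The identity functor as a `D`-module functor. -/
def unit : ModEnd D M where
  toBddEnd := 𝟙_ (BddEnd M)
  lineator :=
    { δₗ := fun U X => 𝟙 (U ⊙ₗ X)
      δₗ_naturality_left := fun f X => by simp
      δₗ_naturality_right := fun U _ _ f => by simp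
      δₗ_associativity := fun U V X => by simp
      δₗ_unitality_inv := fun X => by simp }
  lineator_unitary U X := isUnitary_id _

/-- The composite of module functors, `(F ⊗ G)(X) = F(G(X))`, with structure morphism
`F(G(U ⊗ X)) ⟶ F(U ⊗ G(X)) ⟶ U ⊗ F(G(X))`. -/
def comp (F G : ModEnd D M) : ModEnd D M where
  toBddEnd := F.toBddEnd ⊗ G.toBddEnd
  lineator :=
    letI := F.lineator
    letI := G.lineator
    { δₗ := fun U X =>
        F.toBddEnd.toFunctor.map (G.str U X) ≫ F.str U (G.toBddEnd.toFunctor.obj X)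
      δₗ_naturality_left := fun f X => by
        simp only [BddEnd.tensorObj_map, Category.assoc]
        rw [← Functor.map_comp_assoc, str_naturality_left, Functor.map_comp_assoc,
          str_naturality_left]
        rfl
      δₗ_naturality_right := fun U _ _ f => by
        simp only [BddEnd.tensorObj_map, Category.assoc]
        rw [← Functor.map_comp_assoc, str_naturality_right, Functor.map_comp_assoc,
          str_naturality_right]
      δₗ_associativity := fun U V X => by
        simp only [BddEnd.tensorObj_map, BddEnd.tensorObj_obj, Category.assoc,
          MonoidalLeftAction.actionHomRight_comp]
        rw [str_assoc, ← Functor.map_comp_assoc, str_assoc]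
        simp only [Functor.map_comp, Category.assoc]
        rw [reassoc_of% (str_naturality_right F U (G.str V X))]
      δₗ_unitality_inv := fun X => by
        simp only [BddEnd.tensorObj_map, BddEnd.tensorObj_obj]
        rw [str_unit, str_unit, Functor.map_comp, Category.assoc] }
  lineator_unitary U X :=
    ((G.lineator_unitary U X).map F.toBddEnd.toFunctor).comp (F.lineator_unitary U _)

/-- Upgrade an isomorphism of underlying functors to an isomorphism of module functors. -/
def mkIso {F G : ModEnd D M} (e : F.toBddEnd ≅ G.toBddEnd)
    (h : ∀ U X, F.str U X ≫ U ⊴ₗ BddEnd.app e.hom X = BddEnd.app e.hom (U ⊙ₗ X) ≫ G.str U X) :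
    F ≅ G where
  hom := ⟨e.hom, h⟩
  inv := ⟨e.inv, fun U X => by
    have h1 : BddEnd.app e.inv (U ⊙ₗ X) ≫ BddEnd.app e.hom (U ⊙ₗ X) = 𝟙 _ := by
      rw [← BddEnd.comp_app, Iso.inv_hom_id, BddEnd.id_app]
    have h2 : BddEnd.app e.hom X ≫ BddEnd.app e.inv X = 𝟙 _ := by
      rw [← BddEnd.comp_app, Iso.hom_inv_id, BddEnd.id_app]
    have h3 := congrArg (fun t => BddEnd.app e.inv (U ⊙ₗ X) ≫ t ≫ U ⊴ₗ BddEnd.app e.inv X) (h U X)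
    simp only [Category.assoc, ← MonoidalLeftAction.actionHomRight_comp, h2,
      MonoidalLeftAction.actionHomRight_id, Category.comp_id, reassoc_of% h1] at h3
    exact h3.symm⟩
  hom_inv_id := hom_ext e.hom_inv_id
  inv_hom_id := hom_ext e.inv_hom_id

theorem comp_str (F G : ModEnd D M) (U : D) (X : M) :
    (comp F G).str U X =
      F.toBddEnd.toFunctor.map (G.str U X) ≫ F.str U (G.toBddEnd.toFunctor.obj X) := rfl

theorem whiskerLeft_comm (F : ModEnd D M) {G G' : ModEnd D M} (η : G ⟶ G') (U : D) (X : M) :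
    (comp F G).str U X ≫ U ⊴ₗ BddEnd.app (F.toBddEnd ◁ η.toHom) X =
      BddEnd.app (F.toBddEnd ◁ η.toHom) (U ⊙ₗ X) ≫ (comp F G').str U X := by
  change (F.toBddEnd.toFunctor.map (G.str U X) ≫ F.str U (G.toBddEnd.toFunctor.obj X)) ≫
      U ⊴ₗ F.toBddEnd.toFunctor.map (BddEnd.app η.toHom X) =
    F.toBddEnd.toFunctor.map (BddEnd.app η.toHom (U ⊙ₗ X)) ≫
      F.toBddEnd.toFunctor.map (G'.str U X) ≫ F.str U (G'.toBddEnd.toFunctor.obj X)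
  rw [Category.assoc, ← str_naturality_right, ← Functor.map_comp_assoc, ← Functor.map_comp_assoc, η.comm]

theorem whiskerRight_comm {F F' : ModEnd D M} (η : F ⟶ F') (G : ModEnd D M) (U : D) (X : M) :
    (comp F G).str U X ≫ U ⊴ₗ BddEnd.app (η.toHom ▷ G.toBddEnd) X =
      BddEnd.app (η.toHom ▷ G.toBddEnd) (U ⊙ₗ X) ≫ (comp F' G).str U X := by
  change (F.toBddEnd.toFunctor.map (G.str U X) ≫ F.str U (G.toBddEnd.toFunctor.obj X)) ≫
      U ⊴ₗ BddEnd.app η.toHom (G.toBddEnd.toFunctor.obj X) =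
    BddEnd.app η.toHom (G.toBddEnd.toFunctor.obj (U ⊙ₗ X)) ≫
      F'.toBddEnd.toFunctor.map (G.str U X) ≫ F'.str U (G.toBddEnd.toFunctor.obj X)
  rw [Category.assoc, η.comm, ← reassoc_of% (BddEnd.naturality η.toHom (G.str U X))]

/-- The tensor product of `[M, M]_b^D` is composition of module functors. -/
instance : MonoidalCategoryStruct (ModEnd D M) where
  tensorObj F G := comp F G
  tensorUnit := unit
  whiskerLeft F G G' η := ⟨F.toBddEnd ◁ η.toHom, whiskerLeft_comm F η⟩
  whiskerRight {F F'} η G := ⟨η.toHom ▷ G.toBddEnd, whiskerRight_comm η G⟩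
  tensorHom {F F' G G'} η ζ :=
    (⟨η.toHom ▷ G.toBddEnd, whiskerRight_comm η G⟩ : comp F G ⟶ comp F' G) ≫
      ⟨F'.toBddEnd ◁ ζ.toHom, whiskerLeft_comm F' ζ⟩
  associator F G H := mkIso (α_ F.toBddEnd G.toBddEnd H.toBddEnd) fun U X => by
    change (F.toBddEnd.toFunctor.map (G.toBddEnd.toFunctor.map (H.str U X)) ≫
        F.toBddEnd.toFunctor.map (G.str U (H.toBddEnd.toFunctor.obj X)) ≫
          F.str U (G.toBddEnd.toFunctor.obj (H.toBddEnd.toFunctor.obj X))) ≫ U ⊴ₗ 𝟙 _ =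
      𝟙 _ ≫ F.toBddEnd.toFunctor.map (G.toBddEnd.toFunctor.map (H.str U X) ≫
        G.str U (H.toBddEnd.toFunctor.obj X)) ≫
          F.str U (G.toBddEnd.toFunctor.obj (H.toBddEnd.toFunctor.obj X))
    simp
  leftUnitor F := mkIso (λ_ F.toBddEnd) fun U X => by
    change (F.str U X ≫ 𝟙 _) ≫ U ⊴ₗ 𝟙 _ = 𝟙 _ ≫ F.str U X
    simp
  rightUnitor F := mkIso (ρ_ F.toBddEnd) fun U X => by
    change (F.toBddEnd.toFunctor.map (𝟙 _) ≫ F.str U X) ≫ U ⊴ₗ 𝟙 _ = 𝟙 _ ≫ F.str U X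
    simp

instance : MonoidalCategory (ModEnd D M) where
  tensorHom_def η ζ := hom_ext (MonoidalCategory.tensorHom_def η.toHom ζ.toHom)
  id_tensorHom_id F G := hom_ext (MonoidalCategory.id_tensorHom_id F.toBddEnd G.toBddEnd)
  tensorHom_comp_tensorHom η η' ζ ζ' :=
    hom_ext (MonoidalCategory.tensorHom_comp_tensorHom η.toHom η'.toHom ζ.toHom ζ'.toHom)
  whiskerLeft_id F G := hom_ext (MonoidalCategory.whiskerLeft_id F.toBddEnd G.toBddEnd)
  id_whiskerRight F G := hom_ext (MonoidalCategory.id_whiskerRight F.toBddEnd G.toBddEnd)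
  associator_naturality η ζ θ :=
    hom_ext (MonoidalCategory.associator_naturality η.toHom ζ.toHom θ.toHom)
  leftUnitor_naturality η := hom_ext (MonoidalCategory.leftUnitor_naturality η.toHom)
  rightUnitor_naturality η := hom_ext (MonoidalCategory.rightUnitor_naturality η.toHom)
  pentagon F G H K :=
    hom_ext (MonoidalCategory.pentagon F.toBddEnd G.toBddEnd H.toBddEnd K.toBddEnd)
  triangle F G := hom_ext (MonoidalCategory.triangle F.toBddEnd G.toBddEnd)

end ModEnd

/-! ### Irreducible objects, module traces and the Plancherel weight -/

section Irreducible

variable {M : Type u} [Category.{v} M] [CStarCategory M]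

/-- `X` is irreducible: nonzero, with only scalar endomorphisms. -/
def IsIrreducible (X : M) : Prop :=
  𝟙 X ≠ 0 ∧ ∀ f : X ⟶ X, ∃ c : ℂ, f = c • 𝟙 X

/-- Isomorphism as an equivalence relation on irreducible objects. -/
def irrSetoid (M : Type u) [Category.{v} M] [CStarCategory M] :
    Setoid {X : M // IsIrreducible X} :=
  (isIsomorphicSetoid M).comap Subtype.val

/-- The set of isomorphism classes of irreducible objects. -/
def Irr (M : Type u) [Category.{v} M] [CStarCategory M] : Type u :=
  Quotient (irrSetoid M)

/-- A chosen representative of a class of irreducible objects. -/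
def Irr.rep (i : Irr M) : M := (Quotient.out (s := irrSetoid M) i).1

theorem Irr.rep_irreducible (i : Irr M) : IsIrreducible i.rep :=
  (Quotient.out (s := irrSetoid M) i).2

/-- The scalar `a_i` by which an endomorphism of the irreducible object `i` acts. -/
def Irr.scalar (i : Irr M) (f : i.rep ⟶ i.rep) : ℂ :=
  Classical.choose (i.rep_irreducible.2 f)

theorem Irr.scalar_spec (i : Irr M) (f : i.rep ⟶ i.rep) : f = i.scalar f • 𝟙 i.rep :=
  Classical.choose_spec (i.rep_irreducible.2 f)

end Irreducible

/-- For `R : 1 ⟶ U' ⊗ U` in `C` and an endomorphism `T` of `U ⊗ X`, the endomorphism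
`(R* ⊗ id_X)(id_U' ⊗ T)(R ⊗ id_X)` of `X`. -/
def partialTrace {C : Type u₁} [Category.{v₁} C] [CStarCategory C] [MonoidalCategory C]
    {M : Type u₂} [Category.{v₂} M] [CStarCategory M] [MonoidalLeftAction C M]
    {U U' : C} (R : 𝟙_ C ⟶ U' ⊗ U) {X : M} (T : U ⊙ₗ X ⟶ U ⊙ₗ X) : X ⟶ X :=
  (λₗ[C] X).inv ≫ R ⊵ₗ X ≫ (αₗ U' U X).hom ≫ U' ⊴ₗ T ≫ (αₗ U' U X).inv ≫ R† ⊵ₗ X ≫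
    (λₗ[C] X).hom

/-- A `C`-module trace on `M`: a family of positive traces, compatible with the partial
categorical traces of `C`, under which no irreducible object has dimension zero. -/
structure ModuleTrace (C : Type u₁) [Category.{v₁} C] [CStarCategory C] [MonoidalCategory C]
    (M : Type u₂) [Category.{v₂} M] [CStarCategory M] [MonoidalLeftAction C M] where
  tr (X : M) : (X ⟶ X) →ₗ[ℂ] ℂ
  tr_nonneg {X : M} (f : X ⟶ X) : 0 ≤ tr X (f ≫ f†)
  tr_comm {X Y : M} (f g : X ⟶ Y) : tr X (f ≫ g†) = tr Y (g† ≫ f)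
  tr_action {U U' : C} {R : 𝟙_ C ⟶ U' ⊗ U} {R' : 𝟙_ C ⟶ U ⊗ U'}
    (h : IsStandardSolution U U' R R') {X : M} (T : U ⊙ₗ X ⟶ U ⊙ₗ X) :
    tr (U ⊙ₗ X) T = tr X (partialTrace R T)
  tr_id_ne_zero {X : M} (h : IsIrreducible X) : tr X (𝟙 X) ≠ 0

namespace ModuleTrace

variable {C : Type u₁} [Category.{v₁} C] [CStarCategory C] [MonoidalCategory C]
  {M : Type u₂} [Category.{v₂} M] [CStarCategory M] [MonoidalLeftAction C M]

/-- The dimension `d(X) = tr_X(id_X)`. -/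
def dim (τ : ModuleTrace C M) (X : M) : ℂ := τ.tr X (𝟙 X)

/-- The Plancherel weight `ω(a) = ∑ d(i)² a_i`, summed over the finitely many classes of
irreducible objects. -/
def plancherel (τ : ModuleTrace C M) [Finite (Irr M)] (a : 𝟙_ (BddEnd M) ⟶ 𝟙_ (BddEnd M)) : ℂ :=
  ∑ᶠ i : Irr M, τ.dim i.rep ^ 2 * i.scalar (BddEnd.app a i.rep)

/-- The identity `ω(R*(id ⊗ η)R) = ω(R'*(η ⊗ id)R')` for an endomorphism `η` of `F`. -/
def Balances (τ : ModuleTrace C M) [Finite (Irr M)] {F F' : BddEnd M}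
    (R : 𝟙_ (BddEnd M) ⟶ F' ⊗ F) (R' : 𝟙_ (BddEnd M) ⟶ F ⊗ F') (η : F ⟶ F) : Prop :=
  τ.plancherel (R ≫ F' ◁ η ≫ R†) = τ.plancherel (R' ≫ η ▷ F' ≫ R'†)

/-- Standard solutions in `[M, M]_b`: the identity `ω(R*(id ⊗ η)R) = ω(R'*(η ⊗ id)R')` holds for
every positive `η = ζ* ζ` in `End_b(F)`. -/
structure IsStandard (τ : ModuleTrace C M) [Finite (Irr M)] (F F' : BddEnd M)
    (R : 𝟙_ (BddEnd M) ⟶ F' ⊗ F) (R' : 𝟙_ (BddEnd M) ⟶ F ⊗ F') : Prop where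
  solution : IsConjugateSolution F F' R R'
  balanced (ζ : F ⟶ F) : τ.Balances R R' (ζ ≫ ζ†)

/-- Standard solutions in `[M, M]_b^D`: the same identity for every positive `η = ζ* ζ` in the
endomorphism algebra of the `D`-module functor `F`. -/
structure IsModStandard (τ : ModuleTrace C M) [Finite (Irr M)]
    {D : Type u₃} [Category.{v₃} D] [CStarCategory D] [MonoidalCategory D]
    [MonoidalLeftAction D M] [CStarModuleCategory D M] (F F' : ModEnd D M)
    (R : 𝟙_ (ModEnd D M) ⟶ F' ⊗ F) (R' : 𝟙_ (ModEnd D M) ⟶ F ⊗ F') : Prop where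
  solution : IsConjugateSolution F F' R R'
  balanced (ζ : F ⟶ F) : τ.Balances R.toHom R'.toHom (ζ ≫ ζ†).toHom

end ModuleTrace

end CStarCat

end

open CStarCat

/-!
Compositions are written in diagrammatic order in the code and as operator products in the comments.

**Trace adjunctions.** For a C*-functor `F : M ⥤ M` the traces make all Hom spaces of `M` Hilbert
spaces, and `Hom(F(-), Y)` is represented unitarily by an object `G(Y)`, as `M` is semisimple with
finitely many irreducible objects (`exists_traceAdjunction`).  So `F` has an adjoint `G` with
`tr_{F(X)}(T) = tr_X(R* G(T) R)` for the unit `R : 1 ⟶ G F`.  The weights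
`∑ d(i) tr(Tᵢ)` on natural endomorphisms do not depend on the side on which a functor is closed up
(`TraceAdjunction.balance`), so `(F, G, R, R')` is a standard solution in `[M, M]_b`.

**Rigidity.** If `F` is a `D`-module functor with structure `f : F(U ⊗ X) ≅ U ⊗ F(X)`, then
the mate `U ⊗ G(X) ⟶ G(U ⊗ X)` makes `G` a `D`-module functor, provided that it is unitary.
Suppose that `F` commutes with the action of `U` and of a conjugate `V`, compatibly with a
norm-standard solution `s : 1 ⟶ V ⊗ U` in `C`.  The mate is then a composite of transpositions along
trace adjunctions, which are isometric bijections (`TraceAdjunction.isUnitary_mate`).  However, the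
solution coming from `D` has the form `r = (t ⊗ 1) s` with `t` invertible but in general not unitary: the
image under `Θ` of a norm-standard solution need not be norm-standard.  The main
point is that `F` nevertheless commutes with `p = t t*` (`map_comp_eq_of_compatible`): expanding the
weighted trace of `|f F(p) - p f|²` gives three kinds of terms, each of which reduces by `balance` and
the simplicity of the unit of `C` to the same number.  Hence `f` for the conjugate of `U` can be
replaced by a unitary that is compatible with `s`.

**Standardness.** Any other solution in `[M, M]_b^D` is `(e R, e*⁻¹ R')` for an isomorphism `e` of
module functors, and it is standard in `[M, M]_b` if `e* e = 1`.  If it is standard in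
`[M, M]_b^D`, comparing the two weights shows that the transpose of `e* e` is its own inverse,
which forces `e* e = 1`.  If the unit of `[M, M]_b^D` is simple, then `‖e R‖²` and
`‖e*⁻¹ R'‖²` are proportional to the weights of `e* e` and of `(e* e)⁻¹`, whose sum exceeds its value
at `e = 1` by the weight of `|e - e*⁻¹|²`; so a solution of minimal norm has `e* e = 1`.
Existence of norm-standard solutions in `C` (`exists_standardSolution`) is a compactness argument.
-/

noncomputable section

namespace CStarCat

universe v u v₁ u₁ v₂ u₂ v₃ u₃

/-! ### Linear algebra in C*-categories -/

section CStarCategory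

variable {M : Type u} [Category.{v} M] [CStarCategory M]

instance : Preadditive M where
  homGroup X Y := (CStarCategory.homNormed X Y).toAddCommGroup
  add_comp _ _ _ f f' g := CStarCategory.add_comp f f' g
  comp_add _ _ _ f g g' := CStarCategory.comp_add f g g'

instance : Linear ℂ M where
  homModule X Y := (CStarCategory.homNormedSpace X Y).toModule
  smul_comp _ _ _ c f g := CStarCategory.smul_comp c f g
  comp_smul _ _ _ f c g := CStarCategory.comp_smul c f g

variable {X Y Z : M}

theorem dagger_add (f g : X ⟶ Y) : (f + g)† = f† + g† := CStarCategory.dagger_add f g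

theorem dagger_smul (c : ℂ) (f : X ⟶ Y) : (c • f)† = (starRingEnd ℂ c) • f† :=
  CStarCategory.dagger_smul c f

variable (X Y) in
/-- The adjoint as an additive map. -/
def daggerHom : (X ⟶ Y) →+ (Y ⟶ X) where
  toFun f := f†
  map_zero' := by simpa using dagger_smul (0 : ℂ) (0 : X ⟶ Y)
  map_add' := dagger_add

@[simp] theorem dagger_zero : (0 : X ⟶ Y)† = 0 := (daggerHom X Y).map_zero

theorem dagger_sub (f g : X ⟶ Y) : (f - g)† = f† - g† := (daggerHom X Y).map_sub f g

theorem dagger_sum {ι : Type*} (s : Finset ι) (f : ι → (X ⟶ Y)) :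
    (∑ i ∈ s, f i)† = ∑ i ∈ s, (f i)† := map_sum (daggerHom X Y) f s

theorem comp_dagger_eq_zero {f : X ⟶ Y} (h : f ≫ f† = 0) : f = 0 := by
  have h1 := CStarCategory.norm_dagger_comp f
  rw [h, norm_zero] at h1
  exact norm_eq_zero.1 (by nlinarith [norm_nonneg f])

theorem dagger_injective {f g : X ⟶ Y} (h : f† = g†) : f = g := by
  rw [← DaggerCategory.dagger_dagger f, h, DaggerCategory.dagger_dagger]

theorem norm_id_le (X : M) : ‖𝟙 X‖ ≤ 1 := by
  have h := CStarCategory.norm_dagger_comp (𝟙 X)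
  rw [dagger_id, Category.id_comp] at h
  nlinarith [norm_nonneg (𝟙 X)]

theorem norm_id_eq_one {X : M} (hX : 𝟙 X ≠ 0) : ‖𝟙 X‖ = 1 := by
  have h := CStarCategory.norm_dagger_comp (𝟙 X)
  rw [dagger_id, Category.id_comp] at h
  have : ‖𝟙 X‖ ≠ 0 := by simpa using hX
  have := norm_nonneg (𝟙 X)
  exact mul_left_cancel₀ ‹‖𝟙 X‖ ≠ 0› (by nlinarith)

theorem IsCStarFunctor.map_zero {N : Type u₂} [Category.{v₂} N] [CStarCategory N] (F : M ⥤ N)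
    [IsCStarFunctor F] : F.map (0 : X ⟶ Y) = 0 := by
  simpa using IsCStarFunctor.map_smul (F := F) (0 : ℂ) (0 : X ⟶ Y)

instance IsCStarFunctor.additive {N : Type u₂} [Category.{v₂} N] [CStarCategory N] (F : M ⥤ N)
    [IsCStarFunctor F] : F.Additive where
  map_add := IsCStarFunctor.map_add _ _

/-- A finite-dimensional C*-algebra without nontrivial projections consists of scalars. -/
theorem exists_eq_smul_one_of_projections {A : Type*} [CStarAlgebra A] [FiniteDimensional ℂ A]
    (h : ∀ p : A, p * p = p → star p = p → p = 0 ∨ p = 1) (a : A) : ∃ c : ℂ, a = c • (1 : A) := by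
  have key : ∀ a : A, IsSelfAdjoint a → ∃ c : ℂ, a = c • (1 : A) := by
    intro a ha
    by_cases hA : Nontrivial A
    swap
    · rw [not_nontrivial_iff_subsingleton] at hA
      exact ⟨0, Subsingleton.elim _ _⟩
    have hfin : (spectrum ℂ a).Finite := by
      have hint : IsIntegral ℂ a := Algebra.IsIntegral.isIntegral a
      have h1 := spectrum.subset_polynomial_aeval a (minpoly ℂ a)
      rw [minpoly.aeval, spectrum.zero_eq] at h1
      refine ((minpoly ℂ a).rootSet_finite ℂ).subset fun z hz => ?_
      rw [Polynomial.mem_rootSet]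
      refine ⟨minpoly.ne_zero hint, ?_⟩
      simpa using h1 ⟨z, hz, rfl⟩
    obtain ⟨z, hz⟩ := spectrum.nonempty a
    have hcont : ∀ g : ℂ → ℂ, ContinuousOn g (spectrum ℂ a) := fun g =>
      hfin.continuousOn g
    have hn : IsStarNormal a := ha.isStarNormal
    -- the indicator function of a point of the finite spectrum gives a nonzero projection
    set g : ℂ → ℂ := fun w => if w = z then 1 else 0 with hg
    have hp : cfc g a * cfc g a = cfc g a := by
      rw [← cfc_mul g g a (hcont _) (hcont _)]
      congr 1
      ext w
      by_cases hw : w = z <;> simp [hg, hw]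
    have hp' : star (cfc g a) = cfc g a := by
      rw [← cfc_star]
      congr 1
      ext w
      by_cases hw : w = z <;> simp [hg, hw]
    have hspec := cfc_map_spectrum (R := ℂ) g a hn (hcont g)
    have h1 : cfc g a = 1 := by
      refine (h _ hp hp').resolve_left fun h0 => ?_
      rw [h0, spectrum.zero_eq] at hspec
      have : (1 : ℂ) ∈ ({0} : Set ℂ) := hspec ▸ ⟨z, hz, by simp [hg]⟩
      simp at this
    refine ⟨z, ?_⟩
    have hsub : ∀ w ∈ spectrum ℂ a, w = z := by
      intro w hw
      by_contra hne
      rw [h1, spectrum.one_eq] at hspec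
      have : (0 : ℂ) ∈ ({1} : Set ℂ) := hspec ▸ ⟨w, hw, by simp [hg, hne]⟩
      simp at this
    calc a = cfc (id : ℂ → ℂ) a := (cfc_id ℂ a hn).symm
      _ = cfc (fun _ => z) a := cfc_congr fun w hw => hsub w hw
      _ = z • 1 := by rw [cfc_const z a hn, Algebra.algebraMap_eq_smul_one]
  obtain ⟨c, hc⟩ := key _ (realPart a).2
  obtain ⟨d, hd⟩ := key _ (imaginaryPart a).2
  refine ⟨c + Complex.I * d, ?_⟩
  rw [add_smul, mul_smul, ← hc, ← hd, realPart_add_I_smul_imaginaryPart]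

end CStarCategory

/-! ### Semisimplicity -/

section Semisimple

variable {M : Type u} [Category.{v} M] [CStarCategory M] {X Y Z : M}

theorem IsIrreducible.scalar_comp_dagger (hX : IsIrreducible X) {f : X ⟶ Y} (hf : f ≠ 0) :
    ∃ γ : ℂ, γ ≠ 0 ∧ f ≫ f† = (γ * starRingEnd ℂ γ) • 𝟙 X := by
  obtain ⟨g, hg⟩ := CStarCategory.positive f
  obtain ⟨γ, rfl⟩ := hX.2 g
  have h : f ≫ f† = (γ * starRingEnd ℂ γ) • 𝟙 X := by
    rw [hg, dagger_smul, dagger_id, Linear.smul_comp, Linear.comp_smul, Category.id_comp,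
      smul_smul]
  refine ⟨γ, ?_, h⟩
  rintro rfl
  exact hf (comp_dagger_eq_zero (by simpa using h))

/-- Schur's lemma: a nonzero morphism between irreducible objects is an isomorphism. -/
theorem IsIrreducible.isIso (hX : IsIrreducible X) (hY : IsIrreducible Y) {f : X ⟶ Y}
    (hf : f ≠ 0) : IsIso f := by
  obtain ⟨γ, hγ, h⟩ := hX.scalar_comp_dagger hf
  have hf' : f† ≠ 0 := fun h0 => hf (dagger_injective (by rw [h0, dagger_zero]))
  obtain ⟨δ, hδ, h'⟩ := hY.scalar_comp_dagger hf'
  rw [DaggerCategory.dagger_dagger] at h'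
  have hγ' : γ * starRingEnd ℂ γ ≠ 0 := by simpa using hγ
  have hδ' : δ * starRingEnd ℂ δ ≠ 0 := by simpa using hδ
  have : IsSplitMono f := ⟨⟨(γ * starRingEnd ℂ γ)⁻¹ • f†, by
    rw [Linear.comp_smul, h, smul_smul, inv_mul_cancel₀ hγ', one_smul]⟩⟩
  have : IsSplitEpi f := ⟨⟨(δ * starRingEnd ℂ δ)⁻¹ • f†, by
    rw [Linear.smul_comp, h', smul_smul, inv_mul_cancel₀ hδ', one_smul]⟩⟩
  exact isIso_of_mono_of_isSplitEpi f

theorem Irr.eq_of_hom_ne_zero {i j : Irr M} {f : i.rep ⟶ j.rep} (hf : f ≠ 0) : i = j := by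
  have := i.rep_irreducible.isIso j.rep_irreducible hf
  let e : i.rep ≅ j.rep := asIso f
  rw [← Quotient.out_eq i, ← Quotient.out_eq j]
  exact Quotient.sound ⟨e⟩

theorem Irr.hom_eq_zero {i j : Irr M} (h : i ≠ j) (f : i.rep ⟶ j.rep) : f = 0 := by
  by_contra hf
  exact h (Irr.eq_of_hom_ne_zero hf)

theorem IsIrreducible.exists_unitary (hX : IsIrreducible X) :
    ∃ (i : Irr M) (u : X ⟶ i.rep), u ≫ u† = 𝟙 X := by
  let i : Irr M := Quotient.mk (irrSetoid M) ⟨X, hX⟩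
  obtain ⟨e⟩ : Nonempty (X ≅ i.rep) :=
    (irrSetoid M).symm (Quotient.mk_out (s := irrSetoid M) ⟨X, hX⟩)
  have he : e.hom ≠ 0 := fun h => hX.1 (by rw [← e.hom_inv_id, h, Limits.zero_comp])
  obtain ⟨γ, hγ, h⟩ := hX.scalar_comp_dagger he
  refine ⟨i, γ⁻¹ • e.hom, ?_⟩
  rw [dagger_smul, Linear.smul_comp, Linear.comp_smul, h, smul_smul, smul_smul]
  have hγ' : starRingEnd ℂ γ ≠ 0 := by simpa using hγ
  rw [map_inv₀]
  field_simp
  simp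

theorem exists_projection [FiniteDimensional ℂ (X ⟶ X)] (h0 : 𝟙 X ≠ 0)
    (hX : ¬ IsIrreducible X) :
    ∃ p : X ⟶ X, p ≫ p = p ∧ p† = p ∧ p ≠ 0 ∧ p ≠ 𝟙 X := by
  by_contra! H
  refine hX ⟨h0, fun f => ?_⟩
  let := endCStarAlgebra X
  refine exists_eq_smul_one_of_projections (A := X ⟶ X) (fun p hp hp' => ?_) f
  by_contra! hne
  exact hne.2 (H p hp hp' hne.1)

theorem finrank_end_lt [FiniteDimensional ℂ (X ⟶ X)] {v : Y ⟶ X}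
    (hv : v ≫ v† = 𝟙 Y) (hne : v† ≫ v ≠ 𝟙 X) :
    Module.finrank ℂ (Y ⟶ Y) < Module.finrank ℂ (X ⟶ X) := by
  let φ : (Y ⟶ Y) →ₗ[ℂ] (X ⟶ X) :=
    { toFun := fun f => v† ≫ f ≫ v
      map_add' := fun f g => by simp
      map_smul' := fun c f => by simp }
  have hφ : Function.Injective φ := by
    intro f g h
    have h' := congrArg (fun t => v ≫ t ≫ v†) (show v† ≫ f ≫ v = v† ≫ g ≫ v from h)
    simpa [hv, reassoc_of% hv] using h'
  rw [← LinearMap.finrank_range_of_inj hφ]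
  refine Submodule.finrank_lt fun htop => hne ?_
  obtain ⟨f, hf⟩ : 𝟙 X ∈ LinearMap.range φ := htop ▸ Submodule.mem_top
  have h1 : v† ≫ f ≫ v = 𝟙 X := hf
  calc v† ≫ v = (v† ≫ v) ≫ v† ≫ f ≫ v := by rw [h1, Category.comp_id]
    _ = v† ≫ f ≫ v := by rw [Category.assoc, reassoc_of% hv]
    _ = 𝟙 X := h1

/-- Every object of a C*-category with finite-dimensional Hom spaces is a finite direct sum of
irreducible objects, in the form `1 = ∑ vₖ vₖ*` with `vₖ` starting at irreducible objects. -/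
theorem exists_decomposition [∀ X : M, FiniteDimensional ℂ (X ⟶ X)] (X : M) :
    ∃ (ι : Type) (_ : Fintype ι) (i : ι → Irr M) (v : ∀ k, (i k).rep ⟶ X),
      ∑ k, (v k)† ≫ v k = 𝟙 X := by
  induction hn : Module.finrank ℂ (X ⟶ X) using Nat.strong_induction_on generalizing X with
  | _ n ih =>
    by_cases h0 : 𝟙 X = 0
    · exact ⟨Empty, inferInstance, Empty.elim, fun k => k.elim, by simp [h0]⟩
    by_cases hX : IsIrreducible X
    · obtain ⟨i, u, hu⟩ := hX.exists_unitary
      exact ⟨Unit, inferInstance, fun _ => i, fun _ => u†, by simp [hu]⟩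
    -- a nontrivial projection splits `X` into summands with smaller endomorphism algebras
    obtain ⟨p, hp, hp', hp0, hp1⟩ := exists_projection h0 hX
    obtain ⟨Y, v, hv, hvp⟩ := CStarCategory.exists_subobject p hp hp'
    obtain ⟨Z, w, hw, hwp⟩ := CStarCategory.exists_subobject (𝟙 X - p)
      (by simp [hp]) (by rw [dagger_sub, dagger_id, hp'])
    obtain ⟨ι, _, i, a, ha⟩ := ih _ (hn ▸ finrank_end_lt hv (hvp ▸ hp1)) Y rfl
    obtain ⟨κ, _, j, b, hb⟩ := ih _ (hn ▸ finrank_end_lt hw (by rw [hwp]; simpa using hp0)) Z rfl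
    refine ⟨ι ⊕ κ, inferInstance, Sum.elim i j,
      fun k => Sum.casesOn k (fun k => a k ≫ v) (fun k => b k ≫ w), ?_⟩
    have h1 : ∑ k, (a k ≫ v)† ≫ a k ≫ v = v† ≫ v := by
      have := congrArg (fun t => v† ≫ t ≫ v) ha
      simpa [Preadditive.sum_comp, Preadditive.comp_sum] using this
    have h2 : ∑ k, (b k ≫ w)† ≫ b k ≫ w = w† ≫ w := by
      have := congrArg (fun t => w† ≫ t ≫ w) hb
      simpa [Preadditive.sum_comp, Preadditive.comp_sum] using this
    rw [Fintype.sum_sum_type]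
    refine (congrArg₂ (· + ·) h1 h2).trans ?_
    rw [hvp, hwp]
    abel

theorem hom_ext_irr [∀ X : M, FiniteDimensional ℂ (X ⟶ X)] {f g : X ⟶ Y}
    (h : ∀ (i : Irr M) (v : i.rep ⟶ X), v ≫ f = v ≫ g) : f = g := by
  obtain ⟨ι, _, i, v, hv⟩ := exists_decomposition X
  rw [← Category.id_comp f, ← Category.id_comp g, ← hv]
  simp only [Preadditive.sum_comp, Category.assoc, h]

end Semisimple

section Bounded

variable {M : Type u} [Category.{v} M] [CStarCategory M]

/-- If `f* f` and `c - f* f` are positive endomorphisms, then `‖f* f‖ ≤ c`. -/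
theorem norm_comp_dagger_le_of_add_sum_eq {X Y : M} {ι : Type*} [Fintype ι] {Z : ι → M}
    (f : X ⟶ Y) (g : ∀ k, X ⟶ Z k) {c : ℝ} (hc : 0 ≤ c)
    (h : f ≫ f† + ∑ k, g k ≫ (g k)† = (c : ℂ) • 𝟙 X) : ‖f ≫ f†‖ ≤ c := by
  let := endCStarAlgebra X
  let := CStarAlgebra.spectralOrder (X ⟶ X)
  have := CStarAlgebra.spectralOrderedRing (X ⟶ X)
  have hpos : ∀ {Y : M} (f : X ⟶ Y), 0 ≤ f ≫ f† := by
    intro Y f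
    obtain ⟨g, hg⟩ := CStarCategory.positive f
    rw [hg]
    exact star_mul_self_nonneg (R := (X ⟶ X)) g
  have hle : f ≫ f† ≤ (c : ℂ) • 𝟙 X := by
    rw [← h]
    exact le_add_of_nonneg_right (Finset.sum_nonneg fun k _ => hpos (g k))
  refine (CStarAlgebra.norm_le_norm_of_nonneg_of_le (hpos f) hle).trans ?_
  rw [norm_smul, Complex.norm_real, Real.norm_of_nonneg hc]
  exact mul_le_of_le_one_right hc (norm_id_le X)

variable [∀ X : M, FiniteDimensional ℂ (X ⟶ X)]

/-- A natural family of morphisms `X ⟶ H(X)` is uniformly bounded, as there are only finitely many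
irreducible objects. -/
theorem exists_bound_of_natural [Finite (Irr M)] (H : M ⥤ M) [IsCStarFunctor H]
    (x : ∀ X : M, X ⟶ H.obj X) (hx : ∀ {X Y : M} (f : X ⟶ Y), f ≫ x Y = x X ≫ H.map f) :
    ∃ K : ℝ, ∀ X, ‖x X‖ ≤ K := by
  have := Fintype.ofFinite (Irr M)
  have h1 : ∀ i : Irr M, ∃ γ : ℂ, x i.rep ≫ (x i.rep)† = (γ * starRingEnd ℂ γ) • 𝟙 i.rep := by
    intro i
    by_cases h0 : x i.rep = 0
    · exact ⟨0, by simp [h0]⟩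
    · obtain ⟨γ, -, h⟩ := i.rep_irreducible.scalar_comp_dagger h0
      exact ⟨γ, h⟩
  choose γ hγ using h1
  set c : ℝ := ∑ i, ‖γ i‖ ^ 2 with hc
  have hc0 : 0 ≤ c := Finset.sum_nonneg fun i _ => by positivity
  have hle : ∀ i, ‖γ i‖ ^ 2 ≤ c := fun i =>
    Finset.single_le_sum (f := fun i => ‖γ i‖ ^ 2) (fun i _ => by positivity) (Finset.mem_univ i)
  refine ⟨c + 1, fun X => ?_⟩
  obtain ⟨ι, _, i, v, hv⟩ := exists_decomposition X
  have hvx : ∀ k, v k ≫ x X ≫ (x X)† = ((‖γ (i k)‖ ^ 2 : ℝ) : ℂ) • v k := by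
    intro k
    have h2 := congrArg (fun t => t†) (hx (v k)†)
    simp only [DaggerCategory.dagger_comp, IsCStarFunctor.map_dagger,
      DaggerCategory.dagger_dagger] at h2
    rw [reassoc_of% (hx (v k)), ← h2, ← Category.assoc, hγ, Linear.smul_comp, Category.id_comp,
      Complex.mul_conj, Complex.normSq_eq_norm_sq]
  -- `x* x` acts by the scalar `|γ|²` on each summand, so `c - x* x` is a positive combination of
  -- the projections onto the summands
  have key := norm_comp_dagger_le_of_add_sum_eq (x X)
    (fun k => ((Real.sqrt (c - ‖γ (i k)‖ ^ 2) : ℝ) : ℂ) • (v k)†) hc0 (by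
      rw [← Category.id_comp (x X ≫ (x X)†), ← hv, Preadditive.sum_comp, ← Finset.sum_add_distrib,
        Finset.smul_sum]
      refine Finset.sum_congr rfl fun k _ => ?_
      rw [Category.assoc, hvx, dagger_smul, Linear.smul_comp, Linear.comp_smul, Linear.comp_smul,
        smul_smul, Complex.conj_ofReal, ← Complex.ofReal_mul,
        Real.mul_self_sqrt (sub_nonneg.2 (hle _)), DaggerCategory.dagger_dagger, ← add_smul,
        ← Complex.ofReal_add, add_sub_cancel])
  rw [CStarCategory.norm_dagger_comp] at key
  nlinarith [norm_nonneg (x X)]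

end Bounded

/-! ### The Hilbert space structure defined by a trace -/

/-- Orthonormal bases for a positive definite form.  The form is given as a function, because the Hom
spaces to which this is applied already carry another norm. -/
theorem exists_orthonormal_of_form {V : Type*} [AddCommGroup V] [Module ℂ V]
    [FiniteDimensional ℂ V] (B : V → V → ℂ) (hadd : ∀ x y z, B (x + y) z = B x z + B y z)
    (hsmul : ∀ (c : ℂ) x y, B (c • x) y = c * B x y)
    (hconj : ∀ x y, starRingEnd ℂ (B x y) = B y x) (hnonneg : ∀ x, 0 ≤ B x x)
    (hdef : ∀ x, B x x = 0 → x = 0) :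
    ∃ (n : ℕ) (e : Fin n → V), (∀ a b, B (e a) (e b) = if a = b then 1 else 0) ∧
      ∀ x, ∑ a, B x (e a) • e a = x := by
  let core : InnerProductSpace.Core ℂ V :=
    { inner := fun x y => B y x
      conj_inner_symm := fun x y => hconj x y
      re_inner_nonneg := fun x => (Complex.nonneg_iff.1 (hnonneg x)).1
      add_left := fun x y z => by
        rw [← hconj (x + y) z, hadd, map_add, hconj, hconj]
      smul_left := fun x y r => by
        rw [← hconj (r • x) y, hsmul, map_mul, hconj]
      definite := hdef }
  let : NormedAddCommGroup V := core.toNormedAddCommGroup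
  let : InnerProductSpace ℂ V := InnerProductSpace.ofCore core.toCore
  have hinner : ∀ x y : V, inner ℂ x y = B y x := fun _ _ => rfl
  refine ⟨_, stdOrthonormalBasis ℂ V, fun a b => ?_, fun x => ?_⟩
  · rw [← hinner, orthonormal_iff_ite.1 (stdOrthonormalBasis ℂ V).orthonormal]
    simp only [eq_comm]
  · simpa only [hinner] using (stdOrthonormalBasis ℂ V).sum_repr' x

namespace ModuleTrace

variable {C : Type u₁} [Category.{v₁} C] [CStarCategory C] [MonoidalCategory C]
  {M : Type u₂} [Category.{v₂} M] [CStarCategory M] [MonoidalLeftAction C M]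
  (τ : ModuleTrace C M) {X Y Z : M}

theorem tr_swap (f : X ⟶ Y) (g : Y ⟶ X) : τ.tr X (f ≫ g) = τ.tr Y (g ≫ f) := by
  simpa using τ.tr_comm f g†

theorem dim_pos (i : Irr M) : 0 < τ.dim i.rep := by
  refine lt_of_le_of_ne ?_ (τ.tr_id_ne_zero i.rep_irreducible).symm
  simpa [dim] using τ.tr_nonneg (𝟙 i.rep)

theorem dim_ne_zero (i : Irr M) : τ.dim i.rep ≠ 0 := (τ.dim_pos i).ne'

theorem eq_tr_smul_id (i : Irr M) (f : i.rep ⟶ i.rep) :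
    f = ((τ.dim i.rep)⁻¹ * τ.tr i.rep f) • 𝟙 i.rep := by
  obtain ⟨c, rfl⟩ := i.rep_irreducible.2 f
  rw [map_smul, smul_eq_mul, mul_left_comm]
  change c • 𝟙 i.rep = (c * ((τ.dim i.rep)⁻¹ * τ.dim i.rep)) • 𝟙 i.rep
  rw [inv_mul_cancel₀ (τ.dim_ne_zero i), mul_one]

theorem dim_smul_eq (i : Irr M) (f : i.rep ⟶ i.rep) :
    τ.dim i.rep • f = τ.tr i.rep f • 𝟙 i.rep := by
  conv_lhs => rw [τ.eq_tr_smul_id i f]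
  rw [smul_smul, mul_inv_cancel_left₀ (τ.dim_ne_zero i)]

theorem dim_mul_scalar (i : Irr M) (f : i.rep ⟶ i.rep) :
    τ.dim i.rep * i.scalar f = τ.tr i.rep f := by
  conv_rhs => rw [i.scalar_spec f]
  rw [map_smul, smul_eq_mul, mul_comm]
  rfl

theorem tr_comp_dagger_nonneg (f : X ⟶ Y) : 0 ≤ τ.tr X (f ≫ f†) := by
  obtain ⟨g, hg⟩ := CStarCategory.positive f
  exact hg ▸ τ.tr_nonneg g

theorem tr_conj (f g : X ⟶ Y) : starRingEnd ℂ (τ.tr X (f ≫ g†)) = τ.tr X (g ≫ f†) := by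
  have h0 : ∀ f : X ⟶ Y, (τ.tr X (f ≫ f†)).im = 0 := fun f =>
    ((Complex.nonneg_iff.1 (τ.tr_comp_dagger_nonneg f)).2).symm
  have h1 := h0 (f + g)
  have h2 := h0 (f + Complex.I • g)
  simp only [dagger_add, dagger_smul, Preadditive.add_comp, Preadditive.comp_add,
    Linear.smul_comp, Linear.comp_smul, map_add, map_smul, smul_eq_mul, Complex.add_im,
    Complex.mul_im, h0, Complex.conj_I, Complex.I_re, Complex.I_im, Complex.neg_re,
    Complex.neg_im, Complex.mul_re, Complex.add_re] at h1 h2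
  apply Complex.ext
  · simp only [Complex.conj_re]; linarith
  · simp only [Complex.conj_im]; linarith

variable [∀ X Y : M, FiniteDimensional ℂ (X ⟶ Y)]

/-- The trace is faithful. -/
theorem eq_zero_of_tr {f : X ⟶ Y} (h : τ.tr X (f ≫ f†) = 0) : f = 0 := by
  obtain ⟨ι, _, i, v, hv⟩ := exists_decomposition X
  have h1 : τ.tr X (f ≫ f†) = ∑ k, τ.tr _ ((v k ≫ f) ≫ (v k ≫ f)†) := by
    rw [← Category.id_comp (f ≫ f†), ← hv, Preadditive.sum_comp, map_sum]
    refine Finset.sum_congr rfl fun k _ => ?_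
    rw [Category.assoc, tr_swap]
    simp
  rw [h] at h1
  have h2 := (Finset.sum_eq_zero_iff_of_nonneg fun k _ => τ.tr_comp_dagger_nonneg (v k ≫ f)).1 h1.symm
  have h3 : ∀ k, v k ≫ f = 0 := by
    intro k
    by_contra hne
    obtain ⟨γ, hγ, hk⟩ := (i k).rep_irreducible.scalar_comp_dagger hne
    have := h2 k (Finset.mem_univ k)
    rw [hk, map_smul, smul_eq_mul] at this
    exact mul_ne_zero (by simpa using hγ) (τ.dim_ne_zero (i k)) this
  rw [← Category.id_comp f, ← hv]
  simp [Preadditive.sum_comp, h3]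

theorem exists_orthonormalBasis (X Y : M) :
    ∃ (n : ℕ) (e : Fin n → (X ⟶ Y)),
      (∀ a b, τ.tr X (e a ≫ (e b)†) = if a = b then 1 else 0) ∧
        ∀ x, ∑ a, τ.tr X (x ≫ (e a)†) • e a = x :=
  exists_orthonormal_of_form (fun x y => τ.tr X (x ≫ y†)) (fun x y z => by simp)
    (fun c x y => by simp) (fun x y => τ.tr_conj x y) (fun x => τ.tr_comp_dagger_nonneg x)
    (fun x hx => τ.eq_zero_of_tr hx)

/-- The dimension of `Hom(X, Y)`, as the size of a chosen orthonormal basis. -/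
def onbDim (X Y : M) : ℕ := (τ.exists_orthonormalBasis X Y).choose

/-- A chosen orthonormal basis of `Hom(X, Y)` for the scalar product `⟨x, y⟩ = tr_X(y* x)`. -/
def onb (X Y : M) : Fin (τ.onbDim X Y) → (X ⟶ Y) :=
  (τ.exists_orthonormalBasis X Y).choose_spec.choose

theorem tr_onb (X Y : M) (a b : Fin (τ.onbDim X Y)) :
    τ.tr X (τ.onb X Y a ≫ (τ.onb X Y b)†) = if a = b then 1 else 0 :=
  (τ.exists_orthonormalBasis X Y).choose_spec.choose_spec.1 a b

theorem sum_onb (x : X ⟶ Y) : ∑ a, τ.tr X (x ≫ (τ.onb X Y a)†) • τ.onb X Y a = x :=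
  (τ.exists_orthonormalBasis X Y).choose_spec.choose_spec.2 x

variable [Fintype (Irr M)]

/-- Orthonormal bases of the spaces `Hom(i, Y)` resolve the identity of `Y`. -/
theorem sum_dim_smul_eq_id {Y : M} {n : Irr M → ℕ} {y : ∀ i : Irr M, Fin (n i) → (i.rep ⟶ Y)}
    (hy : ∀ i (v : i.rep ⟶ Y), ∑ a, τ.tr _ (v ≫ (y i a)†) • y i a = v) :
    ∑ i : Irr M, ∑ a, τ.dim i.rep • ((y i a)† ≫ y i a) = 𝟙 Y := by
  refine hom_ext_irr fun j v => ?_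
  rw [Category.comp_id, Preadditive.comp_sum, Finset.sum_eq_single j]
  · rw [Preadditive.comp_sum]
    conv_rhs => rw [← hy j v]
    refine Finset.sum_congr rfl fun a _ => ?_
    rw [Linear.comp_smul, ← Category.assoc, ← Linear.smul_comp, τ.dim_smul_eq, Linear.smul_comp,
      Category.id_comp]
  · intro i _ hi
    rw [Preadditive.comp_sum]
    refine Finset.sum_eq_zero fun a _ => ?_
    rw [Linear.comp_smul, ← Category.assoc, Irr.hom_eq_zero (Ne.symm hi) (v ≫ _),
      Limits.zero_comp, smul_zero]
  · exact fun h => (h (Finset.mem_univ j)).elim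

/-- The weighted traces of a family of endomorphisms, summed over the irreducible objects. -/
theorem sum_eq_zero_imp {X Y : Irr M → M} (f : ∀ i, X i ⟶ Y i)
    (h : ∑ i, τ.dim i.rep * τ.tr _ (f i ≫ (f i)†) ≤ 0) (i : Irr M) : f i = 0 := by
  have hn : ∀ i ∈ Finset.univ, 0 ≤ τ.dim i.rep * τ.tr _ (f i ≫ (f i)†) := fun i _ =>
    mul_nonneg (τ.dim_pos i).le (τ.tr_comp_dagger_nonneg _)
  have h1 := (Finset.sum_eq_zero_iff_of_nonneg hn).1 (le_antisymm h (Finset.sum_nonneg hn)) i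
    (Finset.mem_univ i)
  exact τ.eq_zero_of_tr ((mul_eq_zero.1 h1).resolve_left (τ.dim_ne_zero i))

end ModuleTrace

/-! ### Adjoints of C*-functors that are unitary for the trace -/

section DirectSum

variable {M : Type u} [Category.{v} M] [CStarCategory M]

theorem exists_finite_directSum [Nonempty M] {ι : Type*} [DecidableEq ι] (Y : ι → M)
    (s : Finset ι) :
    ∃ (Z : M) (w : ∀ k, Y k ⟶ Z), (∀ k ∈ s, w k ≫ (w k)† = 𝟙 (Y k)) ∧
      (∀ k ∈ s, ∀ l ∈ s, k ≠ l → w k ≫ (w l)† = 0) ∧ ∑ k ∈ s, (w k)† ≫ w k = 𝟙 Z := by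
  induction s using Finset.induction_on with
  | empty =>
    obtain ⟨X⟩ := ‹Nonempty M›
    obtain ⟨Z, v, hv, hv'⟩ := CStarCategory.exists_subobject (0 : X ⟶ X) (by simp) (by simp)
    refine ⟨Z, fun _ => 0, by simp, by simp, ?_⟩
    have h : v ≫ (v† ≫ v) ≫ v† = 𝟙 Z := by simp [hv]
    rw [← h, hv']
    simp
  | insert a s ha ih =>
    obtain ⟨Z, w, h1, h2, h3⟩ := ih
    obtain ⟨W, p, q, hp, hq, hpq⟩ := CStarCategory.exists_directSum (Y a) Z
    have hpq0 : p ≫ q† = 0 := by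
      have h := congrArg (fun t => p ≫ t ≫ q†) hpq
      simp only [Preadditive.add_comp, Preadditive.comp_add, Category.assoc, Category.id_comp,
        hq, Category.comp_id, reassoc_of% hp] at h
      simpa using h
    have hqp0 : q ≫ p† = 0 := by
      have := congrArg (fun t => t†) hpq0
      simpa using this
    have hne : ∀ k ∈ s, k ≠ a := fun k hk h => ha (h ▸ hk)
    refine ⟨W, Function.update (fun k => w k ≫ q) a p, ?_, ?_, ?_⟩
    · intro k hk
      by_cases hka : k = a
      · subst hka
        simpa using hp
      · rw [Function.update_of_ne hka, DaggerCategory.dagger_comp, Category.assoc,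
          reassoc_of% hq, h1 k ((Finset.mem_insert.1 hk).resolve_left hka)]
    · intro k hk l hl hkl
      by_cases hka : k = a
      · subst hka
        rw [Function.update_self, Function.update_of_ne (Ne.symm hkl),
          DaggerCategory.dagger_comp, reassoc_of% hpq0, Limits.zero_comp]
      · by_cases hla : l = a
        · subst hla
          rw [Function.update_self, Function.update_of_ne hka, Category.assoc, hqp0,
            Limits.comp_zero]
        · rw [Function.update_of_ne hka, Function.update_of_ne hla, DaggerCategory.dagger_comp,
            Category.assoc, reassoc_of% hq,
            h2 k ((Finset.mem_insert.1 hk).resolve_left hka) l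
              ((Finset.mem_insert.1 hl).resolve_left hla) hkl]
    · rw [Finset.sum_insert ha, Function.update_self]
      have h : ∑ k ∈ s, (Function.update (fun k => w k ≫ q) a p k)† ≫
          Function.update (fun k => w k ≫ q) a p k = q† ≫ q := by
        have h4 := congrArg (fun t => q† ≫ t ≫ q) h3
        simp only [Preadditive.sum_comp, Preadditive.comp_sum, Category.id_comp] at h4
        rw [← h4]
        refine Finset.sum_congr rfl fun k hk => ?_
        rw [Function.update_of_ne (hne k hk)]
        simp
      rw [h, hpq]

end DirectSum

section Representation

variable {C : Type u₁} [Category.{v₁} C] [CStarCategory C] [MonoidalCategory C]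
  {M : Type u₂} [Category.{v₂} M] [CStarCategory M] [MonoidalLeftAction C M]
  (τ : ModuleTrace C M)

theorem ModuleTrace.exists_sqrt_dim (i : Irr M) :
    ∃ c : ℂ, c ≠ 0 ∧ c * starRingEnd ℂ c = τ.dim i.rep := by
  have h := Complex.pos_iff.1 (τ.dim_pos i)
  refine ⟨(Real.sqrt (τ.dim i.rep).re : ℝ), ?_, ?_⟩
  · exact_mod_cast (Real.sqrt_pos.2 h.1).ne'
  · rw [Complex.conj_ofReal, ← Complex.ofReal_mul, Real.mul_self_sqrt h.1.le]
    exact Complex.ext rfl h.2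

/-- The map `Hom(X, Z) → Hom(F(X), Y)`, `k ↦ r F(k)`, is unitary for the trace scalar products,
for all `X`: a representation of `X ↦ Hom(F(X), Y)` as a functor to Hilbert spaces. -/
structure UnitarilyRepresents (F : M ⥤ M) (Y Z : M) (r : F.obj Z ⟶ Y) : Prop where
  tr_eq {X : M} (k l : X ⟶ Z) :
    τ.tr _ ((F.map k ≫ r) ≫ (F.map l ≫ r)†) = τ.tr X (k ≫ l†)
  surj {X : M} (x : F.obj X ⟶ Y) : ∃ k : X ⟶ Z, F.map k ≫ r = x

variable [∀ X Y : M, FiniteDimensional ℂ (X ⟶ Y)]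

/-- The isometry condition need only be checked on irreducible objects. -/
theorem unitarilyRepresents_of_irr {F : M ⥤ M} [IsCStarFunctor F] {Y Z : M} {r : F.obj Z ⟶ Y}
    (h1 : ∀ (i : Irr M) (k l : i.rep ⟶ Z),
      τ.tr _ ((F.map k ≫ r) ≫ (F.map l ≫ r)†) = τ.tr i.rep (k ≫ l†))
    (h2 : ∀ (i : Irr M) (x : F.obj i.rep ⟶ Y), ∃ k : i.rep ⟶ Z, F.map k ≫ r = x) :
    UnitarilyRepresents τ F Y Z r where
  tr_eq {X} k l := by
    obtain ⟨ι, _, i, v, hv⟩ := exists_decomposition X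
    have hF : ∑ k, F.map (v k)† ≫ F.map (v k) = 𝟙 (F.obj X) := by
      rw [← F.map_id, ← hv, F.map_sum]
      simp
    rw [← Category.id_comp (_ ≫ (F.map l ≫ r)†), ← Category.id_comp (k ≫ l†), ← hv, ← hF,
      Preadditive.sum_comp, Preadditive.sum_comp, map_sum, map_sum]
    refine Finset.sum_congr rfl fun a _ => ?_
    rw [Category.assoc, τ.tr_swap (F.map (v a)†), Category.assoc (v a)†, τ.tr_swap (v a)†]
    have h := h1 (i a) (v a ≫ k) (v a ≫ l)
    simpa [IsCStarFunctor.map_dagger] using h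
  surj {X} x := by
    obtain ⟨ι, _, i, v, hv⟩ := exists_decomposition X
    choose k hk using fun a => h2 (i a) (F.map (v a) ≫ x)
    refine ⟨∑ a, (v a)† ≫ k a, ?_⟩
    rw [F.map_sum, Preadditive.sum_comp]
    simp only [F.map_comp, Category.assoc, hk]
    conv_rhs => rw [← Category.id_comp x, ← F.map_id, ← hv, F.map_sum, Preadditive.sum_comp]
    simp

/-- The representing object of `Hom(F(-), Y)` is the direct sum of copies of the irreducible objects `i`
indexed by orthonormal bases of `Hom(F(i), Y)`; on the copy belonging to `e`, the morphism `r` is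
`√d(i) e`, as the inclusion of the copy has squared trace norm `d(i)`. -/
theorem exists_unitarilyRepresents [Finite (Irr M)] (F : M ⥤ M) [IsCStarFunctor F] (Y : M) :
    ∃ (Z : M) (r : F.obj Z ⟶ Y), UnitarilyRepresents τ F Y Z r := by
  classical
  have : Nonempty M := ⟨Y⟩
  have := Fintype.ofFinite (Irr M)
  choose c hc0 hc using τ.exists_sqrt_dim
  let n : Irr M → ℕ := fun i => τ.onbDim (F.obj i.rep) Y
  let e : ∀ i, Fin (n i) → (F.obj i.rep ⟶ Y) := fun i => τ.onb (F.obj i.rep) Y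
  obtain ⟨Z, w, hw1, hw2, hw3⟩ := exists_finite_directSum
    (fun k : Σ i : Irr M, Fin (n i) => k.1.rep) Finset.univ
  have hw2' : ∀ (i : Irr M) (a b : Fin (n i)),
      w ⟨i, a⟩ ≫ (w ⟨i, b⟩)† = if a = b then 𝟙 i.rep else 0 := by
    intro i a b
    split_ifs with hab
    · subst hab
      exact hw1 ⟨i, a⟩ (Finset.mem_univ _)
    · exact hw2 ⟨i, a⟩ (Finset.mem_univ _) ⟨i, b⟩ (Finset.mem_univ _) (by simpa using hab)
  let r : F.obj Z ⟶ Y := ∑ k : Σ i : Irr M, Fin (n i), c k.1 • (F.map (w k)† ≫ e k.1 k.2)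
  have hwr : ∀ (i : Irr M) (a : Fin (n i)), F.map (w ⟨i, a⟩) ≫ r = c i • e i a := by
    intro i a
    rw [Preadditive.comp_sum, Finset.sum_eq_single ⟨i, a⟩]
    · rw [Linear.comp_smul, ← F.map_comp_assoc, hw1 ⟨i, a⟩ (Finset.mem_univ _), F.map_id,
        Category.id_comp]
    · intro l _ hl
      rw [Linear.comp_smul, ← F.map_comp_assoc,
        hw2 ⟨i, a⟩ (Finset.mem_univ _) l (Finset.mem_univ _) (Ne.symm hl),
        IsCStarFunctor.map_zero, Limits.zero_comp, smul_zero]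
    · exact fun h => (h (Finset.mem_univ _)).elim
  have hk : ∀ (i : Irr M) (k : i.rep ⟶ Z), ∃ κ : Fin (n i) → ℂ, k = ∑ a, κ a • w ⟨i, a⟩ := by
    intro i k
    choose κ hκ using fun a : Fin (n i) => i.rep_irreducible.2 (k ≫ (w ⟨i, a⟩)†)
    refine ⟨κ, ?_⟩
    conv_lhs => rw [← Category.comp_id k, ← hw3, Preadditive.comp_sum]
    rw [Fintype.sum_sigma, Finset.sum_eq_single i]
    · refine Finset.sum_congr rfl fun a _ => ?_
      rw [← Category.assoc, hκ a, Linear.smul_comp, Category.id_comp]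
    · intro j _ hj
      refine Finset.sum_eq_zero fun a _ => ?_
      rw [← Category.assoc, Irr.hom_eq_zero (Ne.symm hj) (k ≫ _), Limits.zero_comp]
    · exact fun h => (h (Finset.mem_univ i)).elim
  refine ⟨Z, r, unitarilyRepresents_of_irr τ (fun i k l => ?_) fun i x => ?_⟩
  · obtain ⟨κ, rfl⟩ := hk i k
    obtain ⟨μ, rfl⟩ := hk i l
    have hF : ∀ κ : Fin (n i) → ℂ, F.map (∑ a, κ a • w ⟨i, a⟩) ≫ r = ∑ a, (κ a * c i) • e i a := by
      intro κ
      rw [F.map_sum, Preadditive.sum_comp]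
      refine Finset.sum_congr rfl fun a _ => ?_
      rw [IsCStarFunctor.map_smul, Linear.smul_comp, hwr, smul_smul]
    have he : ∀ a b, τ.tr _ (e i a ≫ (e i b)†) = if a = b then 1 else 0 := τ.tr_onb _ _
    rw [hF, hF, dagger_sum, dagger_sum, Preadditive.sum_comp, Preadditive.sum_comp, map_sum,
      map_sum]
    refine Finset.sum_congr rfl fun a _ => ?_
    rw [Preadditive.comp_sum, Preadditive.comp_sum, map_sum, map_sum]
    refine Finset.sum_congr rfl fun b _ => ?_
    simp only [dagger_smul, Linear.smul_comp, Linear.comp_smul, map_smul, smul_eq_mul, he, hw2']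
    split_ifs with hab
    · change _ = _ * (_ * τ.dim i.rep)
      rw [← hc i, map_mul]
      ring
    · simp
  · refine ⟨∑ a, ((c i)⁻¹ * τ.tr _ (x ≫ (e i a)†)) • w ⟨i, a⟩, ?_⟩
    conv_rhs => rw [← τ.sum_onb x]
    rw [F.map_sum, Preadditive.sum_comp]
    refine Finset.sum_congr rfl fun a _ => ?_
    rw [IsCStarFunctor.map_smul, Linear.smul_comp, hwr, smul_smul, mul_right_comm,
      inv_mul_cancel₀ (hc0 i), one_mul]

end Representation

section Adjunction

variable {C : Type u₁} [Category.{v₁} C] [CStarCategory C] [MonoidalCategory C]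
  {M : Type u₂} [Category.{v₂} M] [CStarCategory M] [MonoidalLeftAction C M]

/-- An adjunction `F ⊣ G` between C*-functors for which the bijections
`Hom(F(X), Y) ≅ Hom(X, G(Y))` are unitary for the trace scalar products.  It is given by its unit
`R_X : X ⟶ G(F(X))` and by the adjoint `R'_X : X ⟶ F(G(X))` of its counit, as for solutions of the
conjugate equations; unitarity is stated as `tr_{F(X)}(T) = tr_X(R* G(T) R)`. -/
structure TraceAdjunction (τ : ModuleTrace C M) (F G : M ⥤ M) where
  R (X : M) : X ⟶ G.obj (F.obj X)
  R' (X : M) : X ⟶ F.obj (G.obj X)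
  R_naturality {X Y : M} (f : X ⟶ Y) : f ≫ R Y = R X ≫ G.map (F.map f)
  R'_naturality {X Y : M} (f : X ⟶ Y) : f ≫ R' Y = R' X ≫ F.map (G.map f)
  left_zigzag (X : M) : F.map (R X) ≫ (R' (F.obj X))† = 𝟙 (F.obj X)
  right_zigzag (X : M) : R (G.obj X) ≫ G.map (R' X)† = 𝟙 (G.obj X)
  tr_eq {X : M} (T : F.obj X ⟶ F.obj X) : τ.tr _ T = τ.tr X (R X ≫ G.map T ≫ (R X)†)

namespace TraceAdjunction

variable {τ : ModuleTrace C M} {F G : M ⥤ M}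

section

variable (A : TraceAdjunction τ F G) {X Y : M}

theorem transpose_injective {k l : X ⟶ G.obj Y}
    (h : F.map k ≫ (A.R' Y)† = F.map l ≫ (A.R' Y)†) : k = l := by
  have h' := congrArg (fun t => A.R X ≫ G.map t) h
  simpa only [G.map_comp, ← reassoc_of% A.R_naturality, A.right_zigzag, Category.comp_id] using h'

variable [IsCStarFunctor G]

/-- The bijection `Hom(X, G(Y)) → Hom(F(X), Y)` is isometric. -/
theorem tr_transpose (k l : X ⟶ G.obj Y) :
    τ.tr _ ((F.map k ≫ (A.R' Y)†) ≫ (F.map l ≫ (A.R' Y)†)†) = τ.tr X (k ≫ l†) := by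
  have h : ∀ k : X ⟶ G.obj Y, A.R X ≫ G.map (F.map k ≫ (A.R' Y)†) = k := by
    intro k
    rw [G.map_comp, ← reassoc_of% A.R_naturality k, A.right_zigzag, Category.comp_id]
  rw [A.tr_eq]
  congr 1
  conv_rhs => rw [← h k, ← h l]
  simp [IsCStarFunctor.map_dagger]

variable [IsCStarFunctor F]

theorem R'_dagger_naturality (f : X ⟶ Y) :
    (A.R' X)† ≫ f = F.map (G.map f) ≫ (A.R' Y)† := by
  have := congrArg (fun t => t†) (A.R'_naturality f†)
  simpa [IsCStarFunctor.map_dagger] using this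

theorem R_dagger_naturality (f : X ⟶ Y) :
    (A.R X)† ≫ f = G.map (F.map f) ≫ (A.R Y)† := by
  have := congrArg (fun t => t†) (A.R_naturality f†)
  simpa [IsCStarFunctor.map_dagger] using this

theorem transpose_surjective (x : F.obj X ⟶ Y) : ∃ k : X ⟶ G.obj Y, F.map k ≫ (A.R' Y)† = x :=
  ⟨A.R X ≫ G.map x, by
    rw [F.map_comp, Category.assoc, ← A.R'_dagger_naturality, reassoc_of% A.left_zigzag]⟩

/-- Exchanging the roles of the two functors. -/
def flip : TraceAdjunction τ G F where
  R := A.R'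
  R' := A.R
  R_naturality := A.R'_naturality
  R'_naturality := A.R_naturality
  left_zigzag X := by
    have := congrArg (fun t => t†) (A.right_zigzag X)
    simpa [IsCStarFunctor.map_dagger] using this
  right_zigzag X := by
    have := congrArg (fun t => t†) (A.left_zigzag X)
    simpa [IsCStarFunctor.map_dagger] using this
  tr_eq {X} T := by
    have h := A.tr_transpose T (𝟙 (G.obj X))
    rw [dagger_id, Category.comp_id, F.map_id, Category.id_comp, DaggerCategory.dagger_dagger,
      τ.tr_swap] at h
    exact h.symm

@[simp] theorem flip_R' (X : M) : A.flip.R' X = A.R X := rfl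

end

section Balance

variable [∀ X Y : M, FiniteDimensional ℂ (X ⟶ Y)] [Fintype (Irr M)]
  [IsCStarFunctor F] [IsCStarFunctor G] (A : TraceAdjunction τ F G) {X Y : M}

theorem _root_.CStarCat.ModuleTrace.tr_eq_sum_basis (τ : ModuleTrace C M) (K : M ⥤ M)
    [IsCStarFunctor K] {n : Irr M → ℕ} {y : ∀ i : Irr M, Fin (n i) → (i.rep ⟶ X)}
    (hy : ∀ i (v : i.rep ⟶ X), ∑ a, τ.tr _ (v ≫ (y i a)†) • y i a = v)
    (T : K.obj X ⟶ K.obj X) :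
    τ.tr _ T = ∑ i : Irr M, ∑ a, τ.dim i.rep *
      τ.tr _ (K.map (y i a) ≫ T ≫ (K.map (y i a))†) := by
  have h : 𝟙 (K.obj X) = ∑ i : Irr M, ∑ a, τ.dim i.rep •
      ((K.map (y i a))† ≫ K.map (y i a)) := by
    rw [← K.map_id, ← τ.sum_dim_smul_eq_id hy]
    simp only [K.map_sum, IsCStarFunctor.map_smul, K.map_comp, IsCStarFunctor.map_dagger]
  conv_lhs => rw [← Category.id_comp T, h]
  simp only [Preadditive.sum_comp, map_sum, Linear.smul_comp, map_smul, smul_eq_mul]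
  refine Finset.sum_congr rfl fun i _ => Finset.sum_congr rfl fun a _ => ?_
  rw [Category.assoc, τ.tr_swap, Category.assoc]

/-- The weighted trace of a natural endomorphism of `K ∘ F`, summed over the irreducible objects,
can be computed after closing `F` with the counit of the adjunction: both sides are the sum of
`d(i) d(j) tr_{K(j)}(K(z)* T K(z))` over orthonormal bases `z` of the spaces `Hom(j, F(i))`. -/
theorem balance (K : M ⥤ M) [IsCStarFunctor K]
    (T : ∀ X : M, K.obj (F.obj X) ⟶ K.obj (F.obj X))
    (hT : ∀ {X Y : M} (f : X ⟶ Y),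
      K.map (F.map f) ≫ T Y = T X ≫ K.map (F.map f)) :
    ∑ i : Irr M, τ.dim i.rep * τ.tr _ (T i.rep) =
      ∑ j : Irr M, τ.dim j.rep *
        τ.tr _ (K.map (A.R' j.rep) ≫ T (G.obj j.rep) ≫ K.map (A.R' j.rep)†) := by
  let y : ∀ i j : Irr M, _ → (i.rep ⟶ G.obj j.rep) := fun i j => τ.onb i.rep (G.obj j.rep)
  let m : ∀ i j : Irr M, _ → (j.rep ⟶ F.obj i.rep) := fun i j a =>
    (F.map (y i j a) ≫ (A.R' j.rep)†)†
  have hm : ∀ (i j : Irr M) (v : j.rep ⟶ F.obj i.rep),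
      ∑ a, τ.tr _ (v ≫ (m i j a)†) • m i j a = v := by
    intro i j v
    obtain ⟨k, hk⟩ := A.transpose_surjective v†
    apply dagger_injective
    rw [← hk, dagger_sum]
    conv_rhs => rw [← τ.sum_onb k, F.map_sum, Preadditive.sum_comp]
    refine Finset.sum_congr rfl fun a _ => ?_
    rw [dagger_smul, τ.tr_conj, ← A.tr_transpose k, hk, IsCStarFunctor.map_smul, Linear.smul_comp,
      τ.tr_swap]
    simp [m, y]
  have hl : ∀ i : Irr M, τ.dim i.rep * τ.tr _ (T i.rep) =
      ∑ j : Irr M, ∑ a, τ.dim i.rep * τ.dim j.rep *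
        τ.tr _ (K.map (m i j a) ≫ T i.rep ≫ (K.map (m i j a))†) := by
    intro i
    rw [τ.tr_eq_sum_basis K (fun j => hm i j) (T i.rep), Finset.mul_sum]
    refine Finset.sum_congr rfl fun j _ => ?_
    rw [Finset.mul_sum]
    exact Finset.sum_congr rfl fun a _ => (mul_assoc _ _ _).symm
  have hr : ∀ j : Irr M, τ.dim j.rep *
        τ.tr _ (K.map (A.R' j.rep) ≫ T (G.obj j.rep) ≫ K.map (A.R' j.rep)†) =
      ∑ i : Irr M, ∑ a, τ.dim i.rep * τ.dim j.rep *
        τ.tr _ (K.map (m i j a) ≫ T i.rep ≫ (K.map (m i j a))†) := by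
    intro j
    rw [τ.tr_swap, Category.assoc]
    refine (congrArg (τ.dim j.rep * ·) (τ.tr_eq_sum_basis (F ⋙ K)
      (fun i => τ.sum_onb (X := i.rep)) (T (G.obj j.rep) ≫ K.map (A.R' j.rep)† ≫
        K.map (A.R' j.rep)))).trans ?_
    rw [Finset.mul_sum]
    refine Finset.sum_congr rfl fun i _ => ?_
    rw [Finset.mul_sum]
    refine Finset.sum_congr rfl fun a _ => ?_
    rw [← mul_assoc, mul_comm (τ.dim j.rep)]
    congr 1
    simp only [Functor.comp_map, Functor.comp_obj, Category.assoc]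
    rw [reassoc_of% (hT (τ.onb i.rep (G.obj j.rep) a)), τ.tr_swap (K.map (m i j a)),
      Category.assoc]
    simp [m, y, IsCStarFunctor.map_dagger]
  rw [Finset.sum_congr rfl fun i _ => hl i, Finset.sum_congr rfl fun j _ => hr j,
    Finset.sum_comm]

end Balance

end TraceAdjunction

section Existence

variable (τ : ModuleTrace C M) [∀ X Y : M, FiniteDimensional ℂ (X ⟶ Y)]

theorem UnitarilyRepresents.ext {F : M ⥤ M} [IsCStarFunctor F] {Y Z : M} {r : F.obj Z ⟶ Y}
    (h : UnitarilyRepresents τ F Y Z r) {X : M} {k l : X ⟶ Z}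
    (hkl : F.map k ≫ r = F.map l ≫ r) : k = l := by
  rw [← sub_eq_zero]
  refine τ.eq_zero_of_tr ?_
  rw [← h.tr_eq, F.map_sub, Preadditive.sub_comp, hkl, sub_self, Limits.zero_comp, map_zero]

/-- Every C*-functor has an adjoint that is unitary for the trace scalar products. -/
theorem exists_traceAdjunction [Finite (Irr M)] (F : M ⥤ M) [IsCStarFunctor F] :
    ∃ (G : M ⥤ M) (_ : IsCStarFunctor G), Nonempty (TraceAdjunction τ F G) := by
  choose Z r hr using fun Y => exists_unitarilyRepresents τ F Y
  -- `pre X Y` inverts the bijection `Hom(X, G(Y)) → Hom(F(X), Y)`, which defines `G` on morphisms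
  choose pre hpre using fun (X Y : M) (x : F.obj X ⟶ Y) => (hr Y).surj x
  have hext : ∀ {X Y : M} {k l : X ⟶ Z Y}, F.map k ≫ r Y = F.map l ≫ r Y → k = l :=
    fun {X Y} {k l} h => (hr Y).ext τ h
  let G : M ⥤ M :=
    { obj := Z
      map := fun {Y Y'} g => pre (Z Y) Y' (r Y ≫ g)
      map_id := fun Y => hext (by rw [hpre]; simp)
      map_comp := fun f g => hext (by simp [hpre, reassoc_of% hpre]) }
  have hG : ∀ {Y Y' : M} (g : Y ⟶ Y'), F.map (G.map g) ≫ r Y' = r Y ≫ g := fun g => hpre _ _ _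
  have hdag : ∀ {Y Y' : M} (g : Y ⟶ Y'), G.map g† = (G.map g)† := by
    intro Y Y' g
    -- both sides have the same scalar products with all `l`, as the transposition is isometric
    have h1 : ∀ (l : Z Y' ⟶ Z Y), τ.tr _ (G.map g† ≫ l†) = τ.tr _ ((G.map g)† ≫ l†) := by
      intro l
      rw [← (hr Y).tr_eq, hG, ← DaggerCategory.dagger_comp (l), ← Category.id_comp (l ≫ G.map g)†,
        ← (hr Y').tr_eq]
      simp [hG]
    rw [← sub_eq_zero]
    refine τ.eq_zero_of_tr ?_
    rw [Preadditive.sub_comp, map_sub, h1, sub_self]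
  have hGs : IsCStarFunctor G :=
    { map_add := fun f g => hext (by rw [F.map_add, Preadditive.add_comp]; simp [hG])
      map_smul := fun c f => hext (by
        rw [hG, IsCStarFunctor.map_smul (F := F), Linear.smul_comp, hG, Linear.comp_smul])
      map_dagger := fun f => hdag f }
  have hη : ∀ X, F.map (pre X (F.obj X) (𝟙 (F.obj X))) ≫ r (F.obj X) = 𝟙 (F.obj X) :=
    fun X => hpre _ _ _
  exact ⟨G, hGs, ⟨
    { R := fun X => pre X (F.obj X) (𝟙 _)
      R' := fun X => (r X)†
      R_naturality := fun f => hext (by simp [hη, hG, reassoc_of% hη])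
      R'_naturality := fun f => by
        apply dagger_injective
        rw [DaggerCategory.dagger_comp, DaggerCategory.dagger_comp, DaggerCategory.dagger_dagger,
          DaggerCategory.dagger_dagger, ← IsCStarFunctor.map_dagger, ← IsCStarFunctor.map_dagger,
          hG]
      left_zigzag := fun X => by rw [DaggerCategory.dagger_dagger, hη]
      right_zigzag := fun X => hext (by
        rw [DaggerCategory.dagger_dagger, F.map_comp, Category.assoc, hG, reassoc_of% hη]
        simp)
      tr_eq := fun {X} T => by
        have h := (hr (F.obj X)).tr_eq (pre X (F.obj X) (𝟙 _) ≫ G.map T) (pre X (F.obj X) (𝟙 _))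
        simpa [hG, hη, reassoc_of% hη] using h }⟩⟩

end Existence

end Adjunction

/-! ### Conjugate equations and duality -/

section Dual

variable {C : Type u} [Category.{v} C] [DaggerCategory C]

theorem IsUnitary.inv_dagger {X Y : C} {e : X ≅ Y} (h : IsUnitary e.hom) : e.inv† = e.hom := by
  rw [h.inv_eq, DaggerCategory.dagger_dagger]

theorem dagger_hom_inv {X Y : C} (e : X ≅ Y) : e.hom† ≫ e.inv† = 𝟙 Y := by
  rw [← DaggerCategory.dagger_comp, e.inv_hom_id, dagger_id]

theorem dagger_inv_hom {X Y : C} (e : X ≅ Y) : e.inv† ≫ e.hom† = 𝟙 X := by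
  rw [← DaggerCategory.dagger_comp, e.hom_inv_id, dagger_id]

variable [MonoidalCategory C]

variable (C) in
/-- The tensor product is compatible with the involution, and the structure isomorphisms are
unitary. -/
class DaggerMonoidal : Prop where
  whiskerLeft_dagger (X : C) {Y Z : C} (f : Y ⟶ Z) : X ◁ f† = (X ◁ f)†
  dagger_whiskerRight {Y Z : C} (f : Y ⟶ Z) (X : C) : f† ▷ X = (f ▷ X)†
  associator_unitary (X Y Z : C) : IsUnitary (α_ X Y Z).hom
  leftUnitor_unitary (X : C) : IsUnitary (λ_ X).hom
  rightUnitor_unitary (X : C) : IsUnitary (ρ_ X).hom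

namespace IsConjugateSolution

variable {X X' X'' : C} {R : 𝟙_ C ⟶ X' ⊗ X} {R' : 𝟙_ C ⟶ X ⊗ X'}

theorem symm (h : IsConjugateSolution X X' R R') : IsConjugateSolution X' X R' R :=
  ⟨h.right_eq, h.left_eq⟩

variable [DaggerMonoidal C]

theorem right_eq_dagger (h : IsConjugateSolution X X' R R') :
    (ρ_ X').inv ≫ X' ◁ R' ≫ (α_ X' X X').inv ≫ R† ▷ X' ≫ (λ_ X').hom = 𝟙 X' := by
  have := congrArg (fun t => t†) h.right_eq
  simp only [DaggerCategory.dagger_comp, dagger_id, ← DaggerMonoidal.whiskerLeft_dagger,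
    ← DaggerMonoidal.dagger_whiskerRight, DaggerCategory.dagger_dagger,
    (DaggerMonoidal.leftUnitor_unitary X').inv_dagger,
    ← (DaggerMonoidal.associator_unitary X' X X').inv_eq,
    ← (DaggerMonoidal.rightUnitor_unitary X').inv_eq, Category.assoc] at this
  exact this

/-- A solution of the conjugate equations exhibits `X'` as a dual of `X`. -/
@[reducible]
def exactPairing (h : IsConjugateSolution X X' R R') : ExactPairing X X' where
  coevaluation' := R'
  evaluation' := R†
  coevaluation_evaluation' := by
    rw [← cancel_epi (ρ_ X').inv, ← cancel_mono (λ_ X').hom]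
    simpa using h.right_eq_dagger
  evaluation_coevaluation' := by
    rw [← cancel_epi (λ_ X).inv, ← cancel_mono (ρ_ X).hom]
    simpa using h.left_eq

/-- Any two solutions for `X` differ by an isomorphism of the conjugate objects. -/
theorem exists_iso (h : IsConjugateSolution X X' R R') {S : 𝟙_ C ⟶ X'' ⊗ X}
    {S' : 𝟙_ C ⟶ X ⊗ X''} (h' : IsConjugateSolution X X'' S S') :
    ∃ e : X' ≅ X'', S = R ≫ e.hom ▷ X ∧ S' = R' ≫ X ◁ e.inv† := by
  let t : X' ≅ X'' := rightDualIso h.exactPairing h'.exactPairing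
  let d : HasRightDual X := @HasRightDual.mk _ _ _ X X' h.exactPairing
  let d' : HasRightDual X := @HasRightDual.mk _ _ _ X X'' h'.exactPairing
  have h1 : R' ≫ X ◁ t.hom = S' ≫ 𝟙 X ▷ X'' :=
    @coevaluation_comp_rightAdjointMate C _ _ X X d' d (𝟙 X)
  have h2 : t.hom ▷ X ≫ S† = X' ◁ 𝟙 X ≫ R† :=
    @rightAdjointMate_comp_evaluation C _ _ X X d' d (𝟙 X)
  simp only [id_whiskerRight, whiskerLeft_id, Category.comp_id, Category.id_comp] at h1 h2
  refine ⟨⟨t.inv†, t.hom†, dagger_inv_hom t, dagger_hom_inv t⟩, ?_, by simpa using h1.symm⟩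
  have h3 := congrArg (fun t => t†) h2
  simp only [DaggerCategory.dagger_comp, DaggerCategory.dagger_dagger,
    ← DaggerMonoidal.dagger_whiskerRight] at h3
  rw [← h3, Category.assoc, ← comp_whiskerRight, dagger_hom_inv, id_whiskerRight, Category.comp_id]

/-- Changing the conjugate object by an isomorphism. -/
theorem congr (h : IsConjugateSolution X X' R R') (e : X' ≅ X'') :
    IsConjugateSolution X X'' (R ≫ e.hom ▷ X) (R' ≫ X ◁ e.inv†) where
  left_eq := by
    rw [DaggerCategory.dagger_comp, ← DaggerMonoidal.dagger_whiskerRight]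
    simp only [comp_whiskerRight, Category.assoc, whiskerLeft_comp, associator_naturality_middle_assoc]
    rw [← whiskerLeft_comp_assoc, ← comp_whiskerRight, dagger_inv_hom, id_whiskerRight, whiskerLeft_id,
      Category.id_comp]
    exact h.left_eq
  right_eq := by
    rw [DaggerCategory.dagger_comp, ← DaggerMonoidal.whiskerLeft_dagger,
      DaggerCategory.dagger_dagger]
    simp only [comp_whiskerRight, Category.assoc, whiskerLeft_comp]
    rw [associator_naturality_left_assoc, ← whisker_exchange_assoc, ← whisker_exchange_assoc,
      rightUnitor_naturality, ← associator_naturality_right_assoc, ← whisker_exchange_assoc,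
      ← leftUnitor_inv_naturality_assoc, ← e.inv_hom_id]
    congr 1
    simpa only [Category.assoc, Category.id_comp] using congrArg (fun t => t ≫ e.hom) h.right_eq

/-- The transposition of an automorphism of the conjugate object. -/
theorem exists_mate (h : IsConjugateSolution X X' R R') (p : X' ≅ X') :
    ∃ k : X ≅ X, R ≫ p.hom ▷ X = R ≫ X' ◁ k.hom ∧ X ◁ p.inv ≫ R'† = k.inv ▷ X' ≫ R'† := by
  let d : HasRightDual X' := @HasRightDual.mk _ _ _ X' X h.symm.exactPairing
  have h1 : R ≫ X' ◁ p.homᘁ = R ≫ p.hom ▷ X :=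
    @coevaluation_comp_rightAdjointMate C _ _ X' X' d d p.hom
  have h2 : p.invᘁ ▷ X' ≫ R'† = X ◁ p.inv ≫ R'† :=
    @rightAdjointMate_comp_evaluation C _ _ X' X' d d p.inv
  have h3 : p.homᘁ ≫ p.invᘁ = 𝟙 X := by
    rw [← comp_rightAdjointMate, Iso.inv_hom_id]
    exact @rightAdjointMate_id C _ _ X' d
  have h4 : p.invᘁ ≫ p.homᘁ = 𝟙 X := by
    rw [← comp_rightAdjointMate, Iso.hom_inv_id]
    exact @rightAdjointMate_id C _ _ X' d
  exact ⟨⟨p.homᘁ, p.invᘁ, h3, h4⟩, h1.symm, h2.symm⟩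

end IsConjugateSolution

end Dual

/-! ### Existence of norm-standard solutions in a rigid C*-tensor category -/

section TensorCategory

variable {C : Type u} [Category.{v} C] [CStarCategory C] [MonoidalCategory C]
  [CStarTensorCategory C]

instance : DaggerMonoidal C where
  whiskerLeft_dagger := CStarTensorCategory.whiskerLeft_dagger
  dagger_whiskerRight := CStarTensorCategory.dagger_whiskerRight
  associator_unitary := CStarTensorCategory.associator_unitary
  leftUnitor_unitary := CStarTensorCategory.leftUnitor_unitary
  rightUnitor_unitary := CStarTensorCategory.rightUnitor_unitary

instance (X : C) : IsCStarFunctor (tensorLeft X) where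
  map_add f g := CStarTensorCategory.whiskerLeft_add X f g
  map_smul c f := CStarTensorCategory.whiskerLeft_smul X c f
  map_dagger f := CStarTensorCategory.whiskerLeft_dagger X f

instance (X : C) : IsCStarFunctor (tensorRight X) where
  map_add f g := CStarTensorCategory.add_whiskerRight f g X
  map_smul c f := CStarTensorCategory.smul_whiskerRight c f X
  map_dagger f := CStarTensorCategory.dagger_whiskerRight f X

theorem norm_whiskerLeft_le (X : C) {Y Z : C} (f : Y ⟶ Z) : ‖X ◁ f‖ ≤ ‖f‖ :=
  IsCStarFunctor.norm_map_le (tensorLeft X) f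

theorem norm_whiskerRight_le {Y Z : C} (f : Y ⟶ Z) (X : C) : ‖f ▷ X‖ ≤ ‖f‖ :=
  IsCStarFunctor.norm_map_le (tensorRight X) f

section

variable {M : Type u} [Category.{v} M] [CStarCategory M] {X Y Z : M}

/-- In a finite-dimensional algebra a one-sided inverse is two-sided. -/
theorem comp_eq_id_symm {Y : M} [FiniteDimensional ℂ (Y ⟶ Y)] {g h : Y ⟶ Y}
    (hgh : g ≫ h = 𝟙 Y) : h ≫ g = 𝟙 Y := by
  let φ : (Y ⟶ Y) →ₗ[ℂ] (Y ⟶ Y) :=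
    { toFun := fun x => x ≫ g
      map_add' := fun x y => by simp
      map_smul' := fun c x => by simp }
  have hφ : Function.Injective φ := by
    intro x y hxy
    have := congrArg (fun t => t ≫ h) (show x ≫ g = y ≫ g from hxy)
    simpa [hgh] using this
  obtain ⟨x, hx⟩ := LinearMap.injective_iff_surjective.1 hφ (𝟙 Y)
  have hx' : x ≫ g = 𝟙 Y := hx
  have : x = h := by
    rw [← Category.comp_id x, ← hgh, reassoc_of% hx']
  rw [← this, hx']

theorem IsUnitary.inv {e : X ≅ Y} (h : IsUnitary e.hom) : IsUnitary e.inv := by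
  rw [h.inv_eq]; exact h.dagger

theorem IsUnitary.norm_comp_le {f : X ⟶ Y} (hf : IsUnitary f) (g : Y ⟶ Z) : ‖f ≫ g‖ ≤ ‖g‖ := by
  have h1 := CStarCategory.norm_dagger_comp f
  rw [hf.1] at h1
  have h2 := norm_id_le X
  have h3 := CStarCategory.norm_comp_le f g
  have h4 : ‖f‖ ≤ 1 := by nlinarith [norm_nonneg f]
  nlinarith [norm_nonneg g]

theorem IsUnitary.norm_comp_le' {g : Y ⟶ Z} (hg : IsUnitary g) (f : X ⟶ Y) : ‖f ≫ g‖ ≤ ‖f‖ := by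
  rw [← norm_dagger, DaggerCategory.dagger_comp, ← norm_dagger f]
  exact hg.dagger.norm_comp_le _

end

theorem unit_irreducible : IsIrreducible (𝟙_ C) :=
  ⟨CStarTensorCategory.unit_ne_zero, CStarTensorCategory.unit_simple⟩

/-- A positive endomorphism of the unit is its norm times the identity. -/
theorem comp_dagger_eq_norm_smul {W : C} (S : 𝟙_ C ⟶ W) :
    S ≫ S† = ((‖S‖ ^ 2 : ℝ) : ℂ) • 𝟙 (𝟙_ C) := by
  by_cases h0 : S = 0
  · simp [h0]
  obtain ⟨γ, -, h⟩ := unit_irreducible.scalar_comp_dagger h0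
  have h1 := CStarCategory.norm_dagger_comp S
  rw [h, norm_smul, norm_id_eq_one CStarTensorCategory.unit_ne_zero, mul_one, norm_mul,
    RCLike.norm_conj] at h1
  rw [h, ← h1, Complex.mul_conj, Complex.normSq_eq_norm_sq, sq]

variable {X X' : C} {R : 𝟙_ C ⟶ X' ⊗ X} {R' : 𝟙_ C ⟶ X ⊗ X'}

/-- Frobenius reciprocity bounds a morphism by its transpose. -/
theorem IsConjugateSolution.norm_le_transpose (h : IsConjugateSolution X X' R R')
    (S : 𝟙_ C ⟶ X) : ‖S‖ ≤ ‖R'‖ * ‖R ≫ X' ◁ S†‖ := by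
  have h1 : S = (λ_ (𝟙_ C)).inv ≫ R' ▷ 𝟙_ C ≫ (α_ X X' (𝟙_ C)).hom ≫
      X ◁ (R ≫ X' ◁ S†)† ≫ (ρ_ X).hom := by
    conv_lhs => rw [← Category.comp_id S, ← h.left_eq]
    rw [DaggerCategory.dagger_comp, ← CStarTensorCategory.whiskerLeft_dagger,
      DaggerCategory.dagger_dagger, whiskerLeft_comp, Category.assoc,
      ← associator_naturality_right_assoc, ← whisker_exchange_assoc,
      ← leftUnitor_inv_naturality_assoc]
  conv_lhs => rw [h1]
  refine ((DaggerMonoidal.leftUnitor_unitary _).inv.norm_comp_le _).trans ?_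
  refine (CStarCategory.norm_comp_le _ _).trans ?_
  refine mul_le_mul (norm_whiskerRight_le _ _) ?_ (norm_nonneg _) (norm_nonneg _)
  refine ((DaggerMonoidal.associator_unitary _ _ _).norm_comp_le _).trans ?_
  refine ((DaggerMonoidal.rightUnitor_unitary _).norm_comp_le' _).trans ?_
  exact (norm_whiskerLeft_le _ _).trans (norm_dagger _).le

theorem IsConjugateSolution.norm_le_left (h : IsConjugateSolution X X' R R')
    (g : X' ⟶ X') : ‖g‖ ≤ ‖R ≫ g ▷ X‖ * ‖R'‖ := by
  have h1 : g = (λ_ X').inv ≫ (R ≫ g ▷ X) ▷ X' ≫ (α_ X' X X').hom ≫ X' ◁ R'† ≫ (ρ_ X').hom := by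
    conv_lhs => rw [← Category.id_comp g, ← h.right_eq]
    simp only [Category.assoc, comp_whiskerRight]
    rw [associator_naturality_left_assoc, ← whisker_exchange_assoc, rightUnitor_naturality]
  conv_lhs => rw [h1]
  refine ((DaggerMonoidal.leftUnitor_unitary _).inv.norm_comp_le _).trans ?_
  refine (CStarCategory.norm_comp_le _ _).trans ?_
  refine mul_le_mul (norm_whiskerRight_le _ _) ?_ (norm_nonneg _) (norm_nonneg _)
  refine ((DaggerMonoidal.associator_unitary _ _ _).norm_comp_le _).trans ?_
  refine ((DaggerMonoidal.rightUnitor_unitary _).norm_comp_le' _).trans ?_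
  exact (norm_whiskerLeft_le _ _).trans (norm_dagger _).le

theorem IsConjugateSolution.norm_le_right (h : IsConjugateSolution X X' R R')
    (g : X' ⟶ X') : ‖g‖ ≤ ‖R' ≫ X ◁ g‖ * ‖R‖ := by
  have h1 : g = (ρ_ X').inv ≫ X' ◁ (R' ≫ X ◁ g) ≫ (α_ X' X X').inv ≫ R† ▷ X' ≫ (λ_ X').hom := by
    conv_lhs => rw [← Category.id_comp g, ← h.right_eq_dagger]
    simp only [Category.assoc, whiskerLeft_comp]
    rw [associator_inv_naturality_right_assoc, whisker_exchange_assoc, leftUnitor_naturality]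
  conv_lhs => rw [h1]
  refine ((DaggerMonoidal.rightUnitor_unitary _).inv.norm_comp_le _).trans ?_
  refine (CStarCategory.norm_comp_le _ _).trans ?_
  refine mul_le_mul (norm_whiskerLeft_le _ _) ?_ (norm_nonneg _) (norm_nonneg _)
  refine ((DaggerMonoidal.associator_unitary _ _ _).inv.norm_comp_le _).trans ?_
  refine ((DaggerMonoidal.leftUnitor_unitary _).norm_comp_le' _).trans ?_
  exact (norm_whiskerRight_le _ _).trans (norm_dagger _).le

/-- The scalar by which an endomorphism of the unit acts. -/
def unitScalar (f : 𝟙_ C ⟶ 𝟙_ C) : ℂ := (CStarTensorCategory.unit_simple f).choose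

theorem unitScalar_spec (f : 𝟙_ C ⟶ 𝟙_ C) : f = unitScalar f • 𝟙 (𝟙_ C) :=
  (CStarTensorCategory.unit_simple f).choose_spec

theorem unitScalar_smul_id (c : ℂ) : unitScalar (c • 𝟙 (𝟙_ C)) = c :=
  (smul_left_injective ℂ (CStarTensorCategory.unit_ne_zero (C := C))
    (unitScalar_spec (c • 𝟙 (𝟙_ C)))).symm

theorem unitScalar_eq {f : 𝟙_ C ⟶ 𝟙_ C} {c : ℂ} (h : f = c • 𝟙 (𝟙_ C)) : unitScalar f = c := by
  rw [h, unitScalar_smul_id]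

theorem unitScalar_dagger (f : 𝟙_ C ⟶ 𝟙_ C) :
    unitScalar f† = starRingEnd ℂ (unitScalar f) :=
  unitScalar_eq (by conv_lhs => rw [unitScalar_spec f, dagger_smul, dagger_id])

theorem unitScalar_add (f g : 𝟙_ C ⟶ 𝟙_ C) :
    unitScalar (f + g) = unitScalar f + unitScalar g :=
  unitScalar_eq (by rw [add_smul, ← unitScalar_spec, ← unitScalar_spec])

theorem unitScalar_smul (c : ℂ) (f : 𝟙_ C ⟶ 𝟙_ C) :
    unitScalar (c • f) = c * unitScalar f :=
  unitScalar_eq (by rw [mul_smul, ← unitScalar_spec])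

/-- As the unit is simple, `S* T` is a scalar product on `Hom(1, X)`, with the same norm. -/
@[reducible]
def unitHomInnerProductSpace (X : C) : InnerProductSpace ℂ (𝟙_ C ⟶ X) where
  inner S T := unitScalar (T ≫ S†)
  norm_sq_eq_re_inner S := by
    rw [unitScalar_eq (comp_dagger_eq_norm_smul S)]
    exact (Complex.ofReal_re _).symm
  conj_inner_symm S T := by
    rw [← unitScalar_dagger]
    simp
  add_left S T W := by
    rw [dagger_add, Preadditive.comp_add, unitScalar_add]
  smul_left S T r := by
    rw [dagger_smul, Linear.comp_smul, unitScalar_smul]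

/-- For an orthonormal family `S₁, …, Sₙ` in `Hom(1, X)` the sum `∑ Sₐ Sₐ*` is a projection, so
conjugating it with `R` gives `∑ ‖xₐ‖² ≤ ‖R‖²` for the transposes `xₐ` of the `Sₐ`, while
`1 = ‖Sₐ‖ ≤ ‖R'‖ ‖xₐ‖`. -/
theorem IsConjugateSolution.card_le (h : IsConjugateSolution X X' R R') {ι : Type*} [Fintype ι]
    [DecidableEq ι] (S : ι → (𝟙_ C ⟶ X))
    (hS : ∀ a b, S a ≫ (S b)† = if a = b then 𝟙 _ else 0) :
    (Fintype.card ι : ℝ) ≤ (‖R‖ * ‖R'‖) ^ 2 := by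
  set P : X ⟶ X := ∑ a, (S a)† ≫ S a with hP
  have hP' : P† = P := by simp [hP, dagger_sum]
  have hPP : P ≫ P = P := by
    simp only [hP, Preadditive.sum_comp, Preadditive.comp_sum, Category.assoc]
    refine Finset.sum_congr rfl fun a _ => ?_
    rw [Finset.sum_eq_single a]
    · rw [reassoc_of% hS a a]; simp
    · intro b _ hb
      rw [reassoc_of% hS b a, if_neg hb, Limits.zero_comp, Limits.comp_zero]
    · exact fun h => (h (Finset.mem_univ a)).elim
  have hPn : ‖P‖ ≤ 1 := by
    have := CStarCategory.norm_dagger_comp P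
    rw [hP', hPP] at this
    by_contra! hlt
    nlinarith
  have hsum : ∑ a, (R ≫ X' ◁ (S a)†) ≫ (R ≫ X' ◁ (S a)†)† = (R ≫ X' ◁ P) ≫ (R ≫ X' ◁ P)† := by
    have h1 : (R ≫ X' ◁ P) ≫ (R ≫ X' ◁ P)† = R ≫ X' ◁ P ≫ R† := by
      rw [DaggerCategory.dagger_comp, ← CStarTensorCategory.whiskerLeft_dagger, hP',
        Category.assoc, ← whiskerLeft_comp_assoc, hPP]
    have h2 : X' ◁ P = ∑ a, X' ◁ (S a)† ≫ X' ◁ S a := by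
      have := (tensorLeft X').map_sum (fun a => (S a)† ≫ S a) Finset.univ
      simpa using this
    rw [h1, h2, Preadditive.sum_comp, Preadditive.comp_sum]
    refine Finset.sum_congr rfl fun a _ => ?_
    rw [DaggerCategory.dagger_comp, ← CStarTensorCategory.whiskerLeft_dagger,
      DaggerCategory.dagger_dagger, Category.assoc, Category.assoc]
  have hsq : ∑ a, ‖R ≫ X' ◁ (S a)†‖ ^ 2 = ‖R ≫ X' ◁ P‖ ^ 2 := by
    simp only [comp_dagger_eq_norm_smul, ← Finset.sum_smul] at hsum
    have := smul_left_injective ℂ (CStarTensorCategory.unit_ne_zero (C := C)) hsum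
    exact_mod_cast this
  have hle : ‖R ≫ X' ◁ P‖ ≤ ‖R‖ := by
    refine (CStarCategory.norm_comp_le _ _).trans ?_
    exact mul_le_of_le_one_right (norm_nonneg _) ((norm_whiskerLeft_le _ _).trans hPn)
  have hone : ∀ a, 1 ≤ ‖R'‖ ^ 2 * ‖R ≫ X' ◁ (S a)†‖ ^ 2 := by
    intro a
    have h1 := CStarCategory.norm_dagger_comp (S a)
    rw [hS a a, if_pos rfl, norm_id_eq_one CStarTensorCategory.unit_ne_zero] at h1
    rw [h1, ← mul_pow]
    exact pow_le_pow_left₀ (norm_nonneg _) (h.norm_le_transpose (S a)) 2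
  calc (Fintype.card ι : ℝ) = ∑ _a : ι, 1 := by simp
    _ ≤ ∑ a, ‖R'‖ ^ 2 * ‖R ≫ X' ◁ (S a)†‖ ^ 2 := Finset.sum_le_sum fun a _ => hone a
    _ = ‖R'‖ ^ 2 * ‖R ≫ X' ◁ P‖ ^ 2 := by rw [← Finset.mul_sum, hsq]
    _ ≤ ‖R'‖ ^ 2 * ‖R‖ ^ 2 := by gcongr
    _ = (‖R‖ * ‖R'‖) ^ 2 := by ring

/-- Orthonormal families in `Hom(1, X)` have at most `(‖R‖ ‖R'‖)²` members. -/
theorem IsConjugateSolution.finiteDimensional_unitHom (h : IsConjugateSolution X X' R R') :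
    FiniteDimensional ℂ (𝟙_ C ⟶ X) := by
  classical
  let := unitHomInnerProductSpace X
  obtain ⟨w, b, hb⟩ := exists_hilbertBasis ℂ (𝟙_ C ⟶ X)
  have hfin : w.Finite := by
    by_contra hinf
    obtain ⟨s, hsw, hs⟩ := Set.Infinite.exists_subset_card_eq hinf
      (⌊(‖R‖ * ‖R'‖) ^ 2⌋₊ + 1)
    have ho := b.orthonormal
    have := h.card_le (ι := s) (fun a => a.1) (fun x y => by
      have h1 := orthonormal_iff_ite.1 ho ⟨y.1, hsw y.2⟩ ⟨x.1, hsw x.2⟩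
      rw [hb] at h1
      rw [unitScalar_spec (x.1 ≫ (y.1)†)]
      have h2 : unitScalar (x.1 ≫ (y.1)†) = if x = y then 1 else 0 := by
        refine Eq.trans h1 ?_
        simp only [Subtype.ext_iff, eq_comm]
      rw [h2]
      split_ifs <;> simp)
    rw [Fintype.card_coe, hs] at this
    have h2 := Nat.lt_floor_add_one ((‖R‖ * ‖R'‖) ^ 2)
    push_cast at this
    linarith
  have := hfin.fintype
  exact b.toOrthonormalBasis.toBasis.finiteDimensional_of_finite

/-- `End(X')` embeds into `Hom(1, X' ⊗ X)`. -/
theorem IsConjugateSolution.finiteDimensional_end (h : IsConjugateSolution X X' R R')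
    (hC : IsRigid C) : FiniteDimensional ℂ (X' ⟶ X') := by
  obtain ⟨W, S, S', hS⟩ := hC (X' ⊗ X)
  have := hS.finiteDimensional_unitHom
  let φ : (X' ⟶ X') →ₗ[ℂ] (𝟙_ C ⟶ X' ⊗ X) :=
    { toFun := fun g => R ≫ g ▷ X
      map_add' := fun f g => by
        rw [CStarTensorCategory.add_whiskerRight, Preadditive.comp_add]
      map_smul' := fun c f => by
        rw [CStarTensorCategory.smul_whiskerRight, Linear.comp_smul, RingHom.id_apply] }
  refine FiniteDimensional.of_injective φ ?_
  rw [injective_iff_map_eq_zero]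
  intro g hg
  have h1 := h.norm_le_left g
  rw [show R ≫ g ▷ X = 0 from hg, norm_zero, zero_mul] at h1
  exact norm_le_zero_iff.1 h1

/-- Multiplication by a nonzero scalar as an automorphism. -/
@[simps]
def scalarIso (X : C) (t : ℂ) (ht : t ≠ 0) : X ≅ X where
  hom := t • 𝟙 X
  inv := t⁻¹ • 𝟙 X
  hom_inv_id := by simp [smul_smul, inv_mul_cancel₀ ht]
  inv_hom_id := by simp [smul_smul, mul_inv_cancel₀ ht]

theorem IsConjugateSolution.smul (h : IsConjugateSolution X X' R R') {t : ℝ} (ht : t ≠ 0) :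
    IsConjugateSolution X X' ((t : ℂ) • R) ((t⁻¹ : ℂ) • R') := by
  have := h.congr (scalarIso X' (t : ℂ) (by exact_mod_cast ht))
  rw [scalarIso_hom, scalarIso_inv, dagger_smul, dagger_id,
    CStarTensorCategory.smul_whiskerRight, CStarTensorCategory.whiskerLeft_smul, id_whiskerRight,
    whiskerLeft_id, Linear.comp_smul, Linear.comp_smul, Category.comp_id, Category.comp_id,
    ← Complex.ofReal_inv, Complex.conj_ofReal, Complex.ofReal_inv] at this
  exact this

theorem IsConjugateSolution.eq_zero_right (h : IsConjugateSolution X X' R R') (h0 : ‖R‖ = 0) :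
    ‖R'‖ = 0 := by
  have h1 := h.norm_le_left (𝟙 X')
  rw [id_whiskerRight, Category.comp_id, h0, zero_mul] at h1
  have h2 : 𝟙 X' = 0 := norm_le_zero_iff.1 h1
  rw [← Category.comp_id R', ← whiskerLeft_id, h2]
  have := CStarTensorCategory.whiskerLeft_smul X (0 : ℂ) (𝟙 X')
  rw [zero_smul, zero_smul] at this
  rw [this, Limits.comp_zero, norm_zero]

/-- A solution can be rescaled so that `R` and `R'` have the same norm. -/
theorem IsConjugateSolution.exists_normalized (h : IsConjugateSolution X X' R R') :
    ∃ (S : 𝟙_ C ⟶ X' ⊗ X) (S' : 𝟙_ C ⟶ X ⊗ X'), IsConjugateSolution X X' S S' ∧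
      ‖S‖ ^ 2 = ‖R‖ * ‖R'‖ ∧ ‖S'‖ ^ 2 = ‖R‖ * ‖R'‖ := by
  by_cases h0 : ‖R‖ = 0
  · exact ⟨R, R', h, by simp [h0], by simp [h0, h.eq_zero_right h0]⟩
  have h0' : ‖R'‖ ≠ 0 := fun h1 => h0 (h.symm.eq_zero_right h1)
  have hR : 0 < ‖R‖ := lt_of_le_of_ne (norm_nonneg _) (Ne.symm h0)
  have hR' : 0 < ‖R'‖ := lt_of_le_of_ne (norm_nonneg _) (Ne.symm h0')
  have ht : 0 < Real.sqrt (‖R'‖ / ‖R‖) := Real.sqrt_pos.2 (by positivity)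
  refine ⟨_, _, h.smul ht.ne', ?_, ?_⟩
  · rw [norm_smul, Complex.norm_real, Real.norm_of_nonneg ht.le, mul_pow,
      Real.sq_sqrt (by positivity)]
    field_simp
  · rw [norm_smul, ← Complex.ofReal_inv, Complex.norm_real, Real.norm_of_nonneg (by positivity),
      mul_pow, inv_pow, Real.sq_sqrt (by positivity)]
    field_simp

/-- Every solution can be replaced, without changing the norms, by one with a given conjugate
object: the axiom that `e* e` is a square inside the endomorphism algebra of `X'` replaces the polar
decomposition. -/
theorem IsConjugateSolution.exists_same_norm (h : IsConjugateSolution X X' R R')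
    [FiniteDimensional ℂ (X' ⟶ X')] {X'' : C} {S : 𝟙_ C ⟶ X'' ⊗ X} {S' : 𝟙_ C ⟶ X ⊗ X''}
    (hS : IsConjugateSolution X X'' S S') :
    ∃ g : X' ≅ X', ‖R ≫ g.hom ▷ X‖ = ‖S‖ ∧ ‖R' ≫ X ◁ g.inv†‖ = ‖S'‖ := by
  obtain ⟨e, rfl, rfl⟩ := h.exists_iso hS
  obtain ⟨g, hg⟩ := CStarCategory.positive e.hom
  have hgi : g ≫ g† ≫ e.inv† ≫ e.inv = 𝟙 X' := by
    rw [← reassoc_of% hg, reassoc_of% dagger_hom_inv e, e.hom_inv_id]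
  have hgi' := comp_eq_id_symm hgi
  let g' : X' ≅ X' := ⟨g, _, hgi, hgi'⟩
  have hinv : g'.inv† ≫ g'.inv = e.inv† ≫ e.inv := by
    have h1 : g ≫ g† ≫ g'.inv† ≫ g'.inv = 𝟙 X' := by
      rw [reassoc_of% dagger_hom_inv g']
      exact hgi
    rw [← reassoc_of% hg] at h1
    calc g'.inv† ≫ g'.inv = e.inv† ≫ e.inv ≫ e.hom ≫ e.hom† ≫ g'.inv† ≫ g'.inv := by
          rw [e.inv_hom_id_assoc, reassoc_of% dagger_inv_hom e]
      _ = _ := by rw [h1, Category.comp_id]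
  have hsq : ∀ {W W' : C} (f : 𝟙_ C ⟶ W) (f' : 𝟙_ C ⟶ W'), f ≫ f† = f' ≫ f'† → ‖f‖ = ‖f'‖ := by
    intro W W' f f' hff
    have h1 := CStarCategory.norm_dagger_comp f
    rw [hff, CStarCategory.norm_dagger_comp] at h1
    exact ((pow_left_inj₀ (norm_nonneg _) (norm_nonneg _) two_ne_zero).1 h1).symm
  refine ⟨g', hsq _ _ ?_, hsq _ _ ?_⟩
  · have h1 : ∀ {Y : C} (x : X' ⟶ Y), (R ≫ x ▷ X) ≫ (R ≫ x ▷ X)† = R ≫ (x ≫ x†) ▷ X ≫ R† := by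
      intro Y x
      rw [DaggerCategory.dagger_comp, ← CStarTensorCategory.dagger_whiskerRight, Category.assoc,
        ← comp_whiskerRight_assoc]
    rw [h1, h1, hg]
  · have h1 : ∀ {Y : C} (x : Y ⟶ X'),
        (R' ≫ X ◁ x†) ≫ (R' ≫ X ◁ x†)† = R' ≫ X ◁ (x† ≫ x) ≫ R'† := by
      intro Y x
      rw [DaggerCategory.dagger_comp, ← CStarTensorCategory.whiskerLeft_dagger,
        DaggerCategory.dagger_dagger, Category.assoc, ← whiskerLeft_comp_assoc]
    rw [h1, h1, hinv]

/-- In a rigid C*-tensor category with simple unit every object has a norm-standard solution: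
endomorphism algebras are finite dimensional, so `‖R‖ ‖R'‖` attains its minimum on the compact set of
normalized solutions with a fixed conjugate object. -/
theorem exists_standardSolution (hC : IsRigid C) (X : C) :
    ∃ (X' : C) (R : 𝟙_ C ⟶ X' ⊗ X) (R' : 𝟙_ C ⟶ X ⊗ X'), IsStandardSolution X X' R R' := by
  obtain ⟨X', R, R', h⟩ := hC X
  have hfd := h.finiteDimensional_end hC
  -- a solution with equal norms that improves on `(R, R')` has norms at most `√(‖R‖ ‖R'‖) ≤ b`
  let b : ℝ := ‖R‖ + ‖R'‖
  let K : Set ((X' ⟶ X') × (X' ⟶ X')) :=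
    {z | z.1 ≫ z.2 = 𝟙 X' ∧ z.2 ≫ z.1 = 𝟙 X' ∧ ‖R ≫ z.1 ▷ X‖ ≤ b ∧ ‖R' ≫ X ◁ z.2†‖ ≤ b}
  let val : (X' ⟶ X') × (X' ⟶ X') → ℝ := fun z => ‖R ≫ z.1 ▷ X‖ * ‖R' ≫ X ◁ z.2†‖
  have hc1 : Continuous fun g : X' ⟶ X' => ‖R ≫ g ▷ X‖ := by
    let φ : (X' ⟶ X') →ₗ[ℂ] (𝟙_ C ⟶ X' ⊗ X) :=
      { toFun := fun g => R ≫ g ▷ X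
        map_add' := fun f g => by
          rw [CStarTensorCategory.add_whiskerRight, Preadditive.comp_add]
        map_smul' := fun c f => by
          rw [CStarTensorCategory.smul_whiskerRight, Linear.comp_smul, RingHom.id_apply] }
    exact φ.continuous_of_finiteDimensional.norm
  have hc2 : Continuous fun g : X' ⟶ X' => ‖R' ≫ X ◁ g†‖ := by
    let φ : (X' ⟶ X') →ₗ[ℂ] (𝟙_ C ⟶ X ⊗ X') :=
      { toFun := fun g => R' ≫ X ◁ g
        map_add' := fun f g => by
          rw [CStarTensorCategory.whiskerLeft_add, Preadditive.comp_add]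
        map_smul' := fun c f => by
          rw [CStarTensorCategory.whiskerLeft_smul, Linear.comp_smul, RingHom.id_apply] }
    have hd : Continuous fun g : X' ⟶ X' => g† :=
      (AddMonoidHomClass.isometry_of_norm (daggerHom X' X') fun g => norm_dagger g).continuous
    exact (φ.continuous_of_finiteDimensional.comp hd).norm
  have hmul : Continuous fun z : (X' ⟶ X') × (X' ⟶ X') => z.1 ≫ z.2 := by
    let := endNormedRing X'
    exact (continuous_mul (M := X' ⟶ X')).comp continuous_swap
  have hval : Continuous val := (hc1.comp continuous_fst).mul (hc2.comp continuous_snd)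
  have hK : IsCompact K := by
    have : ProperSpace (X' ⟶ X') := FiniteDimensional.proper ℂ _
    refine Metric.isCompact_of_isClosed_isBounded ?_ ?_
    · exact (isClosed_eq hmul continuous_const).inter
        ((isClosed_eq (hmul.comp continuous_swap) continuous_const).inter
        ((isClosed_le (hc1.comp continuous_fst) continuous_const).inter
          (isClosed_le (hc2.comp continuous_snd) continuous_const)))
    · refine (isBounded_iff_forall_norm_le).2 ⟨b * b, fun z hz => ?_⟩
      obtain ⟨-, -, h1, h2⟩ := hz
      have h3 := h.norm_le_left z.1
      have h4 := h.norm_le_right z.2†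
      rw [norm_dagger] at h4
      have hb : 0 ≤ b := by positivity
      refine max_le (h3.trans (mul_le_mul h1 ?_ (norm_nonneg _) hb))
        (h4.trans (mul_le_mul h2 ?_ (norm_nonneg _) hb))
      · exact le_add_of_nonneg_left (norm_nonneg _)
      · exact le_add_of_nonneg_right (norm_nonneg _)
  have hone : ((𝟙 X', 𝟙 X') : (X' ⟶ X') × (X' ⟶ X')) ∈ K := by
    refine ⟨by simp, by simp, ?_, ?_⟩
    · simp [b]
    · simp [b]
  obtain ⟨z, hz, hmin⟩ := hK.exists_isMinOn ⟨_, hone⟩ hval.continuousOn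
  have hle : ∀ {X'' : C} {S : 𝟙_ C ⟶ X'' ⊗ X} {S' : 𝟙_ C ⟶ X ⊗ X''},
      IsConjugateSolution X X'' S S' → val z ≤ ‖S‖ * ‖S'‖ := by
    intro X'' S S' hS
    by_cases hlt : ‖R‖ * ‖R'‖ ≤ ‖S‖ * ‖S'‖
    · refine le_trans ?_ hlt
      have := hmin hone
      simpa [val] using this
    obtain ⟨S₁, S₁', hS₁, h1, h2⟩ := hS.exists_normalized
    obtain ⟨g, hg1, hg2⟩ := h.exists_same_norm hS₁
    have hbd : ∀ {t : ℝ}, 0 ≤ t → t ^ 2 = ‖S‖ * ‖S'‖ → t ≤ b := by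
      intro t ht ht2
      refine le_of_sq_le_sq ?_ (by positivity)
      have := norm_nonneg R
      have := norm_nonneg R'
      simp only [b]
      nlinarith
    have hgK : (g.hom, g.inv) ∈ K :=
      ⟨g.hom_inv_id, g.inv_hom_id, hg1.trans_le (hbd (norm_nonneg _) h1),
        hg2.trans_le (hbd (norm_nonneg _) h2)⟩
    have h3 : val z ≤ ‖S₁‖ * ‖S₁'‖ := by
      have := hmin hgK
      simpa only [val, Set.mem_ofPred_eq, hg1, hg2] using this
    have h4 : ‖S₁‖ = ‖S₁'‖ :=
      (pow_left_inj₀ (norm_nonneg _) (norm_nonneg _) two_ne_zero).1 (h1.trans h2.symm)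
    rw [h4, ← sq, h2] at h3
    exact h3
  have hz0 := h.congr ⟨z.1, z.2, hz.1, hz.2.1⟩
  obtain ⟨S, S', hS, h1, h2⟩ := hz0.exists_normalized
  have hdim : categoricalDim X = val z := by
    refine IsLeast.csInf_eq ⟨⟨X', _, _, hz0, rfl⟩, ?_⟩
    rintro _ ⟨X'', S, S', hS, rfl⟩
    exact hle hS
  exact ⟨X', S, S', hS, h1.trans hdim.symm, h2.trans hdim.symm⟩

end TensorCategory

/-! ### The adjunctions given by the action of conjugate objects -/

section Action

variable {C : Type u₁} [Category.{v₁} C] [MonoidalCategory C]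
  {M : Type u₂} [Category.{v₂} M] [MonoidalLeftAction C M]

variable (M) in
/-- The functor `X ↦ U ⊗ X`. -/
@[reducible]
def actionFunctor (U : C) : M ⥤ M where
  obj X := U ⊙ₗ X
  map f := U ⊴ₗ f

/-- The morphism `R ⊗ id_X`, for `R : 1 ⟶ V ⊗ U`. -/
def actionUnit {U V : C} (R : 𝟙_ C ⟶ V ⊗ U) (X : M) : X ⟶ V ⊙ₗ U ⊙ₗ X :=
  (λₗ[C] X).inv ≫ R ⊵ₗ X ≫ (αₗ V U X).hom

theorem actionUnit_naturality {U V : C} (R : 𝟙_ C ⟶ V ⊗ U) {X Y : M} (f : X ⟶ Y) :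
    f ≫ actionUnit R Y = actionUnit R X ≫ V ⊴ₗ U ⊴ₗ f := by
  have h := MonoidalLeftAction.actionUnitIso_inv_naturality (C := C) f
  simp only [actionUnit, Category.assoc]
  rw [← reassoc_of% h, MonoidalLeftAction.action_exchange_assoc]
  simp

theorem actionUnit_whiskerRight {U V W : C} (R : 𝟙_ C ⟶ V ⊗ U) (g : V ⟶ W) (X : M) :
    actionUnit (R ≫ g ▷ U) X = actionUnit R X ≫ g ⊵ₗ (U ⊙ₗ X) := by
  simp [actionUnit]

theorem actionUnit_whiskerLeft {U V W : C} (R : 𝟙_ C ⟶ V ⊗ U) (g : U ⟶ W) (X : M) :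
    actionUnit (R ≫ V ◁ g) X = actionUnit R X ≫ V ⊴ₗ g ⊵ₗ X := by
  simp [actionUnit]

end Action

section ModuleCategory

variable {C : Type u₁} [Category.{v₁} C] [CStarCategory C] [MonoidalCategory C]
  {M : Type u₂} [Category.{v₂} M] [CStarCategory M] [MonoidalLeftAction C M]
  [CStarModuleCategory C M]

instance (U : C) : IsCStarFunctor (actionFunctor M U) where
  map_add f g := CStarModuleCategory.actionRight_add U f g
  map_smul c f := CStarModuleCategory.actionRight_smul U c f
  map_dagger f := CStarModuleCategory.actionRight_dagger U f

theorem actionUnit_dagger {U V : C} (R : 𝟙_ C ⟶ V ⊗ U) (X : M) :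
    (actionUnit R X)† = (αₗ V U X).inv ≫ R† ⊵ₗ X ≫ (λₗ[C] X).hom := by
  rw [actionUnit, DaggerCategory.dagger_comp, DaggerCategory.dagger_comp, Category.assoc,
    (CStarModuleCategory.actionUnit_unitary (C := C) X).inv_dagger,
    (CStarModuleCategory.actionAssoc_unitary V U X).inv_eq, CStarModuleCategory.actionLeft_dagger]

theorem actionUnit_zigzag {U V : C} {R : 𝟙_ C ⟶ V ⊗ U} {R' : 𝟙_ C ⟶ U ⊗ V}
    (h : IsConjugateSolution U V R R') (X : M) :
    actionUnit R' (U ⊙ₗ X) ≫ U ⊴ₗ (actionUnit R X)† = 𝟙 (U ⊙ₗ X) := by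
  have h1 := congrArg (fun t => t ⊵ₗ X) h.left_eq
  rw [actionUnit_dagger, actionUnit]
  have h2 : (λ_ U).inv ⊵ₗ X = (λₗ (U ⊙ₗ X)).inv ≫ (αₗ (𝟙_ C) U X).inv := by
    rw [← cancel_epi ((λ_ U).hom ⊵ₗ X), MonoidalLeftAction.hom_inv_actionHomLeft]
    simp
  simp only [MonoidalLeftAction.comp_actionHomLeft, h2, MonoidalLeftAction.id_actionHomLeft,
    MonoidalLeftAction.whiskerLeft_actionHomLeft, MonoidalLeftAction.rightUnitor_actionHom,
    Category.assoc, Iso.inv_hom_id_assoc] at h1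
  rw [← h1]
  have h3 := MonoidalLeftAction.associator_actionHom U V U X
  simp only [MonoidalLeftAction.actionHomLeft_action, MonoidalLeftAction.actionHomRight_comp,
    Category.assoc, ← reassoc_of% h3, MonoidalLeftAction.actionHomRight_hom_inv_assoc]

variable (τ : ModuleTrace C M)

/-- A norm-standard solution in `C` makes the actions of `U` and `V` on `M` adjoint, in a way that is
unitary for a module trace. -/
def actionTraceAdjunction {U V : C} {R : 𝟙_ C ⟶ V ⊗ U} {R' : 𝟙_ C ⟶ U ⊗ V}
    (h : IsStandardSolution U V R R') :
    TraceAdjunction τ (actionFunctor M U) (actionFunctor M V) where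
  R := actionUnit R
  R' := actionUnit R'
  R_naturality := actionUnit_naturality R
  R'_naturality := actionUnit_naturality R'
  left_zigzag X := by
    have := congrArg (fun t => t†) (actionUnit_zigzag h.solution X)
    simp only [DaggerCategory.dagger_comp, ← CStarModuleCategory.actionRight_dagger, dagger_id,
      DaggerCategory.dagger_dagger] at this
    exact this
  right_zigzag X := by
    have := actionUnit_zigzag h.solution.symm X
    exact this
  tr_eq {X} T := by
    refine (τ.tr_action h T).trans ?_
    change _ = τ.tr X (actionUnit R X ≫ V ⊴ₗ T ≫ (actionUnit R X)†)
    rw [actionUnit_dagger]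
    simp only [partialTrace, actionUnit, Category.assoc]

end ModuleCategory

/-! ### Module functors commute with the comparison of two conjugates -/

/-- Natural families of morphisms that agree on the irreducible objects are equal. -/
theorem natural_ext {M : Type u₂} [Category.{v₂} M] [CStarCategory M]
    [∀ X : M, FiniteDimensional ℂ (X ⟶ X)] {F G : M ⥤ M} [IsCStarFunctor F]
    {x y : ∀ X, F.obj X ⟶ G.obj X}
    (hx : ∀ {X Y : M} (f : X ⟶ Y), F.map f ≫ x Y = x X ≫ G.map f)
    (hy : ∀ {X Y : M} (f : X ⟶ Y), F.map f ≫ y Y = y X ≫ G.map f)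
    (h : ∀ i : Irr M, x i.rep = y i.rep) (X : M) : x X = y X := by
  obtain ⟨ι, _, i, v, hv⟩ := exists_decomposition X
  rw [← Category.id_comp (x X), ← Category.id_comp (y X), ← F.map_id, ← hv]
  simp only [F.map_sum, F.map_comp, Preadditive.sum_comp, Category.assoc, hx, hy, h]

section Commutation

variable {C : Type u₁} [Category.{v₁} C] [CStarCategory C] [MonoidalCategory C]
  {M : Type u₂} [Category.{v₂} M] [CStarCategory M] [MonoidalLeftAction C M]
  [∀ X Y : M, FiniteDimensional ℂ (X ⟶ Y)] [Finite (Irr M)]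
  {τ : ModuleTrace C M} {F A B V : M ⥤ M}
  [IsCStarFunctor F] [IsCStarFunctor A] [IsCStarFunctor B] [IsCStarFunctor V]

/-- Let `s : 1 ⟶ V A` be the unit of a trace adjunction, `t : V ⟶ B` natural, and let
`r = t s : 1 ⟶ B A`.  If a functor `F` commutes with `A` and `B` up to unitaries `a` and `b` that are
compatible with `r`, then `b` intertwines `F(p)` and `p` for `p = t t*`: when the weighted trace of
`|b F(p) - p b|²` is expanded, all terms equal `c ∑ d(Y) d(F(Y))`, where `s* (t* t)² s = c`. -/
theorem map_comp_eq_of_compatible (adj : TraceAdjunction τ A V)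
    (t : ∀ X, V.obj X ⟶ B.obj X) (ht : ∀ {X Y : M} (f : X ⟶ Y), V.map f ≫ t Y = t X ≫ B.map f)
    (a : ∀ X, F.obj (A.obj X) ⟶ A.obj (F.obj X)) (ha : ∀ X, IsUnitary (a X))
    (b : ∀ X, F.obj (B.obj X) ⟶ B.obj (F.obj X)) (hb : ∀ X, IsUnitary (b X))
    (hbn : ∀ {X Y : M} (f : X ⟶ Y), F.map (B.map f) ≫ b Y = b X ≫ B.map (F.map f))
    (hr : ∀ X, F.map (adj.R X ≫ t (A.obj X)) ≫ b (A.obj X) ≫ B.map (a X) =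
      adj.R (F.obj X) ≫ t (A.obj (F.obj X)))
    {c c' : ℂ} (hc : ∀ X, adj.R X ≫ (t (A.obj X) ≫ (t (A.obj X))†) ≫
      (t (A.obj X) ≫ (t (A.obj X))†) ≫ (adj.R X)† = c • 𝟙 X)
    (hc' : ∀ X, adj.R' X ≫ A.map ((t X ≫ (t X)†) ≫ t X ≫ (t X)†) ≫ (adj.R' X)† = c' • 𝟙 X)
    (Y : M) : F.map ((t Y)† ≫ t Y) ≫ b Y = b Y ≫ (t (F.obj Y))† ≫ t (F.obj Y) := by
  have := Fintype.ofFinite (Irr M)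
  set p : ∀ X, B.obj X ⟶ B.obj X := fun X => (t X)† ≫ t X with hp
  set w : ∀ X, V.obj X ⟶ V.obj X := fun X => t X ≫ (t X)† with hw
  have hpd : ∀ X, (p X)† = p X := fun X => by simp [hp]
  have hwd : ∀ X, (w X)† = w X := fun X => by simp [hw]
  have htd : ∀ {X Y : M} (f : X ⟶ Y), B.map f ≫ (t Y)† = (t X)† ≫ V.map f := by
    intro X Y f
    have := congrArg (fun t => t†) (ht f†)
    simpa [IsCStarFunctor.map_dagger] using this.symm
  have hwn : ∀ {X Y : M} (f : X ⟶ Y), V.map f ≫ w Y = w X ≫ V.map f := by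
    intro X Y f
    simp only [hw, Category.assoc]
    rw [reassoc_of% (ht f), htd]
  have hwwn : ∀ {X Y : M} (f : X ⟶ Y), V.map f ≫ w Y ≫ w Y = (w X ≫ w X) ≫ V.map f := by
    intro X Y f
    rw [reassoc_of% (hwn f), hwn f]
    exact (Category.assoc (w X) (w X) (V.map f)).symm
  have hpn : ∀ {X Y : M} (f : X ⟶ Y), B.map f ≫ p Y = p X ≫ B.map f := by
    intro X Y f
    simp only [hp, Category.assoc]
    rw [reassoc_of% (htd f), ht]
  set N : ℂ := ∑ i : Irr M, τ.dim i.rep * τ.dim (F.obj i.rep) with hN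
  -- closing `V` with `s` turns the term `F(p²)`, equivalent to `F((t* t)²)`, into `F(s* (t* t)² s) = c`
  have e1 : ∑ i : Irr M, τ.dim i.rep * τ.tr _ (F.map (p i.rep ≫ p i.rep)) = c * N := by
    have h1 : ∀ i : Irr M, τ.tr _ (F.map (p i.rep ≫ p i.rep)) =
        τ.tr _ (F.map (w i.rep ≫ w i.rep)) := by
      intro i
      simp only [hp, hw, Category.assoc]
      rw [F.map_comp, τ.tr_swap, ← F.map_comp]
      simp
    simp only [h1]
    rw [adj.flip.balance F (fun X => F.map (w X ≫ w X)) (fun f => by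
      rw [← F.map_comp, ← F.map_comp, hwwn]), hN, Finset.mul_sum]
    refine Finset.sum_congr rfl fun i _ => ?_
    rw [TraceAdjunction.flip_R', ← F.map_comp, ← F.map_comp, Category.assoc, hc,
      IsCStarFunctor.map_smul, map_smul, F.map_id, smul_eq_mul, mul_left_comm]
    rfl
  -- a mixed term is the trace of `k* k` for `k = t* b F(t) : F V ⟶ V F`, and closing `V` with `s` gives
  -- the scalar `c` again, because `b` is compatible with `r`
  have e3 : ∑ i : Irr M, τ.dim i.rep *
      τ.tr _ (F.map (p i.rep) ≫ b i.rep ≫ p (F.obj i.rep) ≫ (b i.rep)†) = c * N := by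
    let k : ∀ X, F.obj (V.obj X) ⟶ V.obj (F.obj X) := fun X =>
      F.map (t X) ≫ b X ≫ (t (F.obj X))†
    have hkn : ∀ {X Y : M} (f : X ⟶ Y), F.map (V.map f) ≫ k Y = k X ≫ V.map (F.map f) := by
      intro X Y f
      simp only [k, Category.assoc]
      rw [← F.map_comp_assoc, ht, F.map_comp_assoc, reassoc_of% (hbn f), htd]
    have hkd : ∀ {X Y : M} (f : X ⟶ Y), V.map (F.map f) ≫ (k Y)† = (k X)† ≫ F.map (V.map f) := by
      intro X Y f
      have := congrArg (fun t => t†) (hkn f†)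
      simpa [IsCStarFunctor.map_dagger] using this.symm
    have h1 : ∀ i : Irr M, τ.tr _ (F.map (p i.rep) ≫ b i.rep ≫ p (F.obj i.rep) ≫ (b i.rep)†) =
        τ.tr _ (k i.rep ≫ (k i.rep)†) := by
      intro i
      simp only [hp, k, F.map_comp, Category.assoc]
      rw [τ.tr_swap]
      simp [IsCStarFunctor.map_dagger]
    have h2 : ∀ X, F.map (adj.R X) ≫ k (A.obj X) =
        adj.R (F.obj X) ≫ w (A.obj (F.obj X)) ≫ V.map (a X)† := by
      intro X
      have h3 := congrArg (fun z => z ≫ B.map (a X)†) (hr X)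
      simp only [Category.assoc, ← B.map_comp, (ha X).1, B.map_id, Category.comp_id,
        F.map_comp] at h3
      simp only [k, hw, Category.assoc]
      rw [reassoc_of% h3, htd]
    simp only [h1]
    rw [adj.flip.balance F (fun X => k X ≫ (k X)†) (fun f => by
      rw [reassoc_of% (hkn f), hkd]
      exact (Category.assoc (k _) _ _).symm), hN, Finset.mul_sum]
    refine Finset.sum_congr rfl fun i _ => ?_
    have h4 : F.map (adj.R i.rep) ≫ (k (A.obj i.rep) ≫ (k (A.obj i.rep))†) ≫
        F.map (adj.R i.rep)† = c • 𝟙 (F.obj i.rep) := by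
      have h5 := congrArg (fun z => z†) (h2 i.rep)
      simp only [DaggerCategory.dagger_comp, ← IsCStarFunctor.map_dagger, hwd,
        DaggerCategory.dagger_dagger, Category.assoc] at h5
      rw [Category.assoc, h5, reassoc_of% (h2 i.rep), ← V.map_comp_assoc, (ha i.rep).2,
        V.map_id, Category.id_comp]
      exact hc (F.obj i.rep)
    rw [TraceAdjunction.flip_R', h4, map_smul, smul_eq_mul, mul_left_comm]
    rfl
  -- the term `p²` gives the scalar `c'` obtained from `s'` instead; `c' = c`, by `balance` for `K = 1`
  have e2 : ∑ i : Irr M, τ.dim i.rep *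
      τ.tr _ (p (F.obj i.rep) ≫ p (F.obj i.rep)) = c * N := by
    have h1 : ∀ X, τ.tr _ (p X ≫ p X) = c' * τ.dim X := by
      intro X
      have : τ.tr _ (p X ≫ p X) = τ.tr _ (w X ≫ w X) := by
        simp only [hp, hw, Category.assoc]
        rw [τ.tr_swap]
        simp
      rw [this, adj.flip.tr_eq]
      exact (congrArg (τ.tr X) (hc' X)).trans (by rw [map_smul]; rfl)
    have hcc : (∑ i : Irr M, τ.dim i.rep * τ.dim i.rep) * c' =
        (∑ i : Irr M, τ.dim i.rep * τ.dim i.rep) * c := by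
      have h2 := adj.flip.balance (𝟭 M) (fun X => w X ≫ w X) (fun f => by
        simp only [Functor.id_map]
        exact hwwn f)
      rw [Finset.sum_mul, Finset.sum_mul]
      refine Eq.trans ?_ (h2.trans ?_)
      · refine Finset.sum_congr rfl fun i _ => ?_
        have : τ.tr _ (w i.rep ≫ w i.rep) = c' * τ.dim i.rep := by
          rw [adj.flip.tr_eq]
          exact (congrArg (τ.tr i.rep) (hc' i.rep)).trans (by rw [map_smul]; rfl)
        refine Eq.trans ?_ (congrArg (τ.dim i.rep * ·) this).symm
        ring
      · refine Finset.sum_congr rfl fun i _ => ?_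
        have : τ.tr i.rep (adj.R i.rep ≫ (w (A.obj i.rep) ≫ w (A.obj i.rep)) ≫
            (adj.R i.rep)†) = c * τ.dim i.rep := by
          rw [Category.assoc, hc, map_smul]; rfl
        refine Eq.trans (congrArg (τ.dim i.rep * ·) this) ?_
        ring
    cases isEmpty_or_nonempty (Irr M) with
    | inl h => simp [hN]
    | inr h =>
      have hpos : 0 < ∑ i : Irr M, τ.dim i.rep * τ.dim i.rep :=
        Finset.sum_pos (fun i _ => mul_pos (τ.dim_pos i) (τ.dim_pos i)) Finset.univ_nonempty
      rw [← mul_left_cancel₀ hpos.ne' hcc]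
      simp only [h1, hN, Finset.mul_sum]
      exact Finset.sum_congr rfl fun i _ => mul_left_comm _ _ _
  have key : ∀ i : Irr M, F.map (p i.rep) ≫ b i.rep - b i.rep ≫ p (F.obj i.rep) = 0 := by
    refine τ.sum_eq_zero_imp _ (le_of_eq ?_)
    have h1 : ∀ i : Irr M, τ.tr _
        ((F.map (p i.rep) ≫ b i.rep - b i.rep ≫ p (F.obj i.rep)) ≫
          (F.map (p i.rep) ≫ b i.rep - b i.rep ≫ p (F.obj i.rep))†) =
        τ.tr _ (F.map (p i.rep ≫ p i.rep)) + τ.tr _ (p (F.obj i.rep) ≫ p (F.obj i.rep)) -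
          2 * τ.tr _ (F.map (p i.rep) ≫ b i.rep ≫ p (F.obj i.rep) ≫ (b i.rep)†) := by
      intro i
      simp only [dagger_sub, DaggerCategory.dagger_comp, hpd, ← IsCStarFunctor.map_dagger,
        Preadditive.sub_comp, Preadditive.comp_sub, Category.assoc, map_sub]
      rw [reassoc_of% (hb i.rep).1, ← F.map_comp,
        τ.tr_swap (b i.rep) (p (F.obj i.rep) ≫ (b i.rep)† ≫ F.map (p i.rep)),
        τ.tr_swap (b i.rep) (p (F.obj i.rep) ≫ p (F.obj i.rep) ≫ (b i.rep)†),
        τ.tr_swap (F.map (p i.rep)) (b i.rep ≫ p (F.obj i.rep) ≫ (b i.rep)†)]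
      simp only [Category.assoc, (hb i.rep).2, Category.comp_id]
      rw [τ.tr_swap (b i.rep)]
      simp only [Category.assoc]
      ring
    simp only [h1, mul_sub, mul_add, Finset.sum_sub_distrib, Finset.sum_add_distrib,
      mul_left_comm _ (2 : ℂ), ← Finset.mul_sum, e1, e2, e3]
    ring
  refine natural_ext (F := B ⋙ F) (G := F ⋙ B) (x := fun X => F.map (p X) ≫ b X)
    (y := fun X => b X ≫ p (F.obj X)) (fun f => ?_) (fun f => ?_) (fun i => sub_eq_zero.1 (key i)) Y
  · simp only [Functor.comp_map, Category.assoc]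
    rw [← hbn, ← F.map_comp_assoc, hpn, F.map_comp_assoc]
  · simp only [Functor.comp_map, Category.assoc]
    rw [reassoc_of% (hbn f), hpn]

end Commutation

/-! ### The mate of a unitary commutation is unitary -/

section Mate

variable {C : Type u₁} [Category.{v₁} C] [CStarCategory C] [MonoidalCategory C]
  {M : Type u₂} [Category.{v₂} M] [CStarCategory M] [MonoidalLeftAction C M]
  {F : M ⥤ M}

/-- The morphism `t⁻¹ b F(t) : F V ⟶ V F` obtained from a unitary `b : F B ⟶ B F` and an isomorphism
`t : V ⟶ B` is unitary if `b` intertwines `F(t t*)` and `t t*`. -/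
theorem isUnitary_of_commutes [IsCStarFunctor F] {VY BY VFY BFY : M} {t : VY ⟶ BY} {t' : BY ⟶ VY}
    (htt' : t ≫ t' = 𝟙 _) (ht't : t' ≫ t = 𝟙 _) {u : VFY ⟶ BFY} {u' : BFY ⟶ VFY}
    (huu' : u ≫ u' = 𝟙 _) (hu'u : u' ≫ u = 𝟙 _) {b : F.obj BY ⟶ BFY} (hb : IsUnitary b)
    (h : F.map (t† ≫ t) ≫ b = b ≫ u† ≫ u) : IsUnitary (F.map t ≫ b ≫ u') := by
  have hu'd : u'† ≫ u† = 𝟙 _ := by rw [← DaggerCategory.dagger_comp, huu', dagger_id]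
  have hud' : u† ≫ u'† = 𝟙 _ := by rw [← DaggerCategory.dagger_comp, hu'u, dagger_id]
  have ht'd : t'† ≫ t† = 𝟙 _ := by rw [← DaggerCategory.dagger_comp, htt', dagger_id]
  have h1 : F.map t ≫ b = F.map t'† ≫ b ≫ u† ≫ u := by
    rw [← h, ← F.map_comp_assoc, reassoc_of% ht'd]
  have h2 : F.map t ≫ b ≫ u' = F.map t'† ≫ b ≫ u† := by
    rw [reassoc_of% h1, huu', Category.comp_id]
  constructor
  · conv_lhs =>
      congr
      rw [h2]
      rfl
    simp only [DaggerCategory.dagger_comp, Category.assoc, ← IsCStarFunctor.map_dagger]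
    rw [reassoc_of% hud', reassoc_of% hb.1, ← F.map_comp, ht'd, F.map_id]
  · conv_lhs =>
      congr
      rfl
      rw [h2]
    simp only [DaggerCategory.dagger_comp, Category.assoc, ← IsCStarFunctor.map_dagger]
    rw [← F.map_comp_assoc, ← DaggerCategory.dagger_comp, ht't, dagger_id, F.map_id,
      Category.id_comp, reassoc_of% hb.2, hu'd]

variable {τ : ModuleTrace C M} {G A V : M ⥤ M}

/-- The mate `A G ⟶ G A` of `a : F A ⟶ A F` under an adjunction `F ⊣ G`. -/
def TraceAdjunction.mate (adj : TraceAdjunction τ F G) (a : ∀ X, F.obj (A.obj X) ⟶ A.obj (F.obj X))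
    (X : M) : A.obj (G.obj X) ⟶ G.obj (A.obj X) :=
  adj.R (A.obj (G.obj X)) ≫ G.map (a (G.obj X) ≫ A.map (adj.R' X)†)

theorem TraceAdjunction.R_mate (adj : TraceAdjunction τ F G)
    (a : ∀ X, F.obj (A.obj X) ⟶ A.obj (F.obj X))
    (han : ∀ {X Y : M} (f : X ⟶ Y), F.map (A.map f) ≫ a Y = a X ≫ A.map (F.map f)) (X : M) :
    A.map (adj.R X) ≫ adj.mate a (F.obj X) = adj.R (A.obj X) ≫ G.map (a X) := by
  rw [mate, reassoc_of% (adj.R_naturality (A.map (adj.R X))), ← G.map_comp, reassoc_of% han,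
    ← A.map_comp, adj.left_zigzag, A.map_id, Category.comp_id]

variable [IsCStarFunctor F] [IsCStarFunctor G]

theorem TraceAdjunction.map_mate (adj : TraceAdjunction τ F G)
    (a : ∀ X, F.obj (A.obj X) ⟶ A.obj (F.obj X)) (X : M) :
    F.map (adj.mate a X) ≫ (adj.R' (A.obj X))† = a (G.obj X) ≫ A.map (adj.R' X)† := by
  rw [mate, F.map_comp, Category.assoc, ← adj.R'_dagger_naturality, reassoc_of% adj.left_zigzag]

variable [∀ X Y : M, FiniteDimensional ℂ (X ⟶ Y)] [IsCStarFunctor A] [IsCStarFunctor V]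

/-- Let `A ⊣ V` and `F ⊣ G` be adjunctions that are unitary for a trace, and let `F` commute with both
`A` and `V` by unitaries compatible with the unit of `A ⊣ V`.  Then the mate `A G ⟶ G A` is unitary:
the composite of bijections `Hom(Y, A G X) → Hom(Y, G A X) → Hom(F Y, A X) → Hom(V F Y, X)` is,
up to the unitary `V F Y ≅ F V Y`, the composite
`Hom(Y, A G X) → Hom(V Y, G X) → Hom(F V Y, X)`. -/
theorem TraceAdjunction.isUnitary_mate (adj : TraceAdjunction τ F G) (α : TraceAdjunction τ A V)
    (a : ∀ X, F.obj (A.obj X) ⟶ A.obj (F.obj X)) (ha : ∀ X, IsUnitary (a X))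
    (c : ∀ X, F.obj (V.obj X) ⟶ V.obj (F.obj X)) (hc : ∀ X, IsUnitary (c X))
    (hcn : ∀ {X Y : M} (f : X ⟶ Y), F.map (V.map f) ≫ c Y = c X ≫ V.map (F.map f))
    (hac : ∀ X, F.map (α.R X) ≫ c (A.obj X) ≫ V.map (a X) = α.R (F.obj X)) (X : M) :
    IsUnitary (adj.mate a X) := by
  set g := adj.mate a X with hg
  have hac' : V.map (a (G.obj X)) ≫ (α.R (F.obj (G.obj X)))† =
      (c (A.obj (G.obj X)))† ≫ F.map (α.R (G.obj X))† := by
    have := congrArg (fun t => t†) (hac (G.obj X))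
    simp only [DaggerCategory.dagger_comp, ← IsCStarFunctor.map_dagger, Category.assoc] at this
    rw [← this, ← V.map_comp_assoc, (ha _).1, V.map_id, Category.id_comp]
  have hcn' : ∀ {X Y : M} (f : X ⟶ Y), V.map (F.map f) ≫ (c Y)† = (c X)† ≫ F.map (V.map f) := by
    intro X Y f
    have := congrArg (fun t => t†) (hcn f†)
    simpa [IsCStarFunctor.map_dagger] using this.symm
  have key : ∀ {Y : M} (k : Y ⟶ A.obj (G.obj X)),
      V.map (F.map (k ≫ g) ≫ (adj.R' (A.obj X))†) ≫ (α.R X)† =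
        (c Y)† ≫ F.map (V.map k ≫ (α.R (G.obj X))†) ≫ (adj.R' X)† := by
    intro Y k
    rw [F.map_comp, Category.assoc, adj.map_mate]
    simp only [V.map_comp, F.map_comp, Category.assoc]
    rw [← α.R_dagger_naturality, reassoc_of% hac', reassoc_of% hcn']
  have iso : ∀ {Y : M} (k l : Y ⟶ A.obj (G.obj X)), τ.tr Y ((k ≫ g) ≫ (l ≫ g)†) =
      τ.tr Y (k ≫ l†) := by
    intro Y k l
    have h1 := adj.tr_transpose (k ≫ g) (l ≫ g)
    have h2 := α.flip.tr_transpose (F.map (k ≫ g) ≫ (adj.R' (A.obj X))†)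
      (F.map (l ≫ g) ≫ (adj.R' (A.obj X))†)
    have h3 := adj.tr_transpose (V.map k ≫ (α.R (G.obj X))†) (V.map l ≫ (α.R (G.obj X))†)
    have h4 := α.flip.tr_transpose k l
    simp only [TraceAdjunction.flip_R'] at h2 h4
    rw [← h1, ← h2, key, key, ← h4, ← h3, DaggerCategory.dagger_comp (c Y)†,
      DaggerCategory.dagger_dagger, Category.assoc, τ.tr_swap (c Y)†]
    simp only [Category.assoc, (hc Y).1, Category.comp_id]
  have h1 : g ≫ g† = 𝟙 _ := by
    refine sub_eq_zero.1 (τ.eq_zero_of_tr ?_)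
    have h := iso (g ≫ g† - 𝟙 _) (𝟙 _)
    rw [Category.id_comp, dagger_id, Category.comp_id] at h
    rw [dagger_sub, Preadditive.comp_sub, dagger_id, Category.comp_id, map_sub,
      DaggerCategory.dagger_comp, DaggerCategory.dagger_dagger, ← Category.assoc, h, sub_self]
  -- a morphism `k` whose image under the composite of transpositions is that of the identity
  obtain ⟨x, hx⟩ := adj.transpose_surjective
    (c (G.obj (A.obj X)) ≫ V.map (adj.R' (A.obj X))† ≫ (α.R X)†)
  obtain ⟨k, hk⟩ := α.flip.transpose_surjective x
  have h2 : k ≫ g = 𝟙 _ := by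
    apply adj.transpose_injective
    apply α.flip.transpose_injective
    rw [TraceAdjunction.flip_R', key]
    rw [TraceAdjunction.flip_R'] at hk
    rw [hk, hx, reassoc_of% (hc _).2, F.map_id, Category.id_comp]
  refine ⟨h1, ?_⟩
  have h3 : k = g† := by rw [← Category.comp_id k, ← h1, reassoc_of% h2]
  rw [← h3, h2]

end Mate

section ActionMate

variable {C : Type u₁} [Category.{v₁} C] [CStarCategory C] [MonoidalCategory C]
  {M : Type u₂} [Category.{v₂} M] [CStarCategory M] [MonoidalLeftAction C M]
  [CStarModuleCategory C M]

theorem actionUnit_comp_dagger {U V : C} (R S : 𝟙_ C ⟶ V ⊗ U) (X : M) :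
    actionUnit R X ≫ (actionUnit S X)† = (λₗ[C] X).inv ≫ (R ≫ S†) ⊵ₗ X ≫ (λₗ[C] X).hom := by
  rw [actionUnit_dagger, actionUnit]
  simp

variable [CStarTensorCategory C]

theorem exists_actionUnit_comp_dagger_eq_smul {U V : C} (R S : 𝟙_ C ⟶ V ⊗ U) :
    ∃ c : ℂ, ∀ X : M, actionUnit R X ≫ (actionUnit S X)† = c • 𝟙 X := by
  obtain ⟨c, hc⟩ := CStarTensorCategory.unit_simple (R ≫ S†)
  refine ⟨c, fun X => ?_⟩
  rw [actionUnit_comp_dagger, hc, CStarModuleCategory.actionLeft_smul]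
  simp

variable [∀ X Y : M, FiniteDimensional ℂ (X ⟶ Y)] [Finite (Irr M)]
  {τ : ModuleTrace C M} {F G : M ⥤ M} [IsCStarFunctor F] [IsCStarFunctor G]

/-- If `F` commutes with the actions of `U` and `W` by unitaries that are compatible with some
solution of the conjugate equations for `(U, W)`, then the mate of `F(U ⊗ X) ≅ U ⊗ F(X)` under an
adjunction of `F` is unitary: the solution can be replaced by a norm-standard one, and
`map_comp_eq_of_compatible` shows that the comparison of the two preserves unitarity. -/
theorem TraceAdjunction.isUnitary_mate_action (adj : TraceAdjunction τ F G) (hC : IsRigid C)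
    {U W : C} {r : 𝟙_ C ⟶ W ⊗ U} {r' : 𝟙_ C ⟶ U ⊗ W} (hr : IsConjugateSolution U W r r')
    (a : ∀ X, F.obj (U ⊙ₗ X) ⟶ U ⊙ₗ F.obj X) (ha : ∀ X, IsUnitary (a X))
    (b : ∀ X, F.obj (W ⊙ₗ X) ⟶ W ⊙ₗ F.obj X) (hb : ∀ X, IsUnitary (b X))
    (hbn : ∀ {X Y : M} (f : X ⟶ Y), F.map (W ⊴ₗ f) ≫ b Y = b X ≫ W ⊴ₗ F.map f)
    (hab : ∀ X, F.map (actionUnit r X) ≫ b (U ⊙ₗ X) ≫ W ⊴ₗ a X = actionUnit r (F.obj X)) (X : M) :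
    IsUnitary (adj.mate (A := actionFunctor M U) a X) := by
  obtain ⟨V, s, s', hs⟩ := exists_standardSolution hC U
  obtain ⟨e, he, -⟩ := hs.solution.exists_iso hr
  let α := actionTraceAdjunction τ hs
  have hrs : ∀ X : M, actionUnit s X ≫ e.hom ⊵ₗ (U ⊙ₗ X) = actionUnit r X := fun X => by
    rw [he, actionUnit_whiskerRight]
  obtain ⟨c, hc⟩ := exists_actionUnit_comp_dagger_eq_smul (M := M)
    (s ≫ ((e.hom ≫ e.hom†) ≫ e.hom ≫ e.hom†) ▷ U) s
  obtain ⟨c', hc'⟩ := exists_actionUnit_comp_dagger_eq_smul (M := M)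
    (s' ≫ U ◁ ((e.hom ≫ e.hom†) ≫ e.hom ≫ e.hom†)) s'
  have hcomm := map_comp_eq_of_compatible (F := F) (B := actionFunctor M W) α
    (fun X => e.hom ⊵ₗ X) (fun f => (MonoidalLeftAction.action_exchange e.hom f)) a ha b hb hbn
    (fun X => (congrArg (fun z => F.map z ≫ _) (hrs X)).trans ((hab X).trans (hrs _).symm))
    (c := c) (c' := c')
    (fun X => by
      rw [← hc X, actionUnit_whiskerRight]
      simp only [MonoidalLeftAction.comp_actionHomLeft, CStarModuleCategory.actionLeft_dagger,
        Category.assoc]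
      rfl)
    (fun X => by
      rw [← hc' X, actionUnit_whiskerLeft]
      simp only [MonoidalLeftAction.comp_actionHomLeft, CStarModuleCategory.actionLeft_dagger,
        Category.assoc]
      rfl)
  have hinv : ∀ X : M, e.hom ⊵ₗ X ≫ e.inv ⊵ₗ X = 𝟙 _ := fun X => by simp
  have hinv' : ∀ X : M, e.inv ⊵ₗ X ≫ e.hom ⊵ₗ X = 𝟙 _ := fun X => by simp
  refine adj.isUnitary_mate α a ha (fun X => F.map (e.hom ⊵ₗ X) ≫ b X ≫ e.inv ⊵ₗ F.obj X)
    (fun X => isUnitary_of_commutes (hinv X) (hinv' X) (hinv _) (hinv' _) (hb X) (hcomm X))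
    (fun {X Y} f => ?_) (fun X => ?_) X
  · change F.map (V ⊴ₗ f) ≫ F.map (e.hom ⊵ₗ Y) ≫ b Y ≫ e.inv ⊵ₗ F.obj Y =
      (F.map (e.hom ⊵ₗ X) ≫ b X ≫ e.inv ⊵ₗ F.obj X) ≫ V ⊴ₗ F.map f
    rw [← F.map_comp_assoc, MonoidalLeftAction.action_exchange, F.map_comp_assoc,
      reassoc_of% hbn, MonoidalLeftAction.action_exchange]
    simp only [Category.assoc]
  · change F.map (actionUnit s X) ≫ (F.map (e.hom ⊵ₗ (U ⊙ₗ X)) ≫ b (U ⊙ₗ X) ≫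
      e.inv ⊵ₗ F.obj (U ⊙ₗ X)) ≫ V ⊴ₗ a X = actionUnit s (F.obj X)
    simp only [Category.assoc]
    rw [← F.map_comp_assoc, hrs, ← MonoidalLeftAction.action_exchange, reassoc_of% hab, ← hrs,
      Category.assoc, hinv, Category.comp_id]

end ActionMate

/-! ### Images of solutions under C*-tensor functors -/

section TensorFunctor

open Functor.LaxMonoidal Functor.OplaxMonoidal

variable {D : Type u₁} [Category.{v₁} D] [CStarCategory D] [MonoidalCategory D]
  {C : Type u₂} [Category.{v₂} C] [CStarCategory C] [MonoidalCategory C]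
  (Θ : D ⥤ C) [Θ.Monoidal] [IsCStarTensorFunctor Θ]

theorem dagger_unit_comp_map_comp {X Y : D} (R : 𝟙_ D ⟶ X ⊗ Y) :
    (ε Θ ≫ Θ.map R ≫ δ Θ X Y)† = μ Θ X Y ≫ Θ.map R† ≫ η Θ := by
  have h : IsUnitary (Functor.Monoidal.εIso Θ).hom := IsCStarTensorFunctor.unit_unitary
  have h' : IsUnitary (Functor.Monoidal.μIso Θ X Y).hom := IsCStarTensorFunctor.tensor_unitary X Y
  have h1 : η Θ = (ε Θ)† := h.inv_eq
  have h2 : (δ Θ X Y)† = μ Θ X Y := h'.inv_dagger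
  rw [DaggerCategory.dagger_comp, DaggerCategory.dagger_comp, h1, h2, IsCStarFunctor.map_dagger,
    Category.assoc]

theorem map_left_eq {X X' : D} {R : 𝟙_ D ⟶ X' ⊗ X} {R' : 𝟙_ D ⟶ X ⊗ X'}
    (h : (λ_ X).inv ≫ R' ▷ X ≫ (α_ X X' X).hom ≫ X ◁ R† ≫ (ρ_ X).hom = 𝟙 X) :
    (λ_ (Θ.obj X)).inv ≫ (ε Θ ≫ Θ.map R' ≫ δ Θ X X') ▷ Θ.obj X ≫
      (α_ (Θ.obj X) (Θ.obj X') (Θ.obj X)).hom ≫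
      Θ.obj X ◁ (ε Θ ≫ Θ.map R ≫ δ Θ X' X)† ≫ (ρ_ (Θ.obj X)).hom = 𝟙 (Θ.obj X) := by
  have h1 := congrArg (fun t => Θ.map t) h
  simp only [Functor.map_comp, Functor.Monoidal.map_leftUnitor_inv, Functor.Monoidal.map_whiskerRight,
    Functor.Monoidal.map_associator, Functor.Monoidal.map_whiskerLeft,
    Functor.Monoidal.map_rightUnitor, Category.assoc, Functor.Monoidal.μ_δ_assoc] at h1
  rw [Θ.map_id] at h1
  rw [dagger_unit_comp_map_comp, ← h1]
  simp only [comp_whiskerRight, whiskerLeft_comp, Category.assoc]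

/-- A C*-tensor functor maps solutions of the conjugate equations to solutions. -/
theorem IsConjugateSolution.map {X X' : D} {R : 𝟙_ D ⟶ X' ⊗ X} {R' : 𝟙_ D ⟶ X ⊗ X'}
    (h : IsConjugateSolution X X' R R') :
    IsConjugateSolution (Θ.obj X) (Θ.obj X') (ε Θ ≫ Θ.map R ≫ δ Θ X' X)
      (ε Θ ≫ Θ.map R' ≫ δ Θ X X') :=
  ⟨map_left_eq Θ h.left_eq, map_left_eq Θ h.right_eq⟩

end TensorFunctor

/-! ### Rigidity of the category of module endofunctors -/

section ModuleFunctor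

variable {D : Type u₃} [Category.{v₃} D] [CStarCategory D] [MonoidalCategory D]
  {M : Type u₂} [Category.{v₂} M] [CStarCategory M] [MonoidalLeftAction D M]

theorem ModEnd.map_actionUnit_comp_str (F : ModEnd D M) {U V : D} (R : 𝟙_ D ⟶ V ⊗ U) (X : M) :
    F.toBddEnd.toFunctor.map (actionUnit R X) ≫ F.str V (U ⊙ₗ X) ≫ V ⊴ₗ F.str U X =
      actionUnit R (F.toBddEnd.toFunctor.obj X) := by
  simp only [actionUnit, Functor.map_comp, Category.assoc]
  rw [← F.str_assoc, reassoc_of% (F.str_naturality_left R X), F.str_unit, Category.assoc]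

variable {C : Type u₁} [Category.{v₁} C] [CStarCategory C] [MonoidalCategory C]
  [MonoidalLeftAction C M] {τ : ModuleTrace C M} {G : M ⥤ M}

namespace ModEnd

/-- The mate `U ⊗ G(X) ⟶ G(U ⊗ X)` of the structure morphism of a module functor `F`, for `G`
adjoint to `F`. -/
def mateStr (F : ModEnd D M) (adj : TraceAdjunction τ F.toBddEnd.toFunctor G) (U : D) (X : M) :
    U ⊙ₗ G.obj X ⟶ G.obj (U ⊙ₗ X) :=
  adj.mate (A := actionFunctor M U) (F.str U) X

variable (F : ModEnd D M) (adj : TraceAdjunction τ F.toBddEnd.toFunctor G)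

theorem R_mateStr (U : D) (X : M) :
    U ⊴ₗ adj.R X ≫ F.mateStr adj U (F.toBddEnd.toFunctor.obj X) =
      adj.R (U ⊙ₗ X) ≫ G.map (F.str U X) :=
  adj.R_mate (A := actionFunctor M U) (F.str U) (F.str_naturality_right U) X

variable [IsCStarFunctor G]

theorem map_mateStr (U : D) (X : M) :
    F.toBddEnd.toFunctor.map (F.mateStr adj U X) ≫ (adj.R' (U ⊙ₗ X))† =
      F.str U (G.obj X) ≫ U ⊴ₗ (adj.R' X)† :=
  adj.map_mate (A := actionFunctor M U) (F.str U) X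

theorem mateStr_naturality_left {U V : D} (f : U ⟶ V) (X : M) :
    f ⊵ₗ G.obj X ≫ F.mateStr adj V X = F.mateStr adj U X ≫ G.map (f ⊵ₗ X) := by
  apply adj.transpose_injective
  rw [Functor.map_comp, Functor.map_comp, Category.assoc, Category.assoc, map_mateStr,
    ← adj.R'_dagger_naturality, reassoc_of% (F.map_mateStr adj U X),
    reassoc_of% (F.str_naturality_left f (G.obj X)), MonoidalLeftAction.action_exchange]

theorem mateStr_naturality_right (U : D) {X Y : M} (f : X ⟶ Y) :
    U ⊴ₗ G.map f ≫ F.mateStr adj U Y = F.mateStr adj U X ≫ G.map (U ⊴ₗ f) := by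
  apply adj.transpose_injective
  rw [Functor.map_comp, Functor.map_comp, Category.assoc, Category.assoc, map_mateStr,
    ← adj.R'_dagger_naturality, reassoc_of% (F.map_mateStr adj U X),
    reassoc_of% (F.str_naturality_right U (G.map f)), ← MonoidalLeftAction.actionHomRight_comp,
    ← MonoidalLeftAction.actionHomRight_comp, adj.R'_dagger_naturality]

theorem mateStr_assoc (U V : D) (X : M) :
    F.mateStr adj (U ⊗ V) X ≫ G.map (αₗ U V X).hom =
      (αₗ U V (G.obj X)).hom ≫ U ⊴ₗ F.mateStr adj V X ≫ F.mateStr adj U (V ⊙ₗ X) := by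
  apply adj.transpose_injective
  simp only [Functor.map_comp, Category.assoc]
  rw [← adj.R'_dagger_naturality, reassoc_of% (F.map_mateStr adj (U ⊗ V) X), map_mateStr,
    reassoc_of% (F.str_naturality_right U (F.mateStr adj V X)),
    ← MonoidalLeftAction.actionHomRight_comp, map_mateStr, MonoidalLeftAction.actionHomRight_comp,
    ← reassoc_of% (F.str_assoc U V (G.obj X))]
  simp

theorem mateStr_unit (X : M) :
    (λₗ[D] (G.obj X)).inv ≫ F.mateStr adj (𝟙_ D) X = G.map (λₗ[D] X).inv := by
  apply adj.transpose_injective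
  rw [Functor.map_comp, Category.assoc, map_mateStr, ← adj.R'_dagger_naturality,
    ← reassoc_of% (F.str_unit (G.obj X)), MonoidalLeftAction.actionUnitIso_inv_naturality]

/-- The module functor structure on a functor adjoint to a module functor `F`, with structure
morphisms the adjoints of the mates of those of `F`, which are assumed to be unitary. -/
def conjugate (h : ∀ U X, IsUnitary (F.mateStr adj U X)) : ModEnd D M where
  toBddEnd := ⟨G, inferInstance⟩
  lineator :=
    { δₗ := fun U X => (F.mateStr adj U X)†
      δₗ_naturality_left := fun {U V} f X => by
        rw [← Category.id_comp (G.map _ ≫ _), ← (h U X).2, Category.assoc,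
          ← reassoc_of% (F.mateStr_naturality_left adj f X), (h V X).1, Category.comp_id]
      δₗ_naturality_right := fun U X Y f => by
        rw [← Category.id_comp (G.map _ ≫ _), ← (h U X).2, Category.assoc,
          ← reassoc_of% (F.mateStr_naturality_right adj U f), (h U Y).1, Category.comp_id]
      δₗ_associativity := fun U V X => by
        rw [← Category.id_comp (G.map _ ≫ _), ← (h (U ⊗ V) X).2, Category.assoc,
          reassoc_of% (F.mateStr_assoc adj U V X), reassoc_of% (h U (V ⊙ₗ X)).1,
          ← MonoidalLeftAction.actionHomRight_comp, (h V X).1,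
          MonoidalLeftAction.actionHomRight_id, Category.comp_id]
      δₗ_unitality_inv := fun X => by
        change _ = G.map _ ≫ _
        rw [← F.mateStr_unit adj X, Category.assoc, (h _ X).1, Category.comp_id] }
  lineator_unitary U X := (h U X).dagger

/-- A module functor `F` is rigid as soon as the mates of its structure morphisms are unitary, and has
a solution which is an adjunction unitary for the trace. -/
theorem exists_solution [CStarModuleCategory D M] [∀ X Y : M, FiniteDimensional ℂ (X ⟶ Y)]
    [Finite (Irr M)] (h : ∀ U X, IsUnitary (F.mateStr adj U X)) :
    ∃ (F' : ModEnd D M) (R : 𝟙_ (ModEnd D M) ⟶ F' ⊗ F) (R' : 𝟙_ (ModEnd D M) ⟶ F ⊗ F')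
      (A : TraceAdjunction τ F.toBddEnd.toFunctor F'.toBddEnd.toFunctor),
      IsConjugateSolution F F' R R' ∧ (∀ X, BddEnd.app R.toHom X = A.R X) ∧
        ∀ X, BddEnd.app R'.toHom X = A.R' X := by
  let R : 𝟙_ (ModEnd D M) ⟶ F.conjugate adj h ⊗ F :=
    { toHom :=
        { natTrans :=
            { app := adj.R
              naturality := fun X Y f => adj.R_naturality f }
          bounded := exists_bound_of_natural (F.toBddEnd.toFunctor ⋙ G) adj.R adj.R_naturality }
      comm := fun U X => by
        change 𝟙 _ ≫ U ⊴ₗ adj.R X = adj.R (U ⊙ₗ X) ≫ G.map (F.str U X) ≫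
          (F.mateStr adj U (F.toBddEnd.toFunctor.obj X))†
        rw [← reassoc_of% (F.R_mateStr adj U X), (h _ _).1, Category.id_comp, Category.comp_id] }
  let R' : 𝟙_ (ModEnd D M) ⟶ F ⊗ F.conjugate adj h :=
    { toHom :=
        { natTrans :=
            { app := adj.R'
              naturality := fun X Y f => adj.R'_naturality f }
          bounded := exists_bound_of_natural (G ⋙ F.toBddEnd.toFunctor) adj.R' adj.R'_naturality }
      comm := fun U X => by
        change 𝟙 _ ≫ U ⊴ₗ adj.R' X = adj.R' (U ⊙ₗ X) ≫
          F.toBddEnd.toFunctor.map (F.mateStr adj U X)† ≫ F.str U (G.obj X)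
        have h1 := congrArg (fun t => t†) (F.map_mateStr adj U X)
        simp only [DaggerCategory.dagger_comp, DaggerCategory.dagger_dagger,
          ← IsCStarFunctor.map_dagger, ← CStarModuleCategory.actionRight_dagger] at h1
        have h2 : (F.str U (G.obj X))† ≫ F.str U (G.obj X) = 𝟙 _ := (F.lineator_unitary U _).2
        rw [reassoc_of% h1, h2, Category.id_comp, Category.comp_id] }
  refine ⟨F.conjugate adj h, R, R', adj, ⟨?_, ?_⟩, fun X => rfl, fun X => rfl⟩
  · refine hom_ext (BddEnd.hom_ext fun X => ?_)
    change 𝟙 _ ≫ adj.R' (F.toBddEnd.toFunctor.obj X) ≫ 𝟙 _ ≫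
      F.toBddEnd.toFunctor.map (adj.R X)† ≫ 𝟙 _ = 𝟙 _
    have := congrArg (fun t => t†) (adj.left_zigzag X)
    simpa [IsCStarFunctor.map_dagger] using this
  · refine hom_ext (BddEnd.hom_ext fun X => ?_)
    change 𝟙 _ ≫ adj.R (G.obj X) ≫ 𝟙 _ ≫ G.map (adj.R' X)† ≫ 𝟙 _ = 𝟙 _
    simpa using adj.right_zigzag X

end ModEnd

end ModuleFunctor

section Restriction

open Functor.LaxMonoidal Functor.OplaxMonoidal

variable {C : Type u₁} [Category.{v₁} C] [MonoidalCategory C]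
  {D : Type u₃} [Category.{v₃} D] [MonoidalCategory D] (Θ : D ⥤ C) [Θ.Monoidal]
  {M : Type u₂} [Category.{v₂} M] [MonoidalLeftAction C M]

theorem actionUnit_restrictAction {U V : D} (R : 𝟙_ D ⟶ V ⊗ U) (X : M) :
    letI := restrictAction Θ M
    actionUnit R X = actionUnit (ε Θ ≫ Θ.map R ≫ δ Θ V U) X := by
  let := restrictAction Θ M
  have h : (λₗ[D] X).inv = (λₗ[C] X).inv ≫ ε Θ ⊵ₗ X := rfl
  have h' : (αₗ V U X).hom = δ Θ V U ⊵ₗ X ≫ (αₗ (Θ.obj V) (Θ.obj U) X).hom := rfl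
  have h2 : R ⊵ₗ X = Θ.map R ⊵ₗ X := rfl
  rw [actionUnit, actionUnit, h, h', h2]
  simp only [MonoidalLeftAction.comp_actionHomLeft, Category.assoc]

/-- For a module functor `F` over a rigid category acting through `Θ`, the mates of the structure
morphisms of `F` are unitary. -/
theorem isUnitary_mateStr [CStarCategory C] [CStarCategory D] [CStarCategory M]
    [CStarTensorCategory C] (hC : IsRigid C) (hD : IsRigid D)
    [IsCStarTensorFunctor Θ] [CStarModuleCategory C M]
    [∀ X Y : M, FiniteDimensional ℂ (X ⟶ Y)] [Finite (Irr M)] {τ : ModuleTrace C M} :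
    letI := restrictAction Θ M
    ∀ (F : ModEnd D M) {G : M ⥤ M} [IsCStarFunctor G]
      (adj : TraceAdjunction τ F.toBddEnd.toFunctor G) (U : D) (X : M),
      IsUnitary (F.mateStr adj U X) := by
  let := restrictAction Θ M
  intro F G _ adj U X
  obtain ⟨W, R, R', h⟩ := hD U
  refine adj.isUnitary_mate_action hC (h.map Θ) (F.str U) (F.lineator_unitary U) (F.str W)
    (F.lineator_unitary W) (F.str_naturality_right W) (fun Y => ?_) X
  have h1 := F.map_actionUnit_comp_str R Y
  rw [actionUnit_restrictAction, actionUnit_restrictAction] at h1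
  exact h1

end Restriction

/-! ### Standard solutions -/

section DaggerMonoidal

variable {C : Type u} [Category.{v} C] [DaggerCategory C] [MonoidalCategory C] [DaggerMonoidal C]
  {X X' X'' : C}

theorem comp_whiskerRight_comp_dagger {R : 𝟙_ C ⟶ X' ⊗ X} {k : X ⟶ X} (e : X' ⟶ X'')
    (hk : R ≫ (e ≫ e†) ▷ X = R ≫ X' ◁ k) (η : X ⟶ X) :
    (R ≫ e ▷ X) ≫ X'' ◁ η ≫ (R ≫ e ▷ X)† = R ≫ X' ◁ (k ≫ η) ≫ R† := by
  rw [DaggerCategory.dagger_comp, ← DaggerMonoidal.dagger_whiskerRight, Category.assoc,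
    whisker_exchange_assoc, ← comp_whiskerRight_assoc, reassoc_of% hk, whiskerLeft_comp,
    Category.assoc]

theorem comp_whiskerLeft_comp_dagger {R' : 𝟙_ C ⟶ X ⊗ X'} {k : X ⟶ X} (f : X'' ⟶ X')
    (hk : X ◁ (f† ≫ f) ≫ R'† = k ▷ X' ≫ R'†) (η : X ⟶ X) :
    (R' ≫ X ◁ f†) ≫ η ▷ X'' ≫ (R' ≫ X ◁ f†)† = R' ≫ (η ≫ k) ▷ X' ≫ R'† := by
  rw [DaggerCategory.dagger_comp, ← DaggerMonoidal.whiskerLeft_dagger,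
    DaggerCategory.dagger_dagger, Category.assoc, whisker_exchange_assoc, comp_whiskerRight,
    Category.assoc, ← hk, whiskerLeft_comp, Category.assoc]

end DaggerMonoidal

instance {M : Type u₂} [Category.{v₂} M] [CStarCategory M] : DaggerMonoidal (BddEnd M) where
  whiskerLeft_dagger F _ _ η := BddEnd.hom_ext fun X =>
    IsCStarFunctor.map_dagger (F := F.toFunctor) (BddEnd.app η X)
  dagger_whiskerRight _ _ := rfl
  associator_unitary F G H :=
    have h X := isUnitary_id (F.toFunctor.obj (G.toFunctor.obj (H.toFunctor.obj X)))
    ⟨BddEnd.hom_ext fun X => (h X).1, BddEnd.hom_ext fun X => (h X).2⟩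
  leftUnitor_unitary F :=
    have h X := isUnitary_id (F.toFunctor.obj X)
    ⟨BddEnd.hom_ext fun X => (h X).1, BddEnd.hom_ext fun X => (h X).2⟩
  rightUnitor_unitary F :=
    have h X := isUnitary_id (F.toFunctor.obj X)
    ⟨BddEnd.hom_ext fun X => (h X).1, BddEnd.hom_ext fun X => (h X).2⟩

instance {D : Type u₁} [Category.{v₁} D] [CStarCategory D] [MonoidalCategory D]
    {M : Type u₂} [Category.{v₂} M] [CStarCategory M] [MonoidalLeftAction D M]
    [CStarModuleCategory D M] : DaggerMonoidal (ModEnd D M) where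
  whiskerLeft_dagger F _ _ η := ModEnd.hom_ext
    (DaggerMonoidal.whiskerLeft_dagger F.toBddEnd η.toHom)
  dagger_whiskerRight _ _ := rfl
  associator_unitary F G H :=
    have h := DaggerMonoidal.associator_unitary F.toBddEnd G.toBddEnd H.toBddEnd
    ⟨ModEnd.hom_ext h.1, ModEnd.hom_ext h.2⟩
  leftUnitor_unitary F :=
    have h := DaggerMonoidal.leftUnitor_unitary F.toBddEnd
    ⟨ModEnd.hom_ext h.1, ModEnd.hom_ext h.2⟩
  rightUnitor_unitary F :=
    have h := DaggerMonoidal.rightUnitor_unitary F.toBddEnd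
    ⟨ModEnd.hom_ext h.1, ModEnd.hom_ext h.2⟩

section Plancherel

variable {C : Type u₁} [Category.{v₁} C] [CStarCategory C] [MonoidalCategory C]
  {M : Type u₂} [Category.{v₂} M] [CStarCategory M] [MonoidalLeftAction C M]
  [Fintype (Irr M)]

theorem ModuleTrace.plancherel_eq_sum (τ : ModuleTrace C M) (a : 𝟙_ (BddEnd M) ⟶ 𝟙_ (BddEnd M)) :
    τ.plancherel a = ∑ i : Irr M, τ.dim i.rep * τ.tr i.rep (BddEnd.app a i.rep) := by
  rw [plancherel, finsum_eq_sum_of_fintype]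
  refine Finset.sum_congr rfl fun i _ => ?_
  rw [sq, mul_assoc, τ.dim_mul_scalar]

variable {τ : ModuleTrace C M} {F G F' : BddEnd M}
  (A : TraceAdjunction τ F.toFunctor G.toFunctor)
  {R : 𝟙_ (BddEnd M) ⟶ G ⊗ F} {R' : 𝟙_ (BddEnd M) ⟶ F ⊗ G}

theorem TraceAdjunction.plancherel_left (hR : ∀ X, BddEnd.app R X = A.R X) (x : F ⟶ F) :
    τ.plancherel (R ≫ G ◁ x ≫ R†) =
      ∑ i : Irr M, τ.dim i.rep * τ.tr _ (BddEnd.app x i.rep) := by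
  rw [τ.plancherel_eq_sum]
  refine Finset.sum_congr rfl fun i _ => ?_
  rw [A.tr_eq]
  simp only [BddEnd.comp_app, BddEnd.whiskerLeft_app, BddEnd.dagger_app, hR]

variable [∀ X Y : M, FiniteDimensional ℂ (X ⟶ Y)]

theorem TraceAdjunction.plancherel_right (hR' : ∀ X, BddEnd.app R' X = A.R' X) (x : F ⟶ F) :
    τ.plancherel (R' ≫ x ▷ G ≫ R'†) =
      ∑ i : Irr M, τ.dim i.rep * τ.tr _ (BddEnd.app x i.rep) := by
  rw [τ.plancherel_eq_sum]
  have h := A.balance (𝟭 M) (fun X => BddEnd.app x X) (fun f => BddEnd.naturality x _)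
  refine Eq.trans ?_ h.symm
  refine Finset.sum_congr rfl fun i _ => ?_
  simp only [BddEnd.comp_app, BddEnd.whiskerRight_app, BddEnd.dagger_app, hR']
  rfl

/-- A solution that differs from an adjunction unitary for the trace by a unitary is standard. -/
theorem TraceAdjunction.isStandard (hR : ∀ X, BddEnd.app R X = A.R X)
    (hR' : ∀ X, BddEnd.app R' X = A.R' X) (e : G ≅ F')
    (he : ∀ i : Irr M, BddEnd.app e.hom i.rep ≫ (BddEnd.app e.hom i.rep)† = 𝟙 _)
    (h : IsConjugateSolution F F' (R ≫ e.hom ▷ F) (R' ≫ F ◁ e.inv†)) :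
    τ.IsStandard F F' (R ≫ e.hom ▷ F) (R' ≫ F ◁ e.inv†) where
  solution := h
  balanced ζ := by
    have he' : e.hom ≫ e.hom† = 𝟙 _ := BddEnd.hom_ext fun X =>
      natural_ext (F := G.toFunctor) (G := G.toFunctor)
        (x := fun X => BddEnd.app (e.hom ≫ e.hom†) X) (y := fun X => 𝟙 _)
        (fun f => BddEnd.naturality (e.hom ≫ e.hom†) f)
        (fun f => by rw [Category.comp_id, Category.id_comp]) he X
    have hinv : e.inv = e.hom† := by rw [← cancel_epi e.hom, he', Iso.hom_inv_id]
    have he'' : e.inv† ≫ e.inv = 𝟙 _ := by rw [hinv, DaggerCategory.dagger_dagger, he']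
    rw [ModuleTrace.Balances, comp_whiskerRight_comp_dagger (k := 𝟙 F) e.hom (by simp [he']),
      comp_whiskerLeft_comp_dagger (k := 𝟙 F) e.inv (by simp [he'']), A.plancherel_left hR,
      A.plancherel_right hR', Category.id_comp, Category.comp_id]

end Plancherel

theorem comp_comp_dagger {C : Type u} [Category.{v} C] [DaggerCategory C] {X Y Z : C} (f : X ⟶ Y)
    (g : Y ⟶ Z) : (f ≫ g) ≫ (f ≫ g)† = f ≫ (g ≫ g†) ≫ f† := by
  simp

section Uniform

variable {C : Type u₁} [Category.{v₁} C] [CStarCategory C] [MonoidalCategory C]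
  {M : Type u₂} [Category.{v₂} M] [CStarCategory M] [MonoidalLeftAction C M]

/-- If `S* S` is a scalar then it equals `‖S‖²`; in particular the uniform norm is attained on the
irreducible objects. -/
theorem ModuleTrace.norm_sq_mul_sum (τ : ModuleTrace C M) [Fintype (Irr M)] [Nonempty (Irr M)]
    {K : BddEnd M} (S : 𝟙_ (BddEnd M) ⟶ K)
    (h : ∃ c : ℂ, ∀ X, BddEnd.app S X ≫ (BddEnd.app S X)† = c • 𝟙 X) :
    ((‖S‖ ^ 2 : ℝ) : ℂ) * ∑ i : Irr M, τ.dim i.rep * τ.dim i.rep =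
      ∑ i : Irr M, τ.dim i.rep * τ.tr i.rep (BddEnd.app S i.rep ≫ (BddEnd.app S i.rep)†) := by
  obtain ⟨c, hc⟩ := h
  have h1 : ∀ X, ‖BddEnd.app S X‖ ^ 2 = ‖c‖ * ‖𝟙 X‖ := fun X => by
    rw [← CStarCategory.norm_dagger_comp, hc, norm_smul]
  have h2 : ∀ X, ‖BddEnd.app S X‖ ≤ √‖c‖ := fun X => by
    apply Real.le_sqrt_of_sq_le
    rw [h1]
    exact mul_le_of_le_one_right (norm_nonneg c) (norm_id_le X)
  let i := Classical.arbitrary (Irr M)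
  have h3 : ‖S‖ = √‖c‖ := by
    refine le_antisymm (@ciSup_le _ _ _ ⟨i.rep⟩ _ _ h2) ?_
    have h4 : √‖c‖ = ‖BddEnd.app S i.rep‖ := by
      rw [← Real.sqrt_sq (norm_nonneg (BddEnd.app S i.rep)), h1, norm_id_eq_one i.rep_irreducible.1,
        mul_one]
    rw [h4]
    exact le_ciSup (f := fun X => ‖BddEnd.app S X‖) ⟨_, Set.forall_mem_range.2 h2⟩ i.rep
  have h4 : ∀ j : Irr M, τ.tr j.rep (BddEnd.app S j.rep ≫ (BddEnd.app S j.rep)†) =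
      c * τ.dim j.rep := fun j => by rw [hc, map_smul]; rfl
  have h5 : 0 ≤ c := by
    have : 0 ≤ c * τ.dim i.rep := (τ.tr_comp_dagger_nonneg (BddEnd.app S i.rep)).trans_eq (h4 i)
    exact le_of_mul_le_mul_right (by rwa [zero_mul]) (τ.dim_pos i)
  rw [h3, Real.sq_sqrt (norm_nonneg c), ← Complex.eq_coe_norm_of_nonneg h5, Finset.mul_sum]
  exact Finset.sum_congr rfl fun j _ => by rw [h4]; ring

/-- If `(t* t)² = 1` then `t* t = 1`: the self-adjoint `q = 1 - t* t` satisfies `q t* t q = - q²`, and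
both `q t* t q` and `q²` have nonnegative traces. -/
theorem ModuleTrace.comp_dagger_eq_id [∀ X Y : M, FiniteDimensional ℂ (X ⟶ Y)]
    (τ : ModuleTrace C M) {X Y : M} (t : X ⟶ Y)
    (h : (t ≫ t†) ≫ t ≫ t† = 𝟙 X) : t ≫ t† = 𝟙 X := by
  set q := 𝟙 X - t ≫ t† with hq
  have hqd : q† = q := by simp [hq, dagger_sub]
  have h1 : (q ≫ t) ≫ (q ≫ t)† + q ≫ q† = 0 := by
    rw [DaggerCategory.dagger_comp, hqd]
    have h2 : (t ≫ t†) ≫ q = - q := by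
      rw [hq, Preadditive.comp_sub, Category.comp_id, h]; abel
    rw [Category.assoc, ← Category.assoc t, h2, Preadditive.comp_neg, neg_add_cancel]
  have h2 := congrArg (τ.tr X) h1
  rw [map_add, map_zero] at h2
  have h3 := τ.tr_comp_dagger_nonneg (q ≫ t)
  have h4 := τ.tr_comp_dagger_nonneg q
  have h5 : q = 0 := τ.eq_zero_of_tr ((add_eq_zero_iff_of_nonneg h3 h4).1 h2).2
  exact (sub_eq_zero.1 h5).symm

end Uniform

section Standard

variable {C : Type u₁} [Category.{v₁} C] [CStarCategory C] [MonoidalCategory C]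
  {D : Type u₃} [Category.{v₃} D] [CStarCategory D] [MonoidalCategory D]
  {M : Type u₂} [Category.{v₂} M] [CStarCategory M] [MonoidalLeftAction C M]
  [MonoidalLeftAction D M] [CStarModuleCategory D M]

theorem ModEnd.exists_add_smul {F G : ModEnd D M} (x y : F ⟶ G) (c : ℂ) :
    ∃ z : F ⟶ G, ∀ X, BddEnd.app z.toHom X = BddEnd.app x.toHom X + c • BddEnd.app y.toHom X := by
  refine ⟨⟨⟨⟨fun X => BddEnd.app x.toHom X + c • BddEnd.app y.toHom X, fun X Y f => ?_⟩, ?_⟩,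
    fun U X => ?_⟩, fun X => rfl⟩
  · rw [Preadditive.comp_add, Preadditive.add_comp, Linear.comp_smul, Linear.smul_comp,
      BddEnd.naturality, BddEnd.naturality]
  · obtain ⟨K, hK⟩ := x.toHom.bounded
    obtain ⟨L, hL⟩ := y.toHom.bounded
    refine ⟨K + ‖c‖ * L, fun X => (norm_add_le _ _).trans (add_le_add (hK X) ?_)⟩
    rw [norm_smul]
    exact mul_le_mul_of_nonneg_left (hL X) (norm_nonneg c)
  · change F.str U X ≫ U ⊴ₗ (BddEnd.app x.toHom X + c • BddEnd.app y.toHom X) =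
      (BddEnd.app x.toHom (U ⊙ₗ X) + c • BddEnd.app y.toHom (U ⊙ₗ X)) ≫ G.str U X
    rw [CStarModuleCategory.actionRight_add, CStarModuleCategory.actionRight_smul,
      Preadditive.comp_add, Preadditive.add_comp, Linear.comp_smul, Linear.smul_comp, x.comm, y.comm]

variable [∀ X Y : M, FiniteDimensional ℂ (X ⟶ Y)]

/-- A linear functional `y ↦ ∑ d(i) tr(aᵢ yᵢ)` that vanishes on all `ζ* ζ`, with `a` a module natural
transformation, is zero; this is polarization. -/
theorem ModuleTrace.eq_zero_of_forall_positive [Fintype (Irr M)] (τ : ModuleTrace C M)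
    {F : ModEnd D M} (a : F ⟶ F)
    (h : ∀ ζ : F ⟶ F, ∑ i : Irr M, τ.dim i.rep * τ.tr _ (BddEnd.app a.toHom i.rep ≫
      BddEnd.app ζ.toHom i.rep ≫ (BddEnd.app ζ.toHom i.rep)†) = 0) (i : Irr M) :
    BddEnd.app a.toHom i.rep = 0 := by
  let ℓ : (∀ i : Irr M, F.toBddEnd.toFunctor.obj i.rep ⟶ F.toBddEnd.toFunctor.obj i.rep) →ₗ[ℂ] ℂ :=
    { toFun := fun y => ∑ i : Irr M, τ.dim i.rep * τ.tr _ (BddEnd.app a.toHom i.rep ≫ y i)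
      map_add' := fun y z => by
        simp only [Pi.add_apply, Preadditive.comp_add, map_add, mul_add, Finset.sum_add_distrib]
      map_smul' := fun c y => by
        simp only [Pi.smul_apply, Linear.comp_smul, map_smul, smul_eq_mul, Finset.mul_sum,
          RingHom.id_apply, mul_left_comm c] }
  have h1 : ∀ c : ℂ, c * ℓ (fun i : Irr M => (BddEnd.app a.toHom i.rep)†) +
      starRingEnd ℂ c * ℓ (fun i : Irr M => BddEnd.app a.toHom i.rep) = 0 := by
    intro c
    obtain ⟨z, hz⟩ := ModEnd.exists_add_smul (𝟙 F) a† c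
    have e0 : ℓ (fun i : Irr M => BddEnd.app z.toHom i.rep ≫ (BddEnd.app z.toHom i.rep)†) = 0 := h z
    have e1 : ℓ (fun i : Irr M => 𝟙 _) = 0 := by
      have := h (𝟙 F)
      simpa [ℓ] using this
    have e2 : ℓ (fun i : Irr M => (BddEnd.app a.toHom i.rep)† ≫ BddEnd.app a.toHom i.rep) = 0 := by
      have := h a†
      simpa [ℓ] using this
    have e3 : (fun i : Irr M => BddEnd.app z.toHom i.rep ≫ (BddEnd.app z.toHom i.rep)†) =
        (fun i : Irr M => 𝟙 _) + (c • (fun i : Irr M => (BddEnd.app a.toHom i.rep)†) +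
          starRingEnd ℂ c • (fun i : Irr M => BddEnd.app a.toHom i.rep)) +
        (c * starRingEnd ℂ c) •
          (fun i : Irr M => (BddEnd.app a.toHom i.rep)† ≫ BddEnd.app a.toHom i.rep) := by
      funext i
      rw [hz]
      simp only [ModEnd.id_toHom, BddEnd.id_app, ModEnd.dagger_toHom, BddEnd.dagger_app,
        dagger_add, dagger_smul, dagger_id, DaggerCategory.dagger_dagger, Preadditive.add_comp,
        Preadditive.comp_add, Linear.smul_comp, Linear.comp_smul, Category.id_comp,
        Category.comp_id, smul_add, mul_smul, smul_comm c, Pi.add_apply, Pi.smul_apply]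
      abel
    rw [e3, map_add, map_add, map_add, map_smul, map_smul, map_smul, e1, e2] at e0
    simpa using e0
  -- polarization: `ζ = 1 + c a*` for `c = 1` and `c = i`
  have h2 := h1 1
  have h3 := h1 Complex.I
  rw [Complex.conj_I] at h3
  simp only [map_one, one_mul] at h2
  have h4 : ℓ (fun i : Irr M => (BddEnd.app a.toHom i.rep)†) = 0 := by
    have h5 : 2 * Complex.I * ℓ (fun i : Irr M => (BddEnd.app a.toHom i.rep)†) = 0 := by
      linear_combination Complex.I * h2 + h3
    simpa using h5
  exact τ.sum_eq_zero_imp _ h4.le i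

variable [Finite (Irr M)] {τ : ModuleTrace C M}
  {F G F' : ModEnd D M} {R : 𝟙_ (ModEnd D M) ⟶ G ⊗ F} {R' : 𝟙_ (ModEnd D M) ⟶ F ⊗ G}
  {S : 𝟙_ (ModEnd D M) ⟶ F' ⊗ F} {S' : 𝟙_ (ModEnd D M) ⟶ F ⊗ F'}
  (A : TraceAdjunction τ F.toBddEnd.toFunctor G.toBddEnd.toFunctor)

theorem TraceAdjunction.isStandard_mod (hR : ∀ X, BddEnd.app R.toHom X = A.R X)
    (hR' : ∀ X, BddEnd.app R'.toHom X = A.R' X) (e : G ≅ F')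
    (he : ∀ i : Irr M, BddEnd.app e.hom.toHom i.rep ≫ (BddEnd.app e.hom.toHom i.rep)† = 𝟙 _)
    (h : IsConjugateSolution F F' (R ≫ e.hom ▷ F) (R' ≫ F ◁ e.inv†)) :
    τ.IsStandard F.toBddEnd F'.toBddEnd (R ≫ e.hom ▷ F).toHom (R' ≫ F ◁ e.inv†).toHom := by
  have := Fintype.ofFinite (Irr M)
  exact A.isStandard hR hR' ((ModEnd.forget D M).mapIso e) he
    ⟨congrArg ModEnd.Hom.toHom h.left_eq, congrArg ModEnd.Hom.toHom h.right_eq⟩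

/-- Two solutions differ by an isomorphism `e`; let `p = e* e` and let `k` be its mate.  The balance
of a solution reads `∑ d(i) tr((k - k⁻¹) η)ᵢ = 0`, whence `k = k⁻¹`, `p = p⁻¹` and `p = 1`. -/
theorem TraceAdjunction.isStandard_of_isModStandard (hR : ∀ X, BddEnd.app R.toHom X = A.R X)
    (hR' : ∀ X, BddEnd.app R'.toHom X = A.R' X) (hA : IsConjugateSolution F G R R')
    (h : τ.IsModStandard F F' S S') :
    τ.IsStandard F.toBddEnd F'.toBddEnd S.toHom S'.toHom := by
  have := Fintype.ofFinite (Irr M)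
  obtain ⟨e, rfl, rfl⟩ := hA.exists_iso h.solution
  let p : G ≅ G :=
    ⟨e.hom ≫ e.hom†, e.inv† ≫ e.inv, by
      rw [Category.assoc, reassoc_of% (dagger_hom_inv e), e.hom_inv_id], by
      rw [Category.assoc, e.inv_hom_id_assoc, dagger_inv_hom e]⟩
  obtain ⟨k, hk, hk'⟩ := hA.exists_mate p
  have hbal : ∀ ζ : F ⟶ F,
      ∑ i : Irr M, τ.dim i.rep * τ.tr _ (BddEnd.app (k.hom ≫ ζ ≫ ζ†).toHom i.rep) =
        ∑ i : Irr M, τ.dim i.rep * τ.tr _ (BddEnd.app ((ζ ≫ ζ†) ≫ k.inv).toHom i.rep) := by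
    intro ζ
    have h1 := h.balanced ζ
    have h2 := congrArg ModEnd.Hom.toHom (comp_whiskerRight_comp_dagger e.hom hk (ζ ≫ ζ†))
    have h3 := congrArg ModEnd.Hom.toHom (comp_whiskerLeft_comp_dagger e.inv hk' (ζ ≫ ζ†))
    have h4 := A.plancherel_left hR (k.hom ≫ ζ ≫ ζ†).toHom
    have h5 := A.plancherel_right hR' ((ζ ≫ ζ†) ≫ k.inv).toHom
    refine h4.symm.trans (Eq.trans ?_ h5)
    exact (congrArg τ.plancherel h2).symm.trans (Eq.trans h1 (congrArg τ.plancherel h3))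
  obtain ⟨a, ha⟩ := ModEnd.exists_add_smul k.hom k.inv (-1)
  have hk2 : ∀ i : Irr M, BddEnd.app k.hom.toHom i.rep = BddEnd.app k.inv.toHom i.rep := by
    intro i
    have := τ.eq_zero_of_forall_positive a (fun ζ => ?_) i
    · rw [ha, neg_one_smul, ← sub_eq_add_neg] at this
      exact sub_eq_zero.1 this
    · have h1 := hbal ζ
      simp only [ModEnd.comp_toHom, BddEnd.comp_app, ModEnd.dagger_toHom, BddEnd.dagger_app] at h1
      simp only [ha, neg_one_smul, Preadditive.add_comp, Preadditive.neg_comp, map_add, map_neg,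
        mul_add, mul_neg, Finset.sum_add_distrib, Finset.sum_neg_distrib]
      rw [h1, ← sub_eq_add_neg, sub_eq_zero]
      exact Finset.sum_congr rfl fun i _ => congrArg (τ.dim i.rep * ·) (τ.tr_swap _ _)
  have hk3 : k.hom = k.inv := ModEnd.hom_ext (BddEnd.hom_ext fun X =>
    natural_ext (F := F.toBddEnd.toFunctor) (G := F.toBddEnd.toFunctor)
      (x := fun X => BddEnd.app k.hom.toHom X) (y := fun X => BddEnd.app k.inv.toHom X)
      (fun f => BddEnd.naturality k.hom.toHom f) (fun f => BddEnd.naturality k.inv.toHom f) hk2 X)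
  -- transposition turns `k² = 1` into `p² = 1`
  have hpp : R ≫ (p.hom ≫ p.hom) ▷ F = R := by
    rw [comp_whiskerRight, reassoc_of% hk, whisker_exchange, reassoc_of% hk, ← whiskerLeft_comp,
      show k.hom ≫ k.hom = 𝟙 F from (congrArg (k.hom ≫ ·) hk3).trans k.hom_inv_id, whiskerLeft_id,
      Category.comp_id]
  have hp : ∀ Y, BddEnd.app (p.hom ≫ p.hom).toHom Y = 𝟙 _ := by
    intro Y
    have h1 : ∀ X, A.R X ≫ BddEnd.app (p.hom ≫ p.hom).toHom (F.toBddEnd.toFunctor.obj X) = A.R X :=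
      fun X => by
        have := congrArg (fun t => BddEnd.app (ModEnd.Hom.toHom t) X) hpp
        rw [← hR]
        exact this
    have h2 := BddEnd.naturality (p.hom ≫ p.hom).toHom (A.R' Y)†
    rw [← Category.id_comp (BddEnd.app (p.hom ≫ p.hom).toHom Y), ← A.right_zigzag, Category.assoc,
      h2, reassoc_of% h1]
  exact A.isStandard_mod hR hR' e (fun i => τ.comp_dagger_eq_id _ (hp i.rep)) h.solution

/-- When the unit is simple, the squared norms of a solution that differs from the adjunction by `e`
are, up to a common factor, `∑ d(j) tr(e* e)ⱼ` and `∑ d(j) tr((e* e)⁻¹)ⱼ`.  Their sum is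
minimal only if `e* e = 1`. -/
theorem TraceAdjunction.isStandard_of_isStandardSolution
    (hR : ∀ X, BddEnd.app R.toHom X = A.R X)
    (hR' : ∀ X, BddEnd.app R'.toHom X = A.R' X) (hA : IsConjugateSolution F G R R')
    (hu : HasSimpleUnit (ModEnd D M)) (h : IsStandardSolution F F' S S') :
    τ.IsStandard F.toBddEnd F'.toBddEnd S.toHom S'.toHom := by
  have := Fintype.ofFinite (Irr M)
  obtain ⟨e, rfl, rfl⟩ := hA.exists_iso h.solution
  refine A.isStandard_mod hR hR' e (fun i => ?_) h.solution
  have : Nonempty (Irr M) := ⟨i⟩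
  have hsc : ∀ {K : ModEnd D M} (S : 𝟙_ (ModEnd D M) ⟶ K),
      ∃ c : ℂ, ∀ X, BddEnd.app S.toHom X ≫ (BddEnd.app S.toHom X)† = c • 𝟙 X := by
    intro K S
    obtain ⟨c, hc⟩ := hu (S ≫ S†)
    exact ⟨c, fun X => congrArg (fun t => BddEnd.app (ModEnd.Hom.toHom t) X) hc⟩
  set N : ℂ := ∑ i : Irr M, τ.dim i.rep * τ.dim i.rep with hN
  have hNpos : 0 < N :=
    Finset.sum_pos (fun i _ => mul_pos (τ.dim_pos i) (τ.dim_pos i)) Finset.univ_nonempty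
  have hleft : ∀ {K : ModEnd D M} (x : G ⟶ K), ((‖R ≫ x ▷ F‖ ^ 2 : ℝ) : ℂ) * N =
      ∑ i : Irr M, τ.dim i.rep * τ.tr _ (BddEnd.app x.toHom i.rep ≫ (BddEnd.app x.toHom i.rep)†) := by
    intro K x
    have h1 := A.flip.balance (𝟭 M) (fun X => BddEnd.app (x ≫ x†).toHom X)
      (fun f => BddEnd.naturality (x ≫ x†).toHom _)
    refine (τ.norm_sq_mul_sum _ (hsc (R ≫ x ▷ F))).trans (Eq.trans ?_ h1.symm)
    refine Finset.sum_congr rfl fun j _ => congrArg (fun t => τ.dim j.rep * τ.tr _ t) ?_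
    have h2 : BddEnd.app (R ≫ x ▷ F).toHom j.rep = A.R j.rep ≫
        BddEnd.app x.toHom (F.toBddEnd.toFunctor.obj j.rep) := by
      rw [← hR]; rfl
    exact (congrArg (fun t => t ≫ t†) h2).trans (comp_comp_dagger (A.R j.rep) _)
  have hright : ∀ {K : ModEnd D M} (x : G ⟶ K), ((‖R' ≫ F ◁ x‖ ^ 2 : ℝ) : ℂ) * N =
      ∑ i : Irr M, τ.dim i.rep * τ.tr _ (BddEnd.app x.toHom i.rep ≫ (BddEnd.app x.toHom i.rep)†) := by
    intro K x
    refine (τ.norm_sq_mul_sum _ (hsc (R' ≫ F ◁ x))).trans ?_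
    refine Finset.sum_congr rfl fun j _ => congrArg (τ.dim j.rep * ·) ?_
    have h2 : BddEnd.app (R' ≫ F ◁ x).toHom j.rep = A.R' j.rep ≫
        F.toBddEnd.toFunctor.map (BddEnd.app x.toHom j.rep) := by
      rw [← hR']; rfl
    refine Eq.trans ?_ (A.flip.tr_eq _).symm
    rw [F.toBddEnd.toFunctor.map_comp, IsCStarFunctor.map_dagger]
    exact congrArg (τ.tr j.rep) ((congrArg (fun t => t ≫ t†) h2).trans
      (comp_comp_dagger (A.R' j.rep) _))
  have hR1 := hleft (𝟙 G)
  have hR2 := hright (𝟙 G)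
  have hS1 := hleft e.hom
  have hS2 := hright e.inv†
  rw [id_whiskerRight, Category.comp_id] at hR1
  rw [whiskerLeft_id, Category.comp_id] at hR2
  have hRR : ‖R‖ ^ 2 = ‖R'‖ ^ 2 := by
    have := mul_right_cancel₀ hNpos.ne' (hR1.trans hR2.symm)
    exact_mod_cast this
  have hn : ∀ {K L : ModEnd D M} (x : K ⟶ L), 0 ≤ ‖x‖ := fun x =>
    Real.iSup_nonneg fun X => norm_nonneg _
  -- the adjunction is itself a solution, with equal norms, hence bounds the infimum
  have hd : categoricalDim F ≤ ‖R‖ ^ 2 := by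
    refine csInf_le ⟨0, ?_⟩ ⟨G, R, R', hA, ?_⟩
    · rintro _ ⟨_, _, _, -, rfl⟩
      exact mul_nonneg (hn _) (hn _)
    · rw [← (sq_eq_sq₀ (hn R) (hn R')).1 hRR, sq]
  rw [h.norm_left] at hS1
  rw [h.norm_right] at hS2
  have hle : ((categoricalDim F : ℝ) : ℂ) * N ≤ ((‖R‖ ^ 2 : ℝ) : ℂ) * N :=
    mul_le_mul_of_nonneg_right (by exact_mod_cast hd) hNpos.le
  have hE : ∀ i : Irr M, BddEnd.app e.hom.toHom i.rep - (BddEnd.app e.inv.toHom i.rep)† = 0 := by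
    refine τ.sum_eq_zero_imp _ ?_
    have h1 : ∀ i : Irr M, τ.tr _ ((BddEnd.app e.hom.toHom i.rep - (BddEnd.app e.inv.toHom i.rep)†) ≫
        (BddEnd.app e.hom.toHom i.rep - (BddEnd.app e.inv.toHom i.rep)†)†) =
        τ.tr _ (BddEnd.app e.hom.toHom i.rep ≫ (BddEnd.app e.hom.toHom i.rep)†) +
        τ.tr _ (BddEnd.app (e.inv†).toHom i.rep ≫ (BddEnd.app (e.inv†).toHom i.rep)†) -
        2 * τ.tr _ (BddEnd.app (𝟙 G : G ⟶ G).toHom i.rep ≫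
          (BddEnd.app (𝟙 G : G ⟶ G).toHom i.rep)†) := by
      intro i
      have h2 : BddEnd.app e.hom.toHom i.rep ≫ BddEnd.app e.inv.toHom i.rep = 𝟙 _ :=
        congrArg (fun t => BddEnd.app (ModEnd.Hom.toHom t) i.rep) e.hom_inv_id
      have h3 := congrArg (fun t => t†) h2
      simp only [DaggerCategory.dagger_comp, dagger_id] at h3
      simp only [dagger_sub, DaggerCategory.dagger_dagger, Preadditive.sub_comp,
        Preadditive.comp_sub, h2, h3, map_sub, ModEnd.dagger_toHom, BddEnd.dagger_app,
        ModEnd.id_toHom, BddEnd.id_app, dagger_id, Category.comp_id]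
      ring
    simp only [h1, mul_sub, mul_add, Finset.sum_sub_distrib, Finset.sum_add_distrib,
      mul_left_comm _ (2 : ℂ), ← Finset.mul_sum]
    rw [← hS1, ← hS2, ← hR1]
    have := sub_nonpos.2 hle
    calc _ = 2 * (((categoricalDim F : ℝ) : ℂ) * N - ((‖R‖ ^ 2 : ℝ) : ℂ) * N) := by ring
      _ ≤ 2 * 0 := mul_le_mul_of_nonneg_left this (by norm_num)
      _ = 0 := mul_zero _
  have h2 : BddEnd.app e.hom.toHom i.rep ≫ BddEnd.app e.inv.toHom i.rep = 𝟙 _ :=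
    congrArg (fun t => BddEnd.app (ModEnd.Hom.toHom t) i.rep) e.hom_inv_id
  have h3 : (BddEnd.app e.hom.toHom i.rep)† = BddEnd.app e.inv.toHom i.rep := by
    rw [sub_eq_zero.1 (hE i), DaggerCategory.dagger_dagger]
  rw [h3, h2]

end Standard

end CStarCat

end

/-- `M` is a tracial `C`-module category with finitely many irreducible objects, `Θ : D ⥤ C` a
C*-tensor functor, and `ModEnd D M` is the category of bounded `D`-module endofunctors of `M`. -/
theorem theorem4p12
    {C : Type*} [Category* C] [CStarCategory C] [MonoidalCategory C]
    [CStarTensorCategory C] (hC : IsRigid C)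
    {D : Type*} [Category* D] [CStarCategory D] [MonoidalCategory D]
    [CStarTensorCategory D] (hD : IsRigid D)
    (Θ : D ⥤ C) [Θ.Monoidal] [IsCStarTensorFunctor Θ]
    {M : Type*} [Category* M] [CStarCategory M] [MonoidalLeftAction C M]
    [CStarModuleCategory C M] (τ : ModuleTrace C M) [Finite (Irr M)] :
    letI : MonoidalLeftAction D M := restrictAction Θ M
    haveI : CStarModuleCategory D M := restrictAction_isModule Θ
    IsRigid (ModEnd D M) ∧
    (∀ (F F' : ModEnd D M) (R : 𝟙_ (ModEnd D M) ⟶ F' ⊗ F) (R' : 𝟙_ (ModEnd D M) ⟶ F ⊗ F'),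
      τ.IsModStandard F F' R R' →
        τ.IsStandard F.toBddEnd F'.toBddEnd R.toHom R'.toHom) ∧
    (HasSimpleUnit (ModEnd D M) →
      ∀ (F F' : ModEnd D M) (R : 𝟙_ (ModEnd D M) ⟶ F' ⊗ F) (R' : 𝟙_ (ModEnd D M) ⟶ F ⊗ F'),
        IsStandardSolution F F' R R' →
          τ.IsStandard F.toBddEnd F'.toBddEnd R.toHom R'.toHom) := by
  let _ : MonoidalLeftAction D M := restrictAction Θ M
  have _ : CStarModuleCategory D M := restrictAction_isModule Θ
  have _ : ∀ X Y : M, FiniteDimensional ℂ (X ⟶ Y) := CStarModuleCategory.finiteDimensional C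
  have hsol : ∀ F : ModEnd D M, ∃ (F' : ModEnd D M) (R : 𝟙_ (ModEnd D M) ⟶ F' ⊗ F)
      (R' : 𝟙_ (ModEnd D M) ⟶ F ⊗ F')
      (A : TraceAdjunction τ F.toBddEnd.toFunctor F'.toBddEnd.toFunctor),
      IsConjugateSolution F F' R R' ∧ (∀ X, BddEnd.app R.toHom X = A.R X) ∧
        ∀ X, BddEnd.app R'.toHom X = A.R' X := by
    intro F
    obtain ⟨G, _, ⟨adj⟩⟩ := exists_traceAdjunction τ F.toBddEnd.toFunctor
    exact F.exists_solution adj (isUnitary_mateStr Θ hC hD F adj)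
  refine ⟨fun F => ?_, fun F F' S S' h => ?_, fun hu F F' S S' h => ?_⟩
  · obtain ⟨F', R, R', -, h, -⟩ := hsol F
    exact ⟨F', R, R', h⟩
  · obtain ⟨G, R, R', A, hA, hR, hR'⟩ := hsol F
    exact A.isStandard_of_isModStandard hR hR' hA h
  · obtain ⟨G, R, R', A, hA, hR, hR'⟩ := hsol F
    exact A.isStandard_of_isStandardSolution hR hR' hA hu h
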